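/- **Setting.** Let $A\to Q$ be a real vector bundle of finite rank over a finite-dimensional smooth (Hausdorff, second countable) manifold, carrying a Lie algebroid structure: a smooth bundle map $\rho\colon A\to TQ$ over the identity (the anchor) and a Lie bracket $[\cdot,\cdot]$ on $\Gamma(A)$ with $[X,fY]=(\rho(X)[f])\,Y+f[X,Y]$. Let $\nabla$ be a (smooth) $TQ$-connection on $A$, and let $\nabla^*$ be the dual connection on $A^*$. Define the $A$-connection $\overline\nabla_XY=\nabla_{\rho(Y)}X+[X,Y]$ on $A$, and its dual $\overline\nabla^*$ on $A^*$ by $\langle\overline\nabla^*_X\sigma,Y\rangle=\rho(X)[\langle\sigma,Y\rangle]-\langle\sigma,\overline\nabla_XY\rangle$. For a path $u$ over the same base path $q$ as $a$, an $A$-connection $D$ gives $(D_au)(t)=\partial_t\eta(t,q(t))+D_\xi\eta(t,q(t))$, where $\xi,\eta$ are time-dependent sections extending $a,u$. The connections $\nabla$, $\nabla^*$ split the tangent spaces of $A$ and $A^*$ into vertical and horizontal parts, with $V_z w=\frac{d}{d\epsilon}(z+\epsilon w)|_{\epsilon=0}$ and $H_z v=T\xi(v)-V_z(\nabla_v\xi)$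 for any section $\xi$ through $z$ (with $\nabla^*$ in place of $\nabla$ on $A^*$). For a smooth function $G$ on either bundle put $\mathrm dG^{\mathrm{ver}}(z)=V_z^*\,\mathrm dG(z)$ (the fibre derivative) and $\mathrm dG^{\mathrm{hor}}(z)=H_z^*\,\mathrm dG(z)\in T^*Q$. Let $I=[t_0,t_1]$, $t_0<t_1$. An *$A$-path* is a $C^1$ path $a\colon I\to A$ with $C^2$ base path $q$ such that $\dot q=\rho(a)$. An *$(A\oplus A^*)$-path* is a $C^1$ path $(a,p)\colon I\to A\oplus A^*$ over a $C^2$ base path $q$ such that $a$ is an $A$-path. An *admissible variation* of $a$ is a variation $\delta a$ with vertical component $\overline\nabla_ab$ and horizontal component $\rho(b)$, where $b$ is a $C^1$ path in $A$ over $q$ vanishing at the endpoints of $I$. An admissible variation of $(a,p)$ consists of such a $\delta a$ together with a variation $\delta p$ with horizontal component $\rho(b)$ and vertical component $r$, for an arbitrary $C^1$ path $r$ in $A^*$ over $q$. The statement $\delta S=0$ with respect to admissible variations means that $\frac{d}{d\epsilon}S|_{\epsilon=0}=0$ along every $C^1$ homotopy of $A$-paths (respectively $(A\oplus A^*)$-paths)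 that starts at the given path and whose velocity at $\epsilon=0$ is an admissible variation. **Theorem.** Let $(a,p)$ be an $(A\oplus A^*)$-path. Fix a choice of sign; the upper signs, or the lower signs, are used throughout. Given $H\in C^\infty(A^*)$, the following are equivalent: (i) $\displaystyle \delta\int_I\bigl(\langle p,a\rangle\pm H(p)\bigr)\,dt=0$ with respect to admissible variations of $(A\oplus A^*)$-paths; (ii) the generalized Lie–Poisson equations $\overline\nabla{}^*_a\,p=\pm\rho^*\bigl(\mathrm dH^{\mathrm{hor}}(p)\bigr)$ hold with $a=\mp\,\mathrm dH^{\mathrm{ver}}(p)$. Given $L\in C^\infty(A)$, the following are equivalent: (iii) $\displaystyle \delta\int_I L(a)\,dt=0$ with respect to admissible variations of $A$-paths, and $p=\mathrm dL^{\mathrm{ver}}(a)$; (iv) the Euler–Lagrange–Poincaré equations $\overline\nabla{}^*_a\,p=\rho^*\bigl(\mathrm dL^{\mathrm{hor}}(a)\bigr)$ hold with $p=\mathrm dL^{\mathrm{ver}}(a)$. Moreover, all of (i)–(iv) are equivalent in either of the following hyperregular situations: - $H\in C^\infty(A^*)$ is such that $\mathrm dH^{\mathrm{ver}}\colon A^*\to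 A$ is a diffeomorphism, and $L$ is defined by $L(a)=\langle p,a\rangle\pm H(p)$, where $p$ is determined by $a=\mp\,\mathrm dH^{\mathrm{ver}}(p)$; - $L\in C^\infty(A)$ is such that $\mathrm dL^{\mathrm{ver}}\colon A\to A^*$ is a diffeomorphism, and $H$ is defined by $H(p)=\mp\bigl(\langle p,a\rangle-L(a)\bigr)$, where $a$ is determined by $p=\mathrm dL^{\mathrm{ver}}(a)$. -/

import Mathlib

open Bundle Set
open scoped Manifold ContDiff Topology

noncomputable section

namespace LieAlgebroidMechanics

set_option linter.unusedSectionVars false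

/-- The fibre over `x` of the dual bundle `A*`. -/
abbrev DualFiber {Q : Type*} (V : Q → Type*) [∀ x, AddCommGroup (V x)] [∀ x, Module ℝ (V x)]
    [∀ x, TopologicalSpace (V x)] (x : Q) : Type _ := V x →L[ℝ] ℝ

section Sections

variable {E : Type*} [NormedAddCommGroup E] [NormedSpace ℝ E]
  {Q : Type*} [TopologicalSpace Q] [ChartedSpace E Q]
  {F : Type*} [NormedAddCommGroup F] [NormedSpace ℝ F]
  {V : Q → Type*} [TopologicalSpace (TotalSpace F V)]
  [∀ x, AddCommGroup (V x)] [∀ x, Module ℝ (V x)] [∀ x, TopologicalSpace (V x)]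
  [FiberBundle F V] [VectorBundle ℝ F V]

/-- Smooth functions act on smooth sections. -/
instance fsmul : SMul C^∞⟮𝓘(ℝ, E), Q; ℝ⟯ Cₛ^∞⟮𝓘(ℝ, E); F, V⟯ where
  smul f s := ⟨fun x => f x • s x, f.contMDiff.smul_section s.contMDiff⟩

@[simp] lemma fsmul_apply (f : C^∞⟮𝓘(ℝ, E), Q; ℝ⟯) (s : Cₛ^∞⟮𝓘(ℝ, E); F, V⟯) (x : Q) :
    (f • s) x = f x • s x := rfl

lemma exists_section_eventuallyEq [FiniteDimensional ℝ E] [T2Space Q] [IsManifold 𝓘(ℝ, E) ∞ Q]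
    {u : Set Q} (hu : IsOpen u) {x : Q} (hx : x ∈ u) {σ : ∀ y, V y}
    (hσ : ContMDiffOn 𝓘(ℝ, E) (𝓘(ℝ, E).prod 𝓘(ℝ, F)) ∞ (fun y => (⟨y, σ y⟩ : TotalSpace F V)) u) :
    ∃ s : Cₛ^∞⟮𝓘(ℝ, E); F, V⟯, ∀ᶠ y in 𝓝 x, s y = σ y := by
  obtain ⟨ψ, -, hψ⟩ := (SmoothBumpFunction.nhds_basis_tsupport (I := 𝓘(ℝ, E)) x).mem_iff.1
    (hu.mem_nhds hx)
  refine ⟨⟨(ψ : Q → ℝ) • σ, ?_⟩, ?_⟩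
  · exact ContMDiffOn.smul_section_of_tsupport (ψ.contMDiff.contMDiffOn) hu hψ hσ
  · filter_upwards [ψ.eventuallyEq_one] with y hy
    simp only [ContMDiffSection.coeFn_mk, Pi.smul_apply']
    rw [hy]; simp

lemma exists_function_eventuallyEq [FiniteDimensional ℝ E] [T2Space Q] [IsManifold 𝓘(ℝ, E) ∞ Q]
    {u : Set Q} (hu : IsOpen u) {x : Q} (hx : x ∈ u) {g : Q → ℝ}
    (hg : ContMDiffOn 𝓘(ℝ, E) 𝓘(ℝ, ℝ) ∞ g u) :
    ∃ f : C^∞⟮𝓘(ℝ, E), Q; ℝ⟯, ∀ᶠ y in 𝓝 x, f y = g y := by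
  obtain ⟨ψ, -, hψ⟩ := (SmoothBumpFunction.nhds_basis_tsupport (I := 𝓘(ℝ, E)) x).mem_iff.1
    (hu.mem_nhds hx)
  refine ⟨⟨fun y => ψ y • g y, ?_⟩, ?_⟩
  · refine contMDiff_of_tsupport fun y hy => ?_
    have hy' : y ∈ u := hψ (closure_mono (Function.support_smul_subset_left _ _) hy)
    exact ψ.contMDiffAt.smul ((hg y hy').contMDiffAt (hu.mem_nhds hy'))
  · filter_upwards [ψ.eventuallyEq_one] with y hy
    simp only [ContMDiffMap.coeFn_mk]
    rw [hy]; simp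

section Tensor
variable [FiniteDimensional ℝ E] [T2Space Q] [IsManifold 𝓘(ℝ, E) ∞ Q] [FiniteDimensional ℝ F]
  [ContMDiffVectorBundle ∞ F V 𝓘(ℝ, E)]

lemma exists_section_apply_eq (x : Q) (w : V x) : ∃ s : Cₛ^∞⟮𝓘(ℝ, E); F, V⟯, s x = w := by
  obtain ⟨u, hu, h⟩ := FiberBundle.exists_contMDiffOn_extend (k := ∞) 𝓘(ℝ, E) F w
  obtain ⟨u', hu', ho, hx⟩ := mem_nhds_iff.1 hu
  obtain ⟨s, hs⟩ := exists_section_eventuallyEq ho hx (h.mono hu')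
  exact ⟨s, by simpa using hs.self_of_nhds⟩

/-- A `C^∞`-linear map from sections to smooth functions. -/
structure IsFunctionLinear (Θ : Cₛ^∞⟮𝓘(ℝ, E); F, V⟯ → C^∞⟮𝓘(ℝ, E), Q; ℝ⟯) : Prop where
  add : ∀ s s', Θ (s + s') = Θ s + Θ s'
  smul : ∀ (f : C^∞⟮𝓘(ℝ, E), Q; ℝ⟯) s, Θ (f • s) = f * Θ s

variable {Θ : Cₛ^∞⟮𝓘(ℝ, E); F, V⟯ → C^∞⟮𝓘(ℝ, E), Q; ℝ⟯}

namespace IsFunctionLinear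

lemma map_zero (h : IsFunctionLinear Θ) : Θ 0 = 0 := by
  have := h.add 0 0
  simpa using this

lemma map_sub (h : IsFunctionLinear Θ) (s s') : Θ (s - s') = Θ s - Θ s' := by
  have := h.add (s - s') s'
  rw [sub_add_cancel] at this
  rw [this, add_sub_cancel_right]

lemma map_sum (h : IsFunctionLinear Θ) {ι : Type*} (t : Finset ι)
    (s : ι → Cₛ^∞⟮𝓘(ℝ, E); F, V⟯) : Θ (∑ i ∈ t, s i) = ∑ i ∈ t, Θ (s i) := by
  classical
  induction t using Finset.induction_on with
  | empty => simpa using h.map_zero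
  | insert i t hi ih => rw [Finset.sum_insert hi, h.add, ih, Finset.sum_insert hi]

lemma local_zero (h : IsFunctionLinear Θ) {x : Q} {s : Cₛ^∞⟮𝓘(ℝ, E); F, V⟯}
    (hs : ∀ᶠ y in 𝓝 x, s y = 0) : Θ s x = 0 := by
  obtain ⟨ψ, -, hψ⟩ := (SmoothBumpFunction.nhds_basis_tsupport (I := 𝓘(ℝ, E)) x).mem_iff.1 hs
  let f : C^∞⟮𝓘(ℝ, E), Q; ℝ⟯ := ⟨ψ, ψ.contMDiff⟩
  have h0 : f • s = 0 := by
    ext y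
    by_cases hy : y ∈ tsupport ψ
    · have : s y = 0 := hψ hy
      simp [this]
    · have : f y = 0 := image_eq_zero_of_notMem_tsupport hy
      simp [this]
  have := h.smul f s
  rw [h0, h.map_zero] at this
  have h1 := congrArg (fun g : C^∞⟮𝓘(ℝ, E), Q; ℝ⟯ => g x) this
  have hf : f x = 1 := ψ.eq_one
  simpa [hf] using h1.symm

lemma local_eq (h : IsFunctionLinear Θ) {x : Q} {s s' : Cₛ^∞⟮𝓘(ℝ, E); F, V⟯}
    (hs : ∀ᶠ y in 𝓝 x, s y = s' y) : Θ s x = Θ s' x := by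
  have := h.local_zero (s := s - s') (x := x) (hs.mono fun y hy => by simp [hy])
  rw [h.map_sub] at this
  exact sub_eq_zero.1 this

lemma apply_eq_of_eq (h : IsFunctionLinear Θ) {x : Q} {s s' : Cₛ^∞⟮𝓘(ℝ, E); F, V⟯}
    (hs : s x = s' x) : Θ s x = Θ s' x := by
  suffices H : ∀ s : Cₛ^∞⟮𝓘(ℝ, E); F, V⟯, s x = 0 → Θ s x = 0 by
    have := H (s - s') (by simp [hs])
    rw [h.map_sub] at this
    exact sub_eq_zero.1 this
  clear hs s s'
  intro s hs
  let t := trivializationAt F V x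
  have ht : x ∈ t.baseSet := FiberBundle.mem_baseSet_trivializationAt F V x
  let b := Module.Basis.ofVectorSpace ℝ F
  have he : ∀ i, ∃ e : Cₛ^∞⟮𝓘(ℝ, E); F, V⟯, ∀ᶠ y in 𝓝 x, e y = t.localFrame b i y := fun i =>
    exists_section_eventuallyEq t.open_baseSet ht (t.contMDiffOn_localFrame_baseSet ∞ b i)
  choose e he using he
  have hc : ∀ i, ∃ c : C^∞⟮𝓘(ℝ, E), Q; ℝ⟯,
      ∀ᶠ y in 𝓝 x, c y = t.localFrameCoeff 𝓘(ℝ, E) b i y (s y) := fun i =>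
    exists_function_eventuallyEq t.open_baseSet ht
      (contMDiffOn_baseSet_localFrameCoeff b s.contMDiff.contMDiffOn i)
  choose c hc using hc
  have key : ∀ᶠ y in 𝓝 x, s y = (∑ i, c i • e i : Cₛ^∞⟮𝓘(ℝ, E); F, V⟯) y := by
    filter_upwards [Filter.eventually_all.2 he, Filter.eventually_all.2 hc,
      t.eventually_eq_localFrame_sum_coeff_smul (I := 𝓘(ℝ, E)) (s := s) b ht] with y h1 h2 h3
    have : (∑ i, c i • e i : Cₛ^∞⟮𝓘(ℝ, E); F, V⟯) y = ∑ i, (c i • e i) y := by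
      have := congrFun (_root_.map_sum (ContMDiffSection.coeAddHom 𝓘(ℝ, E) F ∞ V)
        (fun i => c i • e i) Finset.univ) y
      rw [Finset.sum_apply] at this
      exact this
    rw [this, h3]
    exact Finset.sum_congr rfl fun i _ => by rw [fsmul_apply, h1, h2]
  rw [h.local_eq key, h.map_sum]
  have : ∀ i, (Θ (c i • e i)) x = 0 := by
    intro i
    rw [h.smul]
    have : c i x = 0 := by rw [(hc i).self_of_nhds, hs, _root_.map_zero]
    simp [this]
  have h2 : (∑ i, Θ (c i • e i)) x = ∑ i, Θ (c i • e i) x := by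
    have := congrFun (_root_.map_sum (ContMDiffMap.coeFnAddMonoidHom (I := 𝓘(ℝ, E)) (I' := 𝓘(ℝ, ℝ)) (N := Q) (G := ℝ) (n := ∞))
        (fun i => Θ (c i • e i)) Finset.univ) x
    simpa using this
  rw [h2]; exact Finset.sum_eq_zero fun i _ => this i

/-- The covector at `x` induced by a `C^∞`-linear map `Θ`, with `⟨covector x, s x⟩ = Θ s x`. -/
def covector [∀ x, IsTopologicalAddGroup (V x)] [∀ x, ContinuousSMul ℝ (V x)]
    (h : IsFunctionLinear Θ) (x : Q) : V x →L[ℝ] ℝ :=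
  have : T2Space (V x) := FiberBundle.t2Space F V x
  have : FiniteDimensional ℝ (V x) := VectorBundle.finiteDimensional ℝ F V x
  LinearMap.toContinuousLinearMap
    { toFun := fun w => Θ (exists_section_apply_eq (E := E) (F := F) x w).choose x
      map_add' := fun w w' => by
        have h1 := (exists_section_apply_eq (E := E) (F := F) x w).choose_spec
        have h2 := (exists_section_apply_eq (E := E) (F := F) x w').choose_spec
        have h3 := (exists_section_apply_eq (E := E) (F := F) x (w + w')).choose_spec
        refine Eq.trans ?_ (congrArg (fun g : C^∞⟮𝓘(ℝ, E), Q; ℝ⟯ => g x) (h.add _ _))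
        exact h.apply_eq_of_eq (by rw [h3, ContMDiffSection.coe_add, Pi.add_apply, h1, h2])
      map_smul' := fun c w => by
        have h1 := (exists_section_apply_eq (E := E) (F := F) x w).choose_spec
        have h3 := (exists_section_apply_eq (E := E) (F := F) x (c • w)).choose_spec
        let f : C^∞⟮𝓘(ℝ, E), Q; ℝ⟯ := ⟨fun _ => c, contMDiff_const⟩
        have := h.apply_eq_of_eq (x := x) (s := (exists_section_apply_eq (E := E) (F := F) x (c • w)).choose)
          (s' := f • (exists_section_apply_eq (E := E) (F := F) x w).choose)
          (by rw [h3, fsmul_apply, h1]; rfl)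
        rw [this, h.smul]
        rfl }

lemma covector_apply [∀ x, IsTopologicalAddGroup (V x)] [∀ x, ContinuousSMul ℝ (V x)]
    (h : IsFunctionLinear Θ) (x : Q) (s : Cₛ^∞⟮𝓘(ℝ, E); F, V⟯) :
    h.covector x (s x) = Θ s x :=
  h.apply_eq_of_eq (exists_section_apply_eq (E := E) (F := F) x (s x)).choose_spec

lemma contMDiff_covector [∀ x, IsTopologicalAddGroup (V x)] [∀ x, ContinuousSMul ℝ (V x)]
    (h : IsFunctionLinear Θ) :
    ContMDiff 𝓘(ℝ, E) (𝓘(ℝ, E).prod 𝓘(ℝ, F →L[ℝ] ℝ)) ∞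
      (fun x => (⟨x, h.covector x⟩ : TotalSpace (F →L[ℝ] ℝ) (DualFiber V))) := by
  intro x
  rw [contMDiffAt_hom_bundle]
  refine ⟨contMDiffAt_id, ?_⟩
  let t := trivializationAt F V x
  have ht : x ∈ t.baseSet := FiberBundle.mem_baseSet_trivializationAt F V x
  let b := Module.Basis.ofVectorSpace ℝ F
  have he : ∀ i, ∃ e : Cₛ^∞⟮𝓘(ℝ, E); F, V⟯, ∀ᶠ y in 𝓝 x, e y = t.localFrame b i y := fun i =>
    exists_section_eventuallyEq t.open_baseSet ht (t.contMDiffOn_localFrame_baseSet ∞ b i)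
  choose e he using he
  have hsm : ContMDiffAt 𝓘(ℝ, E) 𝓘(ℝ, F →L[ℝ] ℝ) ∞
      (fun y => ∑ i, Θ (e i) y • (LinearMap.toContinuousLinearMap (b.coord i))) x := by
    refine ContMDiffAt.sum fun i _ => ?_
    exact (Θ (e i)).contMDiff.contMDiffAt.smul contMDiffAt_const
  refine hsm.congr_of_eventuallyEq ?_
  filter_upwards [Filter.eventually_all.2 he, t.open_baseSet.mem_nhds ht] with y h1 h2
  ext v
  apply LinearMap.congr_fun (f := (ContinuousLinearMap.inCoordinates F V ℝ (fun _ => ℝ) x y x y (h.covector y)).toLinearMap)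
    (g := (∑ i, Θ (e i) y • (LinearMap.toContinuousLinearMap (b.coord i)) : F →L[ℝ] ℝ).toLinearMap)
  refine b.ext fun i => ?_
  have h3 : e i y = t.symm y (b i) := by
    rw [h1 i, t.localFrame_apply_of_mem_baseSet b h2]; simp [Trivialization.basisAt]
  have h4 : h.covector y (t.symm y (b i)) = Θ (e i) y := by rw [← h3, h.covector_apply]
  have h5 : (t.symmL ℝ y) (b i) = t.symm y (b i) := by
    rw [t.symmL_apply]; exact h2
  have hL : (ContinuousLinearMap.inCoordinates F V ℝ (fun _ => ℝ) x y x y (h.covector y)) (b i)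
      = h.covector y (t.symm y (b i)) := by
    simp [ContinuousLinearMap.inCoordinates]
    exact congrArg _ h5
  have hR : (∑ j, Θ (e j) y • (LinearMap.toContinuousLinearMap (b.coord j)) : F →L[ℝ] ℝ) (b i)
      = Θ (e i) y := by
    classical
    rw [sum_apply]
    simp [Finsupp.single_apply]
  exact hL.trans (h4.trans hR.symm)

end IsFunctionLinear

end Tensor

/-- The duality pairing of a section of the dual bundle with a section. -/
def pairing [∀ x, IsTopologicalAddGroup (V x)] [∀ x, ContinuousSMul ℝ (V x)]
    (σ : Cₛ^∞⟮𝓘(ℝ, E); F →L[ℝ] ℝ, DualFiber V⟯) (s : Cₛ^∞⟮𝓘(ℝ, E); F, V⟯) :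
    C^∞⟮𝓘(ℝ, E), Q; ℝ⟯ where
  val x := σ x (s x)
  property := fun x =>
    ((contMDiffAt_totalSpace).1 ((σ.contMDiff.clm_bundle_apply (F₂ := ℝ) (E₂ := fun _ => ℝ) s.contMDiff) x)).2

@[simp] lemma pairing_apply [∀ x, IsTopologicalAddGroup (V x)] [∀ x, ContinuousSMul ℝ (V x)]
    (σ : Cₛ^∞⟮𝓘(ℝ, E); F →L[ℝ] ℝ, DualFiber V⟯) (s : Cₛ^∞⟮𝓘(ℝ, E); F, V⟯) (x : Q) :
    pairing σ s x = σ x (s x) := rfl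

end Sections

section Algebroid

variable (E : Type*) [NormedAddCommGroup E] [NormedSpace ℝ E]
  {Q : Type*} [TopologicalSpace Q] [ChartedSpace E Q]
  (F : Type*) [NormedAddCommGroup F] [NormedSpace ℝ F]
  (V : Q → Type*) [TopologicalSpace (TotalSpace F V)]
  [∀ x, AddCommGroup (V x)] [∀ x, Module ℝ (V x)] [∀ x, TopologicalSpace (V x)]
  [FiberBundle F V] [VectorBundle ℝ F V] [IsManifold 𝓘(ℝ, E) ∞ Q]

/-- A Lie algebroid structure on the vector bundle `V → Q`: a smooth bundle map
`ρ : V → TQ` over the identity (the anchor) and a Lie bracket on the smooth sections that satisfies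
`[X, f Y] = (ρ(X)[f]) Y + f [X, Y]`. -/
structure LieAlgebroid where
  anchor : ∀ x, V x →L[ℝ] TangentSpace 𝓘(ℝ, E) x
  contMDiff_anchor : ContMDiff 𝓘(ℝ, E) (𝓘(ℝ, E).prod 𝓘(ℝ, F →L[ℝ] E)) ∞
    (fun x => (⟨x, anchor x⟩ :
      TotalSpace (F →L[ℝ] E) (fun x => V x →L[ℝ] TangentSpace 𝓘(ℝ, E) x)))
  bracket : Cₛ^∞⟮𝓘(ℝ, E); F, V⟯ → Cₛ^∞⟮𝓘(ℝ, E); F, V⟯ → Cₛ^∞⟮𝓘(ℝ, E); F, V⟯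
  bracket_add : ∀ X Y Z, bracket X (Y + Z) = bracket X Y + bracket X Z
  bracket_smul : ∀ (c : ℝ) X Y, bracket X (c • Y) = c • bracket X Y
  bracket_skew : ∀ X Y, bracket X Y = -bracket Y X
  jacobi : ∀ X Y Z, bracket X (bracket Y Z) = bracket (bracket X Y) Z + bracket Y (bracket X Z)
  leibniz : ∀ X (f : C^∞⟮𝓘(ℝ, E), Q; ℝ⟯) Y (x : Q),
    bracket X (f • Y) x = mvfderiv 𝓘(ℝ, E) f x (anchor x (X x)) • Y x + f x • bracket X Y x

variable {E F V}

namespace LieAlgebroid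

/-- The derivative `ρ(X)[f]`. -/
def anchorDeriv (L : LieAlgebroid E F V) (X : Cₛ^∞⟮𝓘(ℝ, E); F, V⟯) (f : C^∞⟮𝓘(ℝ, E), Q; ℝ⟯) :
    C^∞⟮𝓘(ℝ, E), Q; ℝ⟯ where
  val x := mvfderiv 𝓘(ℝ, E) f x (L.anchor x (X x))
  property := by
    have h1 : ContMDiff 𝓘(ℝ, E) (𝓘(ℝ, E).prod 𝓘(ℝ, E)) ∞
        (fun x => (⟨x, L.anchor x (X x)⟩ : TangentBundle 𝓘(ℝ, E) Q)) :=
      L.contMDiff_anchor.clm_bundle_apply X.contMDiff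
    have h2 : ContMDiff 𝓘(ℝ, E).tangent 𝓘(ℝ, ℝ).tangent ∞ (tangentMap 𝓘(ℝ, E) 𝓘(ℝ, ℝ) f) :=
      f.contMDiff.contMDiff_tangentMap (by simp)
    exact contMDiff_snd_tangentBundle_modelSpace ℝ 𝓘(ℝ, ℝ) |>.comp (h2.comp h1)

@[simp] lemma anchorDeriv_apply (L : LieAlgebroid E F V) (X : Cₛ^∞⟮𝓘(ℝ, E); F, V⟯)
    (f : C^∞⟮𝓘(ℝ, E), Q; ℝ⟯) (x : Q) :
    L.anchorDeriv X f x = mvfderiv 𝓘(ℝ, E) f x (L.anchor x (X x)) := rfl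

end LieAlgebroid


/-- An `A`-connection on a vector bundle `W`: a map `(X, s) ↦ ∇_X s`, `C^∞`-linear in `X`,
additive in `s`, with `∇_X (f s) = (ρ(X)[f]) s + f ∇_X s`. -/
structure AConnection (L : LieAlgebroid E F V)
    (K : Type*) [NormedAddCommGroup K] [NormedSpace ℝ K]
    (W : Q → Type*) [TopologicalSpace (TotalSpace K W)]
    [∀ x, AddCommGroup (W x)] [∀ x, Module ℝ (W x)] [∀ x, TopologicalSpace (W x)]
    [FiberBundle K W] [VectorBundle ℝ K W] where
  toFun : Cₛ^∞⟮𝓘(ℝ, E); F, V⟯ → Cₛ^∞⟮𝓘(ℝ, E); K, W⟯ → Cₛ^∞⟮𝓘(ℝ, E); K, W⟯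
  add_left : ∀ X Y s, toFun (X + Y) s = toFun X s + toFun Y s
  smul_left : ∀ (f : C^∞⟮𝓘(ℝ, E), Q; ℝ⟯) X s, toFun (f • X) s = f • toFun X s
  add_right : ∀ X s s', toFun X (s + s') = toFun X s + toFun X s'
  leibniz : ∀ X (f : C^∞⟮𝓘(ℝ, E), Q; ℝ⟯) s,
    toFun X (f • s) = L.anchorDeriv X f • s + f • toFun X s

namespace AConnection

variable {L : LieAlgebroid E F V}
    {K : Type*} [NormedAddCommGroup K] [NormedSpace ℝ K]
    {W : Q → Type*} [TopologicalSpace (TotalSpace K W)]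
    [∀ x, AddCommGroup (W x)] [∀ x, Module ℝ (W x)] [∀ x, TopologicalSpace (W x)]
    [FiberBundle K W] [VectorBundle ℝ K W]

section Dual
variable [FiniteDimensional ℝ E] [T2Space Q] [FiniteDimensional ℝ K]
  [ContMDiffVectorBundle ∞ K W 𝓘(ℝ, E)]
  [∀ x, IsTopologicalAddGroup (W x)] [∀ x, ContinuousSMul ℝ (W x)]

lemma isFunctionLinear_dual (D : AConnection L K W) (X : Cₛ^∞⟮𝓘(ℝ, E); F, V⟯)
    (σ : Cₛ^∞⟮𝓘(ℝ, E); K →L[ℝ] ℝ, DualFiber W⟯) :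
    IsFunctionLinear (fun s : Cₛ^∞⟮𝓘(ℝ, E); K, W⟯ =>
      L.anchorDeriv X (pairing σ s) - pairing σ (D.toFun X s)) where
  add s s' := by
    ext x
    have e : ((pairing σ (s + s') : C^∞⟮𝓘(ℝ, E), Q; ℝ⟯) : Q → ℝ) = pairing σ s + pairing σ s' := by
      ext y; simp
    have h := mvfderiv_add (I := 𝓘(ℝ, E)) ((pairing σ s).contMDiff.mdifferentiable (by simp) x)
      ((pairing σ s').contMDiff.mdifferentiable (by simp) x)
    simp only [D.add_right, ContMDiffMap.coe_sub, ContMDiffMap.coe_add, Pi.sub_apply, Pi.add_apply,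
      LieAlgebroid.anchorDeriv_apply, pairing_apply, ContMDiffSection.coe_add, map_add, e, h,
      add_apply]
    ring
  smul f s := by
    ext x
    have e : ((pairing σ (f • s) : C^∞⟮𝓘(ℝ, E), Q; ℝ⟯) : Q → ℝ) = f * pairing σ s := by
      ext y; simp
    have h := mvfderiv_mul (I := 𝓘(ℝ, E)) (f.contMDiff.mdifferentiable (by simp) x)
      ((pairing σ s).contMDiff.mdifferentiable (by simp) x)
    simp [D.leibniz, e, h]
    ring

lemma dual_ext (x : Q) {α β : W x →L[ℝ] ℝ}
    (h : ∀ s : Cₛ^∞⟮𝓘(ℝ, E); K, W⟯, α (s x) = β (s x)) : α = β := by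
  ext w
  obtain ⟨s, rfl⟩ := exists_section_apply_eq (E := E) (F := K) x w
  exact h s

/-- The dual connection `∇*`, with `⟨∇*_X σ, s⟩ = ρ(X)[⟨σ, s⟩] - ⟨σ, ∇_X s⟩`. -/
def dual (D : AConnection L K W) : AConnection L (K →L[ℝ] ℝ) (DualFiber W) where
  toFun X σ := ⟨(D.isFunctionLinear_dual X σ).covector, (D.isFunctionLinear_dual X σ).contMDiff_covector⟩
  add_left X Y σ := by
    refine ContMDiffSection.ext fun x => dual_ext (E := E) (K := K) x fun s => ?_
    simp only [ContMDiffSection.coeFn_mk, ContMDiffSection.coe_add, Pi.add_apply,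
      add_apply, IsFunctionLinear.covector_apply, ContMDiffMap.coe_sub,
      Pi.sub_apply, LieAlgebroid.anchorDeriv_apply, map_add, pairing_apply, D.add_left]
    ring
  smul_left f X σ := by
    refine ContMDiffSection.ext fun x => dual_ext (E := E) (K := K) x fun s => ?_
    simp only [ContMDiffSection.coeFn_mk, fsmul_apply, smul_apply,
      IsFunctionLinear.covector_apply, ContMDiffMap.coe_sub, smul_eq_mul,
      Pi.sub_apply, LieAlgebroid.anchorDeriv_apply, map_smul, pairing_apply, D.smul_left]
    ring
  add_right X σ τ := by
    refine ContMDiffSection.ext fun x => dual_ext (E := E) (K := K) x fun s => ?_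
    have e : ((pairing (σ + τ) s : C^∞⟮𝓘(ℝ, E), Q; ℝ⟯) : Q → ℝ) = pairing σ s + pairing τ s := by
      ext y; simp
    have h := mvfderiv_add (I := 𝓘(ℝ, E)) ((pairing σ s).contMDiff.mdifferentiable (by simp) x)
      ((pairing τ s).contMDiff.mdifferentiable (by simp) x)
    simp only [ContMDiffSection.coeFn_mk, ContMDiffSection.coe_add, Pi.add_apply,
      add_apply, IsFunctionLinear.covector_apply, ContMDiffMap.coe_sub,
      Pi.sub_apply, LieAlgebroid.anchorDeriv_apply, pairing_apply, e, h]
    ring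
  leibniz X f σ := by
    refine ContMDiffSection.ext fun x => dual_ext (E := E) (K := K) x fun s => ?_
    have e : ((pairing (f • σ) s : C^∞⟮𝓘(ℝ, E), Q; ℝ⟯) : Q → ℝ) = f * pairing σ s := by
      ext y; simp
    have h := mvfderiv_mul (I := 𝓘(ℝ, E)) (f.contMDiff.mdifferentiable (by simp) x)
      ((pairing σ s).contMDiff.mdifferentiable (by simp) x)
    simp only [ContMDiffSection.coeFn_mk, ContMDiffSection.coe_add, Pi.add_apply, fsmul_apply,
      add_apply, smul_apply, smul_eq_mul, IsFunctionLinear.covector_apply, ContMDiffMap.coe_sub,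
      Pi.sub_apply, LieAlgebroid.anchorDeriv_apply, pairing_apply, e, h]
    ring

lemma dual_apply (D : AConnection L K W) (X : Cₛ^∞⟮𝓘(ℝ, E); F, V⟯)
    (σ : Cₛ^∞⟮𝓘(ℝ, E); K →L[ℝ] ℝ, DualFiber W⟯) (s : Cₛ^∞⟮𝓘(ℝ, E); K, W⟯) :
    pairing (D.dual.toFun X σ) s = L.anchorDeriv X (pairing σ s) - pairing σ (D.toFun X s) := by
  ext x
  exact (D.isFunctionLinear_dual X σ).covector_apply x s

end Dual
end AConnection

section Bar
open CovariantDerivative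

variable [∀ x, IsTopologicalAddGroup (V x)] [∀ x, ContinuousSMul ℝ (V x)]

lemma LieAlgebroid.leibniz_left (L : LieAlgebroid E F V) (f : C^∞⟮𝓘(ℝ, E), Q; ℝ⟯)
    (X Y : Cₛ^∞⟮𝓘(ℝ, E); F, V⟯) (x : Q) :
    L.bracket (f • X) Y x
      = -(mvfderiv 𝓘(ℝ, E) f x (L.anchor x (Y x)) • X x) + f x • L.bracket X Y x := by
  rw [L.bracket_skew, ContMDiffSection.coe_neg, Pi.neg_apply, L.leibniz, L.bracket_skew Y X,
    ContMDiffSection.coe_neg, Pi.neg_apply]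
  module

lemma LieAlgebroid.add_bracket (L : LieAlgebroid E F V) (X Y Z : Cₛ^∞⟮𝓘(ℝ, E); F, V⟯) :
    L.bracket (X + Y) Z = L.bracket X Z + L.bracket Y Z := by
  rw [L.bracket_skew, L.bracket_add, L.bracket_skew X, L.bracket_skew Y]
  abel

/-- The section `∇_{ρ(Y)} X`. -/
def anchorCov (L : LieAlgebroid E F V) (cov : CovariantDerivative 𝓘(ℝ, E) F V)
    [hc : ContMDiffCovariantDerivative cov ∞] (X Y : Cₛ^∞⟮𝓘(ℝ, E); F, V⟯) :
    Cₛ^∞⟮𝓘(ℝ, E); F, V⟯ where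
  toFun x := cov X x (L.anchor x (Y x))
  contMDiff_toFun := by
    have h1 := hc.contMDiff.contMDiff (σ := X) (X.contMDiff.contMDiffOn)
    rw [contMDiffOn_univ] at h1
    exact h1.clm_bundle_apply (L.contMDiff_anchor.clm_bundle_apply Y.contMDiff)

lemma anchorCov_apply (L : LieAlgebroid E F V) (cov : CovariantDerivative 𝓘(ℝ, E) F V)
    [ContMDiffCovariantDerivative cov ∞] (X Y : Cₛ^∞⟮𝓘(ℝ, E); F, V⟯) (x : Q) :
    anchorCov L cov X Y x = cov X x (L.anchor x (Y x)) := rfl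

/-- The `A`-connection `∇̄_X Y = ∇_{ρ(Y)} X + [X, Y]`. -/
def AConnection.bar (L : LieAlgebroid E F V) (cov : CovariantDerivative 𝓘(ℝ, E) F V)
    [hc : ContMDiffCovariantDerivative cov ∞] : AConnection L F V where
  toFun X Y := anchorCov L cov X Y + L.bracket X Y
  add_left X Y s := by
    refine ContMDiffSection.ext fun x => ?_
    have h : cov (⇑X + ⇑Y) x = cov X x + cov Y x := cov.isCovariantDerivativeOnUniv.add
      (X.mdifferentiableAt (x := x)) (Y.mdifferentiableAt)
    simp only [anchorCov_apply, ContMDiffSection.coe_add, Pi.add_apply, h,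
      L.add_bracket, add_apply]
    abel
  smul_left f X s := by
    refine ContMDiffSection.ext fun x => ?_
    have h : cov ((f : Q → ℝ) • ⇑X) x = f x • cov X x + (mvfderiv 𝓘(ℝ, E) f x).smulRight (X x) :=
      cov.isCovariantDerivativeOnUniv.leibniz (X.mdifferentiableAt (x := x))
        (f.contMDiff.mdifferentiable (by simp) x)
    have h' : (⇑(f • X) : ∀ x, V x) = (f : Q → ℝ) • ⇑X := rfl
    simp only [anchorCov_apply, ContMDiffSection.coe_add, Pi.add_apply, h', h,
      L.leibniz_left, fsmul_apply, add_apply, smul_apply, ContinuousLinearMap.smulRight_apply]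
    module
  add_right X s s' := by
    refine ContMDiffSection.ext fun x => ?_
    simp only [anchorCov_apply, ContMDiffSection.coe_add, Pi.add_apply,
      L.bracket_add, map_add]
    abel
  leibniz X f s := by
    refine ContMDiffSection.ext fun x => ?_
    simp only [anchorCov_apply, ContMDiffSection.coe_add, Pi.add_apply,
      fsmul_apply, L.leibniz, map_smul, LieAlgebroid.anchorDeriv_apply]
    module

lemma AConnection.bar_apply (L : LieAlgebroid E F V) (cov : CovariantDerivative 𝓘(ℝ, E) F V)
    [ContMDiffCovariantDerivative cov ∞] (X Y : Cₛ^∞⟮𝓘(ℝ, E); F, V⟯) (x : Q) :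
    (bar L cov).toFun X Y x = cov X x (L.anchor x (Y x)) + L.bracket X Y x := rfl

end Bar

end Algebroid

section Algebroid

variable {E : Type*} [NormedAddCommGroup E] [NormedSpace ℝ E]
  {Q : Type*} [TopologicalSpace Q] [ChartedSpace E Q]
  {F : Type*} [NormedAddCommGroup F] [NormedSpace ℝ F]
  {V : Q → Type*} [TopologicalSpace (TotalSpace F V)]
  [∀ x, AddCommGroup (V x)] [∀ x, Module ℝ (V x)] [∀ x, TopologicalSpace (V x)]
  [FiberBundle F V] [VectorBundle ℝ F V] [IsManifold 𝓘(ℝ, E) ∞ Q]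

section DualCov

variable [∀ x, IsTopologicalAddGroup (V x)] [∀ x, ContinuousSMul ℝ (V x)]

lemma mdifferentiableAt_pairing {σ : ∀ x, DualFiber V x} {s : ∀ x, V x} {x : Q}
    (hσ : MDifferentiableAt 𝓘(ℝ, E) (𝓘(ℝ, E).prod 𝓘(ℝ, F →L[ℝ] ℝ))
      (fun y => (⟨y, σ y⟩ : TotalSpace (F →L[ℝ] ℝ) (DualFiber V))) x)
    (hs : MDifferentiableAt 𝓘(ℝ, E) (𝓘(ℝ, E).prod 𝓘(ℝ, F))
      (fun y => (⟨y, s y⟩ : TotalSpace F V)) x) :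
    MDifferentiableAt 𝓘(ℝ, E) 𝓘(ℝ, ℝ) (fun y => σ y (s y)) x :=
  ((mdifferentiableAt_totalSpace 𝓘(ℝ, E) _).1
    (hσ.clm_bundle_apply (F₂ := ℝ) (E₂ := fun _ => ℝ) hs)).2

variable [ContMDiffVectorBundle ∞ F V 𝓘(ℝ, E)]

lemma tensorialAt_dual (cov : CovariantDerivative 𝓘(ℝ, E) F V)
    {σ : ∀ x, DualFiber V x} {x : Q}
    (hσ : MDifferentiableAt 𝓘(ℝ, E) (𝓘(ℝ, E).prod 𝓘(ℝ, F →L[ℝ] ℝ))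
      (fun y => (⟨y, σ y⟩ : TotalSpace (F →L[ℝ] ℝ) (DualFiber V))) x) :
    TensorialAt 𝓘(ℝ, E) F (fun s : ∀ y, V y =>
      mvfderiv 𝓘(ℝ, E) (fun y => σ y (s y)) x - (σ x).comp (cov s x)) x where
  smul {f s} hf hs := by
    ext v
    have h := mvfderiv_fun_mul hf (mdifferentiableAt_pairing hσ hs)
    have h2 := cov.isCovariantDerivativeOn.leibniz (s := univ) hs hf
    simp [h, h2]
    ring
  add {s s'} hs hs' := by
    ext v
    have h := mvfderiv_fun_add (mdifferentiableAt_pairing hσ hs) (mdifferentiableAt_pairing hσ hs')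
    have h2 := cov.isCovariantDerivativeOn.add (s := univ) hs hs'
    simp [h, h2]
    ring

variable [FiniteDimensional ℝ E] [FiniteDimensional ℝ F]

/-- The covectors `w ↦ ⟨∇*_v σ, w⟩`, `v ∈ T_x Q`. -/
def dualCovAt (cov : CovariantDerivative 𝓘(ℝ, E) F V) {σ : ∀ x, DualFiber V x} {x : Q}
    (hσ : MDifferentiableAt 𝓘(ℝ, E) (𝓘(ℝ, E).prod 𝓘(ℝ, F →L[ℝ] ℝ))
      (fun y => (⟨y, σ y⟩ : TotalSpace (F →L[ℝ] ℝ) (DualFiber V))) x) :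
    TangentSpace 𝓘(ℝ, E) x →L[ℝ] DualFiber V x :=
  have : T2Space (V x) := FiberBundle.t2Space F V x
  have : FiniteDimensional ℝ (V x) := VectorBundle.finiteDimensional ℝ F V x
  have : FiniteDimensional ℝ (TangentSpace 𝓘(ℝ, E) x) := inferInstanceAs (FiniteDimensional ℝ E)
  have : T2Space (TangentSpace 𝓘(ℝ, E) x) := inferInstanceAs (T2Space E)
  LinearMap.toContinuousLinearMap
    { toFun := fun v => LinearMap.toContinuousLinearMap
        { toFun := fun w => TensorialAt.mkHom _ x (tensorialAt_dual cov hσ) w v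
          map_add' := by intros; simp
          map_smul' := by intros; simp }
      map_add' := by intros; ext; simp
      map_smul' := by intros; ext; simp }

lemma dualCovAt_apply (cov : CovariantDerivative 𝓘(ℝ, E) F V) {σ : ∀ x, DualFiber V x} {x : Q}
    (hσ : MDifferentiableAt 𝓘(ℝ, E) (𝓘(ℝ, E).prod 𝓘(ℝ, F →L[ℝ] ℝ))
      (fun y => (⟨y, σ y⟩ : TotalSpace (F →L[ℝ] ℝ) (DualFiber V))) x)
    {s : ∀ x, V x} (hs : MDifferentiableAt 𝓘(ℝ, E) (𝓘(ℝ, E).prod 𝓘(ℝ, F))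
      (fun y => (⟨y, s y⟩ : TotalSpace F V)) x) (v : TangentSpace 𝓘(ℝ, E) x) :
    dualCovAt cov hσ v (s x) =
      mvfderiv 𝓘(ℝ, E) (fun y => σ y (s y)) x v - σ x (cov s x v) :=
  congrArg (fun α : TangentSpace 𝓘(ℝ, E) x →L[ℝ] ℝ => α v)
    (TensorialAt.mkHom_apply (tensorialAt_dual cov hσ) hs)

open Classical in
/-- The dual `∇*` of a `TQ`-connection `∇`, with `⟨∇*_v σ, s⟩ = v[⟨σ, s⟩] - ⟨σ, ∇_v s⟩`. -/
def dualCov (cov : CovariantDerivative 𝓘(ℝ, E) F V) :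
    CovariantDerivative 𝓘(ℝ, E) (F →L[ℝ] ℝ) (DualFiber V) where
  toFun σ x :=
    if hσ : MDifferentiableAt 𝓘(ℝ, E) (𝓘(ℝ, E).prod 𝓘(ℝ, F →L[ℝ] ℝ))
      (fun y => (⟨y, σ y⟩ : TotalSpace (F →L[ℝ] ℝ) (DualFiber V))) x
    then dualCovAt cov hσ else 0
  isCovariantDerivativeOnUniv :=
    { add := fun {σ σ' x} hσ hσ' _ => by
        have h := mdifferentiableAt_add_section hσ hσ'
        rw [dif_pos hσ, dif_pos hσ', dif_pos h]
        ext v w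
        obtain ⟨s, hs, rfl⟩ : ∃ s : ∀ x, V x, MDifferentiableAt 𝓘(ℝ, E) (𝓘(ℝ, E).prod 𝓘(ℝ, F))
          (fun y => (⟨y, s y⟩ : TotalSpace F V)) x ∧ s x = w :=
          ⟨FiberBundle.extend F w, FiberBundle.mdifferentiableAt_extend .., by simp⟩
        have h3 := mvfderiv_fun_add (mdifferentiableAt_pairing hσ hs)
          (mdifferentiableAt_pairing hσ' hs)
        simp only [add_apply, dualCovAt_apply cov _ hs, Pi.add_apply, h3]
        ring
      leibniz := fun {σ g x} hσ hg _ => by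
        have h := hg.smul_section hσ
        rw [dif_pos hσ, dif_pos h]
        ext v w
        obtain ⟨s, hs, rfl⟩ : ∃ s : ∀ x, V x, MDifferentiableAt 𝓘(ℝ, E) (𝓘(ℝ, E).prod 𝓘(ℝ, F))
          (fun y => (⟨y, s y⟩ : TotalSpace F V)) x ∧ s x = w :=
          ⟨FiberBundle.extend F w, FiberBundle.mdifferentiableAt_extend .., by simp⟩
        have h3 := mvfderiv_fun_mul hg (mdifferentiableAt_pairing hσ hs)
        simp only [add_apply, smul_apply, dualCovAt_apply cov _ hs, Pi.smul_apply', smul_eq_mul, h3,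
          ContinuousLinearMap.smulRight_apply]
        ring }

lemma dualCov_apply (cov : CovariantDerivative 𝓘(ℝ, E) F V) {σ : ∀ x, DualFiber V x} {x : Q}
    (hσ : MDifferentiableAt 𝓘(ℝ, E) (𝓘(ℝ, E).prod 𝓘(ℝ, F →L[ℝ] ℝ))
      (fun y => (⟨y, σ y⟩ : TotalSpace (F →L[ℝ] ℝ) (DualFiber V))) x)
    {s : ∀ x, V x} (hs : MDifferentiableAt 𝓘(ℝ, E) (𝓘(ℝ, E).prod 𝓘(ℝ, F))
      (fun y => (⟨y, s y⟩ : TotalSpace F V)) x) (v : TangentSpace 𝓘(ℝ, E) x) :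
    dualCov cov σ x v (s x) =
      mvfderiv 𝓘(ℝ, E) (fun y => σ y (s y)) x v - σ x (cov s x v) := by
  have : dualCov cov σ x = dualCovAt cov hσ := dif_pos hσ
  rw [this, dualCovAt_apply cov hσ hs]

end DualCov

section Lifts

variable [∀ x, IsTopologicalAddGroup (V x)] [∀ x, ContinuousSMul ℝ (V x)]

lemma hasMFDerivAt_vertical (z : TotalSpace F V) (w : V z.1) :
    HasMFDerivAt 𝓘(ℝ, ℝ) (𝓘(ℝ, E).prod 𝓘(ℝ, F))
    (fun ε : ℝ => (⟨z.1, z.2 + ε • w⟩ : TotalSpace F V)) 0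
    (ContinuousLinearMap.toSpanSingleton ℝ
      ((0, (trivializationAt F V z.1).continuousLinearEquivAt ℝ z.1
        (FiberBundle.mem_baseSet_trivializationAt F V z.1) w) : E × F) : ℝ →L[ℝ] E × F) := by
  have hz : z.1 ∈ (trivializationAt F V z.1).baseSet :=
    FiberBundle.mem_baseSet_trivializationAt F V z.1
  set e := trivializationAt F V z.1 with he
  have key : ∀ ε : ℝ, (e (⟨z.1, z.2 + ε • w⟩ : TotalSpace F V)).2
      = e.continuousLinearEquivAt ℝ z.1 hz z.2 + ε • e.continuousLinearEquivAt ℝ z.1 hz w := by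
    intro ε
    rw [← map_smul, ← map_add]
    rfl
  constructor
  · have : ContMDiffAt 𝓘(ℝ, ℝ) (𝓘(ℝ, E).prod 𝓘(ℝ, F)) 1
      (fun ε : ℝ => (⟨z.1, z.2 + ε • w⟩ : TotalSpace F V)) 0 := by
      rw [contMDiffAt_totalSpace]
      refine ⟨contMDiffAt_const, ?_⟩
      change ContMDiffAt 𝓘(ℝ, ℝ) 𝓘(ℝ, F) 1
        (fun ε : ℝ => (e (⟨z.1, z.2 + ε • w⟩ : TotalSpace F V)).2) 0
      simp only [key]
      rw [contMDiffAt_iff_contDiffAt]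
      fun_prop
    exact this.continuousAt
  · have hw : writtenInExtChartAt 𝓘(ℝ, ℝ) (𝓘(ℝ, E).prod 𝓘(ℝ, F)) 0
        (fun ε : ℝ => (⟨z.1, z.2 + ε • w⟩ : TotalSpace F V)) =
        fun ε : ℝ => (extChartAt 𝓘(ℝ, E) z.1 z.1,
          e.continuousLinearEquivAt ℝ z.1 hz z.2 + ε • e.continuousLinearEquivAt ℝ z.1 hz w) := by
      funext ε
      rw [← key ε]
      have h0 : (trivializationAt F V
          (⟨z.1, z.2 + (0 : ℝ) • w⟩ : TotalSpace F V).proj) = e := rfl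
      simp only [writtenInExtChartAt, FiberBundle.extChartAt, h0]
      simp
      exact ⟨congrArg (chartAt E z.1) (e.coe_fst' hz), rfl⟩
    rw [hw]
    have h1 : HasFDerivAt (fun ε : ℝ => (extChartAt 𝓘(ℝ, E) z.1 z.1,
          e.continuousLinearEquivAt ℝ z.1 hz z.2 + ε • e.continuousLinearEquivAt ℝ z.1 hz w))
        (ContinuousLinearMap.toSpanSingleton ℝ
          ((0, e.continuousLinearEquivAt ℝ z.1 hz w) : E × F)) (0 : ℝ) := by
      rw [← hasDerivAt_iff_hasFDerivAt]
      refine HasDerivAt.prodMk (hasDerivAt_const _ _) ?_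
      simpa using ((hasDerivAt_id (0 : ℝ)).smul_const
        (e.continuousLinearEquivAt ℝ z.1 hz w)).const_add (e.continuousLinearEquivAt ℝ z.1 hz z.2)
    exact h1.hasFDerivWithinAt

lemma mfderiv_vertical (z : TotalSpace F V) (w : V z.1) :
    (mfderiv 𝓘(ℝ, ℝ) (𝓘(ℝ, E).prod 𝓘(ℝ, F))
      (fun ε : ℝ => (⟨z.1, z.2 + ε • w⟩ : TotalSpace F V)) 0 (1 : ℝ) : E × F) =
    (0, (trivializationAt F V z.1).continuousLinearEquivAt ℝ z.1
        (FiberBundle.mem_baseSet_trivializationAt F V z.1) w) := by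
  rw [(hasMFDerivAt_vertical z w).mfderiv]
  exact one_smul ℝ (_ : E × F)

/-- The vertical lift `V_z w = d/dε (z + ε w)` at `ε = 0`. -/
def vertLift (z : TotalSpace F V) :
    V z.1 →L[ℝ] TangentSpace (𝓘(ℝ, E).prod 𝓘(ℝ, F)) z where
  toFun w := mfderiv 𝓘(ℝ, ℝ) (𝓘(ℝ, E).prod 𝓘(ℝ, F))
    (fun ε : ℝ => (⟨z.1, z.2 + ε • w⟩ : TotalSpace F V)) 0 (1 : ℝ)
  map_add' w w' := by
    refine (mfderiv_vertical z _).trans (Eq.trans ?_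
      (congrArg₂ (fun a b : E × F => a + b) (mfderiv_vertical z w) (mfderiv_vertical z w')).symm)
    simp only [map_add, Prod.mk_add_mk, add_zero]
    rfl
  map_smul' c w := by
    refine (mfderiv_vertical z _).trans (Eq.trans ?_
      (congrArg (fun a : E × F => c • a) (mfderiv_vertical z w)).symm)
    simp only [map_smul, Prod.smul_mk, smul_zero]
    rfl
  cont := by
    refine Continuous.congr (f := fun w : V z.1 => ((0,
      (trivializationAt F V z.1).continuousLinearEquivAt ℝ z.1
        (FiberBundle.mem_baseSet_trivializationAt F V z.1) w) : E × F)) ?_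
      fun w => (mfderiv_vertical z w).symm
    exact continuous_const.prodMk (ContinuousLinearEquiv.continuous _)

/-- The horizontal lift `H_z v = Tξ(v) - V_z (∇_v ξ)`, where `ξ` is a local section with
`ξ(x) = z`. -/
def horLift (cov : CovariantDerivative 𝓘(ℝ, E) F V) (z : TotalSpace F V) :
    TangentSpace 𝓘(ℝ, E) z.1 →L[ℝ] TangentSpace (𝓘(ℝ, E).prod 𝓘(ℝ, F)) z :=
  (mfderiv 𝓘(ℝ, E) (𝓘(ℝ, E).prod 𝓘(ℝ, F))
      (fun y => (⟨y, FiberBundle.extend F z.2 y⟩ : TotalSpace F V)) z.1 :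
    TangentSpace 𝓘(ℝ, E) z.1 →L[ℝ] TangentSpace (𝓘(ℝ, E).prod 𝓘(ℝ, F)) z) -
  (vertLift z).comp (cov (FiberBundle.extend F z.2) z.1)

end Lifts

end Algebroid

section Algebroid

variable {E : Type*} [NormedAddCommGroup E] [NormedSpace ℝ E]
  {Q : Type*} [TopologicalSpace Q] [ChartedSpace E Q]
  {F : Type*} [NormedAddCommGroup F] [NormedSpace ℝ F]
  {V : Q → Type*} [TopologicalSpace (TotalSpace F V)]
  [∀ x, AddCommGroup (V x)] [∀ x, Module ℝ (V x)] [∀ x, TopologicalSpace (V x)]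
  [FiberBundle F V] [VectorBundle ℝ F V] [IsManifold 𝓘(ℝ, E) ∞ Q]
  [∀ x, IsTopologicalAddGroup (V x)] [∀ x, ContinuousSMul ℝ (V x)]

/-! ### Vertical and horizontal differentials -/

/-- The vertical differential `dG^ver(z) = V_z^* dG(z)` (the derivative along the fibre) of a
function `G` on the total space of a vector bundle. -/
def verDeriv (G : TotalSpace F V → ℝ) (z : TotalSpace F V) : DualFiber V z.1 :=
  (mvfderiv (𝓘(ℝ, E).prod 𝓘(ℝ, F)) G z).comp (vertLift (E := E) z)

/-- The horizontal differential `dG^hor(z) = H_z^* dG(z)` with respect to a connection. -/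
def horDeriv (cov : CovariantDerivative 𝓘(ℝ, E) F V) (G : TotalSpace F V → ℝ)
    (z : TotalSpace F V) : TangentSpace 𝓘(ℝ, E) z.1 →L[ℝ] ℝ :=
  (mvfderiv (𝓘(ℝ, E).prod 𝓘(ℝ, F)) G z).comp (horLift cov z)

section Predual
variable [FiniteDimensional ℝ F]

variable (F) in
/-- The element of `V x` that represents a linear form on the dual space of `V x`. -/
def predual (x : Q) (φ : DualFiber V x →L[ℝ] ℝ) : V x :=
  have : T2Space (V x) := FiberBundle.t2Space F V x
  have : FiniteDimensional ℝ (V x) := VectorBundle.finiteDimensional ℝ F V x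
  (Module.evalEquiv ℝ (V x)).symm
    (φ.toLinearMap ∘ₗ (LinearMap.toContinuousLinearMap (𝕜 := ℝ) (E := V x) (F' := ℝ)).toLinearMap)

lemma apply_predual (x : Q) (φ : DualFiber V x →L[ℝ] ℝ) (r : DualFiber V x) :
    r (predual F x φ) = φ r := by
  have : T2Space (V x) := FiberBundle.t2Space F V x
  have : FiniteDimensional ℝ (V x) := VectorBundle.finiteDimensional ℝ F V x
  have h := Module.apply_evalEquiv_symm_apply (R := ℝ) (M := V x) r.toLinearMap
    (φ.toLinearMap ∘ₗ (LinearMap.toContinuousLinearMap (𝕜 := ℝ) (E := V x) (F' := ℝ)).toLinearMap)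
  exact h

variable [ContMDiffVectorBundle ∞ F V 𝓘(ℝ, E)]

/-- The vertical differential `dH^ver(p)` of a function on the dual bundle. -/
def verDerivDual (H : TotalSpace (F →L[ℝ] ℝ) (DualFiber V) → ℝ)
    (z : TotalSpace (F →L[ℝ] ℝ) (DualFiber V)) : V z.1 :=
  predual F z.1 (verDeriv (E := E) H z)


end Predual

/-! ### Covariant derivatives along paths -/

section Along
variable {K : Type*} [NormedAddCommGroup K] [NormedSpace ℝ K]
  {W : Q → Type*} [TopologicalSpace (TotalSpace K W)]
  [∀ x, AddCommGroup (W x)] [∀ x, Module ℝ (W x)] [∀ x, TopologicalSpace (W x)]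
  [FiberBundle K W] [VectorBundle ℝ K W]

/-- The time-dependent section `η` extends the path `u` over `q`, that is,
`η(t, q(t)) = u(t)` for `t ∈ J`. -/
def IsTimeExtension (J : Set ℝ) (q : ℝ → Q) (u : ∀ t, W (q t))
    (η : ℝ → Cₛ^∞⟮𝓘(ℝ, E); K, W⟯) : Prop :=
  ContMDiff (𝓘(ℝ, ℝ).prod 𝓘(ℝ, E)) (𝓘(ℝ, E).prod 𝓘(ℝ, K)) 1
    (fun z : ℝ × Q => (⟨z.2, η z.1 z.2⟩ : TotalSpace K W)) ∧
  ∀ t ∈ J, η t (q t) = u t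

open Classical in
/-- The covariant derivative `∇_a u (t) = ∂_t η(t, q(t)) + ∇_ξ η(t, q(t))` of a path `u` in `W`
along an `A`-path `a`, where `ξ` and `η` are time-dependent sections that extend `a` and `u`. -/
def AConnection.along {L : LieAlgebroid E F V} (D : AConnection L K W) (J : Set ℝ) (q : ℝ → Q)
    (a : ∀ t, V (q t)) (u : ∀ t, W (q t)) (t : ℝ) : W (q t) :=
  if h : (∃ ξ : ℝ → Cₛ^∞⟮𝓘(ℝ, E); F, V⟯, IsTimeExtension J q a ξ) ∧
      (∃ η : ℝ → Cₛ^∞⟮𝓘(ℝ, E); K, W⟯, IsTimeExtension J q u η) then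
    deriv (fun τ => h.2.choose τ (q t)) t + D.toFun (h.1.choose t) (h.2.choose t) (q t)
  else 0

end Along

/-! ### Paths -/

section Paths
variable {K : Type*} [NormedAddCommGroup K] [NormedSpace ℝ K]
  {W : Q → Type*} [TopologicalSpace (TotalSpace K W)] [∀ x, TopologicalSpace (W x)]
  [FiberBundle K W]

variable (E) in
/-- A path of class `C¹` in the total space of a bundle whose base path is of class `C²`. -/
def IsBundlePath (J : Set ℝ) (γ : ℝ → TotalSpace K W) : Prop :=
  ContMDiffOn 𝓘(ℝ, ℝ) (𝓘(ℝ, E).prod 𝓘(ℝ, K)) 1 γ J ∧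
  ContMDiffOn 𝓘(ℝ, ℝ) 𝓘(ℝ, E) 2 (fun t => (γ t).1) J

/-- An `A`-path: its base path `q` satisfies `q̇ = ρ(a)`. -/
def LieAlgebroid.IsAPath (L : LieAlgebroid E F V) (J : Set ℝ) (γ : ℝ → TotalSpace F V) : Prop :=
  IsBundlePath E J γ ∧
  ∀ t ∈ J, mfderivWithin 𝓘(ℝ, ℝ) 𝓘(ℝ, E) (fun τ => (γ τ).1) J t (1 : ℝ) =
    L.anchor (γ t).1 (γ t).2

variable (F V) in
/-- The total space of `A ⊕ A*`. -/
abbrev SumTotal : Type _ := TotalSpace (F × (F →L[ℝ] ℝ)) (V ×ᵇ DualFiber V)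

/-- The component in `A` of a point of `A ⊕ A*`. -/
def toA (z : SumTotal F V) : TotalSpace F V := ⟨z.1, z.2.1⟩

/-- The component in `A*` of a point of `A ⊕ A*`. -/
def toDual (z : SumTotal F V) : TotalSpace (F →L[ℝ] ℝ) (DualFiber V) := ⟨z.1, z.2.2⟩

variable [ContMDiffVectorBundle ∞ F V 𝓘(ℝ, E)]

/-- An `(A ⊕ A*)`-path: a path in `A ⊕ A*` whose component in `A` is an `A`-path. -/
def LieAlgebroid.IsSumPath (L : LieAlgebroid E F V) (J : Set ℝ) (γ : ℝ → SumTotal F V) : Prop :=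
  IsBundlePath E J γ ∧ L.IsAPath J (fun t => toA (γ t))

/-- A homotopy of `A`-paths starting at `γ`: a one-parameter family `Γ ε`, `|ε| < δ`, of `A`-paths,
jointly of class `C¹`, with `Γ 0 = γ`. -/
def LieAlgebroid.IsAHomotopy (L : LieAlgebroid E F V) (J : Set ℝ) (γ : ℝ → TotalSpace F V) (δ : ℝ)
    (Γ : ℝ → ℝ → TotalSpace F V) : Prop :=
  ContMDiffOn 𝓘(ℝ, ℝ × ℝ) (𝓘(ℝ, E).prod 𝓘(ℝ, F)) 1 (fun z : ℝ × ℝ => Γ z.1 z.2)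
    (Ioo (-δ) δ ×ˢ J) ∧
  (∀ ε ∈ Ioo (-δ) δ, L.IsAPath J (Γ ε)) ∧ ∀ t ∈ J, Γ 0 t = γ t

/-- A homotopy of `(A ⊕ A*)`-paths starting at `γ`. -/
def LieAlgebroid.IsSumHomotopy (L : LieAlgebroid E F V) (J : Set ℝ) (γ : ℝ → SumTotal F V) (δ : ℝ)
    (Γ : ℝ → ℝ → SumTotal F V) : Prop :=
  ContMDiffOn 𝓘(ℝ, ℝ × ℝ) (𝓘(ℝ, E).prod 𝓘(ℝ, F × (F →L[ℝ] ℝ))) 1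
    (fun z : ℝ × ℝ => Γ z.1 z.2) (Ioo (-δ) δ ×ˢ J) ∧
  (∀ ε ∈ Ioo (-δ) δ, L.IsSumPath J (Γ ε)) ∧ ∀ t ∈ J, Γ 0 t = γ t

end Paths

/-! ### Variational principles and equations of motion -/

section Mechanics
open CovariantDerivative

variable [FiniteDimensional ℝ E] [FiniteDimensional ℝ F] [T2Space Q]
  [ContMDiffVectorBundle ∞ F V 𝓘(ℝ, E)]
  (L : LieAlgebroid E F V) (cov : CovariantDerivative 𝓘(ℝ, E) F V)
  [ContMDiffCovariantDerivative cov ∞] (t₀ t₁ : ℝ)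
  (q : ℝ → Q) (a : ∀ t, V (q t)) (p : ∀ t, DualFiber V (q t))

/-- The path `(a, p)` in `A ⊕ A*` over `q`. -/
def sumPath (q : ℝ → Q) (a : ∀ t, V (q t)) (p : ∀ t, DualFiber V (q t)) (t : ℝ) : SumTotal F V :=
  ⟨q t, (a t, p t)⟩

/-- The tangent vector at `a(t)` of the admissible variation `X_{b,a}`: its vertical component is
`∇̄_a b` and its horizontal component is `ρ(b)`. -/
def admissibleTangent (b : ∀ t, V (q t)) (t : ℝ) :
    TangentSpace (𝓘(ℝ, E).prod 𝓘(ℝ, F)) (⟨q t, a t⟩ : TotalSpace F V) :=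
  vertLift (E := E) (⟨q t, a t⟩ : TotalSpace F V)
      ((AConnection.bar L cov).along (Icc t₀ t₁) q a b t) +
    horLift cov (⟨q t, a t⟩ : TotalSpace F V) (L.anchor (q t) (b t))

/-- The tangent vector at `p(t)` of an admissible variation: its vertical component is `r` and its
horizontal component is `ρ(b)`. -/
def admissibleTangentDual (b : ∀ t, V (q t)) (r : ∀ t, DualFiber V (q t)) (t : ℝ) :
    TangentSpace (𝓘(ℝ, E).prod 𝓘(ℝ, F →L[ℝ] ℝ))
      (⟨q t, p t⟩ : TotalSpace (F →L[ℝ] ℝ) (DualFiber V)) :=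
  vertLift (E := E) (⟨q t, p t⟩ : TotalSpace (F →L[ℝ] ℝ) (DualFiber V)) (r t) +
    horLift (dualCov cov) (⟨q t, p t⟩ : TotalSpace (F →L[ℝ] ℝ) (DualFiber V))
      (L.anchor (q t) (b t))

/-- The principle `δ ∫ (⟨p, a⟩ + s H(p)) dt = 0` with respect to admissible variations of
`(A ⊕ A*)`-paths: for all paths `b` in `A` and `r` in `A*` over `q` with `b` vanishing at the
endpoints, the derivative of the action vanishes along every homotopy of `(A ⊕ A*)`-paths that
starts at `(a, p)` in the direction of the admissible variation given by `b` and `r`. -/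
def HamiltonPrinciple (s : ℝ) (H : TotalSpace (F →L[ℝ] ℝ) (DualFiber V) → ℝ) : Prop :=
  ∀ (b : ∀ t, V (q t)) (r : ∀ t, DualFiber V (q t)),
    IsBundlePath E (Icc t₀ t₁) (sumPath (F := F) q b r) → b t₀ = 0 → b t₁ = 0 →
    ∀ δ > 0, ∀ Γ : ℝ → ℝ → SumTotal F V,
      L.IsSumHomotopy (Icc t₀ t₁) (sumPath q a p) δ Γ →
      (∀ t ∈ Icc t₀ t₁,
        (mfderiv 𝓘(ℝ, ℝ) (𝓘(ℝ, E).prod 𝓘(ℝ, F)) (fun ε => toA (Γ ε t)) 0 (1 : ℝ) : E × F) =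
          admissibleTangent L cov t₀ t₁ q a b t) →
      (∀ t ∈ Icc t₀ t₁,
        (mfderiv 𝓘(ℝ, ℝ) (𝓘(ℝ, E).prod 𝓘(ℝ, F →L[ℝ] ℝ)) (fun ε => toDual (Γ ε t)) 0 (1 : ℝ) :
            E × (F →L[ℝ] ℝ)) =
          admissibleTangentDual L cov q p b r t) →
      HasDerivAt (fun ε => ∫ t in t₀..t₁, ((Γ ε t).2.2 (Γ ε t).2.1 + s * H (toDual (Γ ε t)))) 0 0

/-- The generalized Lie–Poisson equations `∇̄*_a p = s ρ*(dH^hor(p))` with `a = -s dH^ver(p)`. -/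
def LiePoissonEquations (s : ℝ) (H : TotalSpace (F →L[ℝ] ℝ) (DualFiber V) → ℝ) : Prop :=
  ∀ t ∈ Icc t₀ t₁,
    (AConnection.bar L cov).dual.along (Icc t₀ t₁) q a p t =
      s • (horDeriv (dualCov cov) H ⟨q t, p t⟩).comp (L.anchor (q t)) ∧
    a t = -s • verDerivDual (E := E) H ⟨q t, p t⟩

/-- The principle `δ ∫ ℓ(a) dt = 0` with respect to admissible variations of `A`-paths. -/
def LagrangePrinciple (ℓ : TotalSpace F V → ℝ) : Prop :=
  ∀ b : ∀ t, V (q t),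
    IsBundlePath E (Icc t₀ t₁) (fun t => (⟨q t, b t⟩ : TotalSpace F V)) → b t₀ = 0 → b t₁ = 0 →
    ∀ δ > 0, ∀ Γ : ℝ → ℝ → TotalSpace F V,
      L.IsAHomotopy (Icc t₀ t₁) (fun t => ⟨q t, a t⟩) δ Γ →
      (∀ t ∈ Icc t₀ t₁,
        (mfderiv 𝓘(ℝ, ℝ) (𝓘(ℝ, E).prod 𝓘(ℝ, F)) (fun ε => Γ ε t) 0 (1 : ℝ) : E × F) =
          admissibleTangent L cov t₀ t₁ q a b t) →
      HasDerivAt (fun ε => ∫ t in t₀..t₁, ℓ (Γ ε t)) 0 0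

variable (E) in
/-- The relation `p = dℓ^ver(a)` along a path. -/
def IsLegendrePath (ℓ : TotalSpace F V → ℝ) : Prop :=
  ∀ t ∈ Icc t₀ t₁, p t = verDeriv (E := E) ℓ ⟨q t, a t⟩

/-- The Euler–Lagrange–Poincaré equations `∇̄*_a p = ρ*(dℓ^hor(a))`. -/
def EulerLagrangePoincareEquations (ℓ : TotalSpace F V → ℝ) : Prop :=
  ∀ t ∈ Icc t₀ t₁,
    (AConnection.bar L cov).dual.along (Icc t₀ t₁) q a p t =
      (horDeriv cov ℓ ⟨q t, a t⟩).comp (L.anchor (q t))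

variable (E) in
/-- `H` is hyperregular if `dH^ver : A* → A` is a diffeomorphism. -/
def IsHyperregularHamiltonian (H : TotalSpace (F →L[ℝ] ℝ) (DualFiber V) → ℝ) : Prop :=
  ∃ Φ : Diffeomorph (𝓘(ℝ, E).prod 𝓘(ℝ, F →L[ℝ] ℝ)) (𝓘(ℝ, E).prod 𝓘(ℝ, F))
      (TotalSpace (F →L[ℝ] ℝ) (DualFiber V)) (TotalSpace F V) ∞,
    ∀ z, Φ z = ⟨z.1, verDerivDual (E := E) H z⟩

variable (E) in
/-- `ℓ` is hyperregular if `dℓ^ver : A → A*` is a diffeomorphism. -/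
def IsHyperregularLagrangian (ℓ : TotalSpace F V → ℝ) : Prop :=
  ∃ Φ : Diffeomorph (𝓘(ℝ, E).prod 𝓘(ℝ, F)) (𝓘(ℝ, E).prod 𝓘(ℝ, F →L[ℝ] ℝ))
      (TotalSpace F V) (TotalSpace (F →L[ℝ] ℝ) (DualFiber V)) ∞,
    ∀ z, Φ z = ⟨z.1, verDeriv (E := E) ℓ z⟩

variable (E) in
/-- `ℓ` is the Lagrangian of `H`: `ℓ(a) = ⟨p, a⟩ + s H(p)` where `a = -s dH^ver(p)`. -/
def IsLagrangianOf (s : ℝ) (H : TotalSpace (F →L[ℝ] ℝ) (DualFiber V) → ℝ)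
    (ℓ : TotalSpace F V → ℝ) : Prop :=
  ∀ (x : Q) (p : DualFiber V x) (a : V x), a = -s • verDerivDual (E := E) H ⟨x, p⟩ →
    ℓ ⟨x, a⟩ = p a + s * H ⟨x, p⟩

variable (E) in
/-- `H` is the Hamiltonian of `ℓ`: `H(p) = -s (⟨p, a⟩ - ℓ(a))` where `p = dℓ^ver(a)`. -/
def IsHamiltonianOf (s : ℝ) (ℓ : TotalSpace F V → ℝ)
    (H : TotalSpace (F →L[ℝ] ℝ) (DualFiber V) → ℝ) : Prop :=
  ∀ (x : Q) (a : V x) (p : DualFiber V x), p = verDeriv (E := E) ℓ ⟨x, a⟩ →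
    H ⟨x, p⟩ = -s * (p a - ℓ ⟨x, a⟩)

end Mechanics

end Algebroid

end LieAlgebroidMechanics

end

open LieAlgebroidMechanics

noncomputable section

namespace LieAlgebroidMechanics

set_option linter.unusedSectionVars false

/-! ### Differentiability of the local flow of a vector field in its initial value -/

section Flow

open Metric

variable {G : Type*} [NormedAddCommGroup G] [NormedSpace ℝ G]

/-! Both equivalences rest on a first variation formula. A tangent vector of `A` or `A*` is the sum
of a vertical and a horizontal lift, so a derivative of an integrand along a homotopy is a fibre
derivative plus a horizontal derivative. Because `∇*` is dual to `∇`, the pairing `⟨p, a⟩` has no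
horizontal derivative (`mvfderiv_pairing`). For an admissible variation the derivative of `⟨p, a⟩ +
s H(p)`, with `s = ±1` the chosen sign, is therefore `⟨r, a⟩ + ⟨p, ∇̄_a b⟩ + s (⟨r, dH^ver(p)⟩ +
⟨dH^hor(p), ρ(b)⟩)`, and that of `ℓ(a)` is `⟨dℓ^ver(a), ∇̄_a b⟩ + ⟨dℓ^hor(a), ρ(b)⟩`. The product
rule `d/dt ⟨p, b⟩ = ⟨∇̄*_a p, b⟩ + ⟨p, ∇̄_a b⟩` (`hasDerivWithinAt_pairing_path`) and the vanishing
of `b` at the endpoints move the derivative from `b` to `p`. If the equations hold, the integrand is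
`d/dt ⟨p, b⟩`, and the variational principle follows at once.

The converse needs homotopies. The principle speaks only of variations that are velocities of
families of `A`-paths, so enough variations have to be realized. It suffices to treat `b = f • (e ∘
q)` with a global section `e` and a function `f` supported near an interior time. In a local frame
`s_j` with `[e, s_k] = ∑ M_jk s_j`, the section `e` acts on `A` through the flow of `(ρ(e), -M)`.
This flow preserves the relation `ẋ = ρ(y)`, because the anchor is a morphism of Lie algebras, which
in turn follows from the Jacobi identity and the Leibniz rule. Flowing the point `a(t)` for the time
`ε f(t)` and adding `ε f'(t) e` yields `A`-paths again, and the velocity at `ε = 0` has vertical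
part `f' e + f ∇̄_a e = ∇̄_a b` (`exists_anchored_flow`, `exists_local_family`,
`exists_local_homotopy`). The fundamental lemma of the calculus of variations then gives the
equations in the interior, and continuity gives them at the endpoints.

For the action with `H`, variations with `b = 0` are realized by `p + ε r` and give `a = -s
dH^ver(p)`. After that all terms with `r` cancel, so any lift of a homotopy of `A`-paths to `A ⊕ A*`
serves for the second equation (`exists_lift_homotopy`).

In the hyperregular cases the relation `ℓ(a) = ⟨p, a⟩ + s H(p)` is differentiated along the Legendre
diffeomorphism. Separating vertical and horizontal directions shows that the two fibre derivatives
correspond to each other and that `dℓ^hor = s dH^hor`. The two systems of equations then coincide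
(`isLegendrePair_of_hamiltonian`, `isLegendrePair_of_lagrangian`). -/

/-- Linearity in the forcing constant: a forcing of order `‖y - z‖ ^ 2` gives a bound of the same
order, and zero forcing gives zero. -/
lemma gronwallBound_eq_mul (K c x : ℝ) : gronwallBound 0 K c x = c * gronwallBound 0 K 1 x := by
  by_cases hK : K = 0
  · simp [hK, gronwallBound_K0]
  · simp [gronwallBound_of_K_ne_0 hK]; ring

/-- A two-sided Grönwall inequality for a curve that vanishes at `0`. -/
lemma norm_le_gronwallBound_abs {D D' : ℝ → G} {δ K c : ℝ}
    (hD : ∀ τ ∈ Ioo (-δ) δ, HasDerivAt D (D' τ) τ) (h0 : D 0 = 0)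
    (hb : ∀ τ ∈ Ioo (-δ) δ, ‖D' τ‖ ≤ K * ‖D τ‖ + c) {τ : ℝ} (hτ : τ ∈ Ioo (-δ) δ) :
    ‖D τ‖ ≤ gronwallBound 0 K c |τ| := by
  have key : ∀ {D D' : ℝ → G}, (∀ τ ∈ Ioo (-δ) δ, HasDerivAt D (D' τ) τ) → D 0 = 0 →
      (∀ τ ∈ Ioo (-δ) δ, ‖D' τ‖ ≤ K * ‖D τ‖ + c) → ∀ τ ∈ Ico 0 δ,
      ‖D τ‖ ≤ gronwallBound 0 K c τ := by
    intro D D' hD h0 hb τ hτ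
    have hsub : Icc 0 τ ⊆ Ioo (-δ) δ := fun x hx =>
      ⟨by linarith [hx.1, hx.2, hτ.2], lt_of_le_of_lt hx.2 hτ.2⟩
    have := norm_le_gronwallBound_of_norm_deriv_right_le (f := D) (f' := D') (δ := 0) (K := K)
      (ε := c) (a := 0) (b := τ) (fun x hx => (hD x (hsub hx)).continuousAt.continuousWithinAt)
      (fun x hx => (hD x (hsub (Ico_subset_Icc_self hx))).hasDerivWithinAt) (by simp [h0])
      (fun x hx => hb x (hsub (Ico_subset_Icc_self hx))) τ ⟨hτ.1, le_rfl⟩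
    simpa using this
  rcases le_total 0 τ with h | h
  · rw [abs_of_nonneg h]; exact key hD h0 hb τ ⟨h, hτ.2⟩
  · rw [abs_of_nonpos h]
    have := key (D := fun x => D (-x)) (D' := fun x => -D' (-x)) (fun x hx => ?_) (by simpa using h0)
      (fun x hx => ?_) (-τ) ⟨by linarith, by linarith [hτ.1]⟩
    · simpa using this
    · have h1 := hD (-x) ⟨by linarith [hx.2], by linarith [hx.1]⟩
      simpa [Function.comp_def] using HasDerivAt.scomp x h1 (hasDerivAt_neg x)
    · rw [norm_neg]; exact hb (-x) ⟨by linarith [hx.2], by linarith [hx.1]⟩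

/-- The local flow of a `C²` vector field is of class `C¹`; its derivative `A` in the initial
value solves the variational equation. -/
theorem exists_local_flow [CompleteSpace G] {f : G → G} {z₀ : G} (hf : ContDiffAt ℝ 2 f z₀)
    {N : Set G} (hN : N ∈ 𝓝 z₀) :
    ∃ δ > 0, ∃ U : Set G, IsOpen U ∧ z₀ ∈ U ∧ ∃ (φ : ℝ → G → G) (A : ℝ → G → G →L[ℝ] G),
      (∀ z ∈ U, φ 0 z = z ∧ A 0 z = ContinuousLinearMap.id ℝ G) ∧
      ∀ τ ∈ Ioo (-δ) δ, ∀ z ∈ U, φ τ z ∈ N ∧ HasDerivAt (fun σ => φ σ z) (f (φ τ z)) τ ∧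
        HasDerivAt (fun σ => A σ z) ((fderiv ℝ f (φ τ z)).comp (A τ z)) τ ∧
        HasFDerivAt (φ τ) (A τ z) z ∧ ContDiffAt ℝ 1 (Function.uncurry φ) (τ, z) := by
  have hf1 : ContDiffAt ℝ 1 (fderiv ℝ f) z₀ := hf.fderiv_right (by norm_num)
  obtain ⟨K₂, s₂, hs₂, hl₂⟩ := hf1.exists_lipschitzOnWith
  obtain ⟨K₁, hK₁⟩ : ∃ K₁ : ℝ, ∀ᶠ x in 𝓝 z₀, ‖fderiv ℝ f x‖ ≤ K₁ :=
    ⟨‖fderiv ℝ f z₀‖ + 1, (hf1.continuousAt.norm.eventually_lt_const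
      (lt_add_one _)).mono fun _ h => h.le⟩
  have hdf : ∀ᶠ x in 𝓝 z₀, ContDiffAt ℝ 2 f x := hf.eventually (by simp)
  obtain ⟨ρ, hρ, hB⟩ := Metric.mem_nhds_iff.1 (Filter.inter_mem (Filter.inter_mem hN hs₂)
    (Filter.inter_mem hK₁ hdf))
  set B := ball z₀ ρ with hBdef
  have hBc : ∀ x ∈ B, ContDiffAt ℝ 2 f x := fun x hx => (hB hx).2.2
  -- The equation is solved together with its variational equation. The augmented field contains
  -- `fderiv ℝ f`, so `f` has to be `C²` for it to be `C¹`, hence locally Lipschitz.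
  let g : G × (G →L[ℝ] G) → G × (G →L[ℝ] G) := fun p => (f p.1, (fderiv ℝ f p.1).comp p.2)
  have hg : ContDiffAt ℝ 1 g (z₀, ContinuousLinearMap.id ℝ G) := by
    refine ContDiffAt.prodMk ((hf.of_le (by norm_num)).comp _ contDiffAt_fst) ?_
    exact ContDiffAt.clm_comp (hf1.comp (z₀, ContinuousLinearMap.id ℝ G) contDiffAt_fst)
      contDiffAt_snd
  obtain ⟨ε, hε, a, r, L, K, hr, hpl⟩ := IsPicardLindelof.of_contDiffAt_one hg
  obtain ⟨α, hα, L', hL'⟩ :=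
    (hpl 0).exists_forall_mem_closedBall_eq_hasDerivWithinAt_lipschitzOnWith
  set p₀ : G × (G →L[ℝ] G) := (z₀, ContinuousLinearMap.id ℝ G) with hp₀
  simp only [zero_sub, zero_add] at hα hL'
  have hcont : ContinuousOn (Function.uncurry α) (closedBall p₀ r ×ˢ Icc (-ε) ε) :=
    continuousOn_prod_of_continuousOn_lipschitzOnWith _ L'
      (fun x hx => HasDerivWithinAt.continuousOn (hα x hx).2) hL'
  have hcat : ∀ p ∈ ball p₀ r, ∀ τ ∈ Ioo (-ε) ε, ContinuousAt (Function.uncurry α) (p, τ) :=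
    fun p hp τ hτ => hcont.continuousAt (prod_mem_nhds
      (Filter.mem_of_superset (isOpen_ball.mem_nhds hp) ball_subset_closedBall)
      (Icc_mem_nhds hτ.1 hτ.2))
  have hr' : (0 : ℝ) < r := hr
  have h0mem : p₀ ∈ ball p₀ (r : ℝ) := mem_ball_self hr'
  -- Continuity of the flow at time `0` yields a smaller set of times and initial values whose
  -- trajectories stay in `B`, where all estimates on `f` hold.
  have hev : ∀ᶠ y in 𝓝 (p₀, (0 : ℝ)), (Function.uncurry α y).1 ∈ B := by
    have h1 : ContinuousAt (fun y => (Function.uncurry α y).1) (p₀, (0 : ℝ)) :=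
      (hcat p₀ h0mem 0 ⟨by linarith, hε⟩).fst
    refine h1.eventually_mem (isOpen_ball.mem_nhds ?_)
    have : α p₀ 0 = p₀ := (hα p₀ (ball_subset_closedBall h0mem)).1
    simp only [Function.uncurry, this]
    exact mem_ball_self hρ
  obtain ⟨r₁, hr₁, hr₁'⟩ := Metric.mem_nhds_iff.1 hev
  set δ := min ε r₁ with hδ
  set r₂ := min (r : ℝ) r₁ with hr₂
  have hδ0 : 0 < δ := lt_min hε hr₁
  have hpair : ∀ z ∈ ball z₀ r₂, (z, ContinuousLinearMap.id ℝ G) ∈ ball p₀ (r : ℝ) := by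
    intro z hz
    rw [mem_ball, hp₀, Prod.dist_eq, dist_self, max_eq_left dist_nonneg]
    exact lt_of_lt_of_le hz (min_le_left _ _)
  have hmem : ∀ τ ∈ Ioo (-δ) δ, ∀ z ∈ ball z₀ r₂, (α (z, ContinuousLinearMap.id ℝ G) τ).1 ∈ B := by
    intro τ hτ z hz
    refine hr₁' (a := ((z, ContinuousLinearMap.id ℝ G), τ)) ?_
    rw [mem_ball, Prod.dist_eq, hp₀, Prod.dist_eq, dist_self, max_eq_left dist_nonneg]
    refine max_lt (lt_of_lt_of_le hz (min_le_right _ _)) ?_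
    rw [Real.dist_eq, sub_zero]
    exact lt_of_lt_of_le (abs_lt.2 hτ) (min_le_right _ _)
  have hIoo : Ioo (-δ) δ ⊆ Ioo (-ε) ε := fun x hx =>
    ⟨by linarith [hx.1, min_le_left ε r₁], lt_of_lt_of_le hx.2 (min_le_left _ _)⟩
  let φ : ℝ → G → G := fun τ z => (α (z, ContinuousLinearMap.id ℝ G) τ).1
  let A : ℝ → G → G →L[ℝ] G := fun τ z => (α (z, ContinuousLinearMap.id ℝ G) τ).2
  have hder : ∀ τ ∈ Ioo (-δ) δ, ∀ z ∈ ball z₀ r₂,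
      HasDerivAt (α (z, ContinuousLinearMap.id ℝ G)) (g (α (z, ContinuousLinearMap.id ℝ G) τ)) τ := by
    intro τ hτ z hz
    exact ((hα _ (ball_subset_closedBall (hpair z hz))).2 τ
      (Ioo_subset_Icc_self (hIoo hτ))).hasDerivAt (Icc_mem_nhds (hIoo hτ).1 (hIoo hτ).2)
  have hinit : ∀ z ∈ ball z₀ r₂, φ 0 z = z ∧ A 0 z = ContinuousLinearMap.id ℝ G := by
    intro z hz
    have := (hα _ (ball_subset_closedBall (hpair z hz))).1
    exact ⟨congrArg Prod.fst this, congrArg Prod.snd this⟩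
  have hφ : ∀ τ ∈ Ioo (-δ) δ, ∀ z ∈ ball z₀ r₂, HasDerivAt (fun σ => φ σ z) (f (φ τ z)) τ :=
    fun τ hτ z hz => (hder τ hτ z hz).fst
  have hA : ∀ τ ∈ Ioo (-δ) δ, ∀ z ∈ ball z₀ r₂,
      HasDerivAt (fun σ => A σ z) ((fderiv ℝ f (φ τ z)).comp (A τ z)) τ :=
    fun τ hτ z hz => (hder τ hτ z hz).snd
  have hfd : ∀ τ ∈ Ioo (-δ) δ, ∀ z ∈ ball z₀ r₂, HasFDerivAt (φ τ) (A τ z) z := by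
    intro τ hτ z hz
    -- The error `D` of the linear prediction satisfies `D' = Df(φ z) D + R`. The Taylor remainder
    -- `R` is quadratic in `y - z`, because `Df` is `K₂`-Lipschitz and the flow is `L'`-Lipschitz in
    -- the initial value. Grönwall then bounds `D` quadratically, so `A τ z` is the derivative of `φ
    -- τ` at `z`.
    have hquad : ∀ y ∈ ball z₀ r₂, ‖φ τ y - φ τ z - A τ z (y - z)‖ ≤
        (K₂ * (L' * L') * gronwallBound 0 K₁ 1 |τ|) * ‖y - z‖ ^ 2 := by
      intro y hy
      have hG := norm_le_gronwallBound_abs (δ := δ) (K := K₁)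
        (c := K₂ * (L' * L') * ‖y - z‖ ^ 2)
        (D := fun σ => φ σ y - φ σ z - A σ z (y - z))
        (D' := fun σ => f (φ σ y) - f (φ σ z) - (fderiv ℝ f (φ σ z)).comp (A σ z) (y - z))
        (fun σ hσ => ((hφ σ hσ y hy).sub (hφ σ hσ z hz)).sub
          ((hA σ hσ z hz).clm_apply (hasDerivAt_const σ (y - z)) |>.congr_deriv (by simp)))
        (by simp [hinit y hy, hinit z hz]) ?_ hτ
      · rw [gronwallBound_eq_mul] at hG
        refine hG.trans (le_of_eq (by ring))
      · intro σ hσ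
        have hyB := hmem σ hσ y hy
        have hzB := hmem σ hσ z hz
        have hlip : ‖φ σ y - φ σ z‖ ≤ L' * ‖y - z‖ := by
          have h1 := (hL' σ (Ioo_subset_Icc_self (hIoo hσ))).dist_le_mul _
            (ball_subset_closedBall (hpair y hy)) _ (ball_subset_closedBall (hpair z hz))
          rw [Prod.dist_eq (x := (y, ContinuousLinearMap.id ℝ G)), dist_self,
            max_eq_left dist_nonneg] at h1
          rw [← dist_eq_norm, ← dist_eq_norm]
          exact (le_max_left _ _).trans h1
        have hseg : segment ℝ (φ σ z) (φ σ y) ⊆ B := (convex_ball z₀ ρ).segment_subset hzB hyB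
        have hT := (convex_segment (𝕜 := ℝ) (φ σ z) (φ σ y)).norm_image_sub_le_of_norm_hasFDerivWithin_le'
          (f := f) (f' := fderiv ℝ f) (φ := fderiv ℝ f (φ σ z)) (C := K₂ * ‖φ σ y - φ σ z‖)
          (fun x hx => ((hBc x (hseg hx)).differentiableAt (by norm_num)).hasFDerivAt.hasFDerivWithinAt)
          (fun x hx => ?_) (left_mem_segment ℝ _ _) (right_mem_segment ℝ _ _)
        · have h2 : f (φ σ y) - f (φ σ z) - (fderiv ℝ f (φ σ z)).comp (A σ z) (y - z) =
            fderiv ℝ f (φ σ z) (φ σ y - φ σ z - A σ z (y - z)) +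
            (f (φ σ y) - f (φ σ z) - fderiv ℝ f (φ σ z) (φ σ y - φ σ z)) := by
            simp only [ContinuousLinearMap.comp_apply, map_sub]; abel
          rw [h2]
          refine (norm_add_le _ _).trans (add_le_add ?_ ?_)
          · refine (ContinuousLinearMap.le_opNorm _ _).trans ?_
            gcongr
            exact (hB hzB).2.1
          · refine hT.trans ?_
            calc K₂ * ‖φ σ y - φ σ z‖ * ‖φ σ y - φ σ z‖
                ≤ K₂ * (L' * ‖y - z‖) * (L' * ‖y - z‖) := by gcongr
              _ = _ := by ring
        · have h3 := hl₂.dist_le_mul _ (hB (hseg hx)).1.2 _ (hB hzB).1.2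
          rw [dist_eq_norm, dist_eq_norm] at h3
          refine h3.trans ?_
          gcongr
          rw [← dist_eq_norm, ← dist_eq_norm, dist_comm _ (φ σ z), dist_comm _ (φ σ z)]
          obtain ⟨u, v, hu, hv, huv, rfl⟩ := hx
          rw [dist_eq_norm, dist_eq_norm]
          have : φ σ z - (u • φ σ z + v • φ σ y) = v • (φ σ z - φ σ y) := by
            have : u = 1 - v := by linarith
            subst this; module
          rw [this, norm_smul, Real.norm_of_nonneg hv]
          exact mul_le_of_le_one_left (norm_nonneg _) (by linarith)
    have hO : (fun y => φ τ y - φ τ z - A τ z (y - z)) =O[𝓝 z] fun y => ‖y - z‖ ^ 2 :=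
      Asymptotics.IsBigO.of_bound _ (Filter.mem_of_superset (isOpen_ball.mem_nhds hz)
        fun y hy => by simpa using hquad y hy)
    have h0 := hO.hasFDerivAt (𝕜 := ℝ) (by norm_num)
    have h1 : HasFDerivAt (fun y => φ τ z + A τ z (y - z)) (A τ z) z :=
      (((A τ z).hasFDerivAt.comp z ((hasFDerivAt_id z).sub_const z))).const_add _
    have h2 := h0.add h1
    simp only [zero_add] at h2
    refine h2.congr_of_eventuallyEq (Filter.Eventually.of_forall fun y => ?_)
    simp
  refine ⟨δ, hδ0, ball z₀ r₂, isOpen_ball, mem_ball_self (lt_min hr' hr₁), φ, A, hinit,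
    fun τ hτ z hz => ⟨(hB (hmem τ hτ z hz)).1.1, hφ τ hτ z hz, hA τ hτ z hz, hfd τ hτ z hz, ?_⟩⟩
  have hopen : IsOpen (Ioo (-δ) δ ×ˢ ball z₀ r₂) := isOpen_Ioo.prod isOpen_ball
  have hαc : ∀ y ∈ Ioo (-δ) δ ×ˢ ball z₀ r₂,
      ContinuousAt (fun y : ℝ × G => α (y.2, ContinuousLinearMap.id ℝ G) y.1) y := by
    intro y hy
    have := hcat _ (hpair y.2 hy.2) y.1 (hIoo hy.1)
    exact ContinuousAt.comp (f := fun y : ℝ × G => ((y.2, ContinuousLinearMap.id ℝ G), y.1)) this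
      (by fun_prop)
  have hcf : ∀ y ∈ Ioo (-δ) δ ×ˢ ball z₀ r₂, ContinuousAt
      (fun y : ℝ × G => ContinuousLinearMap.toSpanSingleton ℝ (f (φ y.1 y.2))) y := by
    intro y hy
    have h1 : ContinuousAt f (φ y.1 y.2) := (hBc _ (hmem _ hy.1 _ hy.2)).continuousAt
    have h2 : ContinuousAt (fun y : ℝ × G => f (φ y.1 y.2)) y :=
      ContinuousAt.comp (f := fun y : ℝ × G => φ y.1 y.2) h1 (hαc y hy).fst
    exact ((ContinuousLinearMap.toSpanSingletonCLE (𝕜 := ℝ) (E := G)).continuous.continuousAt).comp h2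
  -- Both partial derivatives exist near `y` and are continuous at `y`, hence `φ` is jointly
  -- differentiable; continuity of the total derivative then gives class `C¹`.
  have hstrict : ∀ y ∈ Ioo (-δ) δ ×ˢ ball z₀ r₂, HasStrictFDerivAt (Function.uncurry φ)
      ((ContinuousLinearMap.toSpanSingleton ℝ (f (φ y.1 y.2))).coprod (A y.1 y.2)) y := by
    intro y hy
    refine hasStrictFDerivAt_uncurry_coprod (f := φ)
      (f₁ := fun τ z => ContinuousLinearMap.toSpanSingleton ℝ (f (φ τ z))) (f₂ := A) ?_ ?_ ?_ ?_
    · filter_upwards [hopen.mem_nhds hy] with v hv using (hφ v.1 hv.1 v.2 hv.2).hasFDerivAt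
    · filter_upwards [hopen.mem_nhds hy] with v hv using hfd v.1 hv.1 v.2 hv.2
    · exact hcf y hy
    · exact (hαc y hy).snd
  have hc1 : ContDiffOn ℝ 1 (Function.uncurry φ) (Ioo (-δ) δ ×ˢ ball z₀ r₂) := by
    rw [show (1 : WithTop ℕ∞) = 0 + 1 by norm_num, contDiffOn_succ_iff_fderiv_of_isOpen hopen]
    refine ⟨fun y hy => (hstrict y hy).hasFDerivAt.differentiableAt.differentiableWithinAt,
      by simp, ?_⟩
    rw [contDiffOn_zero]
    refine ContinuousOn.congr (f := fun y : ℝ × G =>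
      (ContinuousLinearMap.toSpanSingleton ℝ (f (φ y.1 y.2))).coprod (A y.1 y.2)) (fun y hy => ?_)
      fun y hy => (hstrict y hy).hasFDerivAt.fderiv
    exact ((ContinuousLinearMap.coprodEquivL (𝕜 := ℝ) (E := ℝ) (F := G) (G := G) ℝ).continuous.continuousAt.comp
      (f := fun y : ℝ × G => (ContinuousLinearMap.toSpanSingleton ℝ (f (φ y.1 y.2)), A y.1 y.2))
      ((hcf y hy).prodMk (hαc y hy).snd)).continuousWithinAt
  exact hc1.contDiffAt (hopen.mem_nhds ⟨hτ, hz⟩)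

end Flow

/-! ### Extension, differentiation under the integral, and the fundamental lemma -/

section Calculus

open MeasureTheory

/-- A `C¹` function on a compact interval extends to a `C¹` function on `ℝ`. -/
lemma exists_contDiff_extension {t₀ t₁ : ℝ} (ht : t₀ < t₁) {g : ℝ → ℝ}
    (hg : ContDiffOn ℝ 1 g (Icc t₀ t₁)) :
    ∃ c : ℝ → ℝ, ContDiff ℝ 1 c ∧ ∀ t ∈ Icc t₀ t₁, c t = g t := by
  have hg' : ContinuousOn (derivWithin g (Icc t₀ t₁)) (Icc t₀ t₁) :=
    hg.continuousOn_derivWithin (uniqueDiffOn_Icc ht) le_rfl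
  -- The derivative is continued by its endpoint values and integrated; on the interval the
  -- primitive recovers `g`.
  let G : ℝ → ℝ := IccExtend ht.le (domRestrict (Icc t₀ t₁) (derivWithin g (Icc t₀ t₁)))
  have hG : Continuous G := continuous_IccExtend_iff.2 hg'.domRestrict
  have hGe : ∀ t ∈ Icc t₀ t₁, G t = derivWithin g (Icc t₀ t₁) t := fun t h => by
    simp only [G, IccExtend_of_mem ht.le _ h, domRestrict_apply]
  have hd : ∀ t, HasDerivAt (fun t => g t₀ + ∫ τ in t₀..t, G τ) (G t) t := fun t =>
    (intervalIntegral.integral_hasDerivAt_right (hG.intervalIntegrable _ _)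
      (hG.stronglyMeasurableAtFilter _ _) hG.continuousAt).const_add _
  refine ⟨fun t => g t₀ + ∫ τ in t₀..t, G τ, ?_, fun t h => ?_⟩
  · rw [contDiff_one_iff_deriv]
    exact ⟨fun t => (hd t).differentiableAt, by simpa only [funext fun t => (hd t).deriv] using hG⟩
  · have := intervalIntegral.integral_eq_sub_of_hasDerivAt_of_le (f := g) (f' := G) h.1
      (hg.continuousOn.mono (Icc_subset_Icc_right h.2)) (fun x hx => ?_) (hG.intervalIntegrable _ _)
    · simp [this]
    · have hx' : x ∈ Ioo t₀ t₁ := ⟨hx.1, hx.2.trans_le h.2⟩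
      rw [hGe x (Ioo_subset_Icc_self hx')]
      exact ((hg.differentiableOn (by simp) x (Ioo_subset_Icc_self hx')).hasDerivWithinAt).hasDerivAt
        (Icc_mem_nhds hx'.1 hx'.2)

/-- Differentiation under the integral sign for a `C¹` integrand. -/
lemma hasDerivAt_integral_of_contDiffOn {t₀ t₁ δ : ℝ} (ht : t₀ < t₁) (hδ : 0 < δ)
    {Φ : ℝ → ℝ → ℝ}
    (hΦ : ContDiffOn ℝ 1 (fun z : ℝ × ℝ => Φ z.1 z.2) (Ioo (-δ) δ ×ˢ Icc t₀ t₁)) :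
    ∃ Φ' : ℝ → ℝ, ContinuousOn Φ' (Icc t₀ t₁) ∧
      (∀ t ∈ Icc t₀ t₁, HasDerivAt (fun ε => Φ ε t) (Φ' t) 0) ∧
      HasDerivAt (fun ε => ∫ t in t₀..t₁, Φ ε t) (∫ t in t₀..t₁, Φ' t) 0 := by
  set S := Ioo (-δ) δ ×ˢ Icc t₀ t₁ with hS
  have hu : UniqueDiffOn ℝ S := (isOpen_Ioo.uniqueDiffOn).prod (uniqueDiffOn_Icc ht)
  have hc : ContinuousOn (fun z => fderivWithin ℝ (fun z : ℝ × ℝ => Φ z.1 z.2) S z (1, 0)) S :=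
    (hΦ.continuousOn_fderivWithin hu le_rfl).clm_apply continuousOn_const
  set Ψ : ℝ → ℝ → ℝ := fun ε t => fderivWithin ℝ (fun z : ℝ × ℝ => Φ z.1 z.2) S (ε, t) (1, 0)
  have hd : ∀ ε ∈ Ioo (-δ) δ, ∀ t ∈ Icc t₀ t₁, HasDerivAt (fun ε => Φ ε t) (Ψ ε t) ε := by
    intro ε hε t h
    have h1 := (hΦ.differentiableOn (by simp) (ε, t) ⟨hε, h⟩).hasFDerivWithinAt
    have h2 : HasDerivWithinAt (fun ε : ℝ => (ε, t)) ((1 : ℝ), (0 : ℝ)) (Ioo (-δ) δ) ε :=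
      (hasDerivWithinAt_id _ _).prodMk (hasDerivWithinAt_const _ _ _)
    exact (h1.comp_hasDerivWithinAt (f := fun ε : ℝ => (ε, t)) ε h2
      fun x hx => ⟨hx, h⟩).hasDerivAt (Ioo_mem_nhds hε.1 hε.2)
  have h0 : (0 : ℝ) ∈ Ioo (-δ) δ := ⟨by linarith, hδ⟩
  have hcut : ∀ ε ∈ Ioo (-δ) δ, ContinuousOn (Φ ε) (Icc t₀ t₁) := fun ε hε =>
    hΦ.continuousOn.comp (f := fun t : ℝ => (ε, t)) (by fun_prop) fun t h => ⟨hε, h⟩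
  have hcut' : ∀ ε ∈ Ioo (-δ) δ, ContinuousOn (Ψ ε) (Icc t₀ t₁) := fun ε hε =>
    hc.comp (f := fun t : ℝ => (ε, t)) (by fun_prop) fun t h => ⟨hε, h⟩
  -- Halving `δ` gives a compact rectangle, on which the `ε`-derivative has a constant bound; this
  -- is the dominating function.
  obtain ⟨C, hC⟩ := (isCompact_Icc (a := -(δ / 2)) (b := δ / 2)).prod
    (isCompact_Icc (a := t₀) (b := t₁)) |>.exists_bound_of_continuousOn
      (hc.mono (prod_mono_left fun x hx => ⟨by linarith [hx.1], by linarith [hx.2]⟩))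
  have huI : Set.uIoc t₀ t₁ ⊆ Icc t₀ t₁ := by
    rw [uIoc_of_le ht.le]; exact Ioc_subset_Icc_self
  refine ⟨Ψ 0, hcut' 0 h0, fun t h => hd 0 h0 t h, ?_⟩
  refine (intervalIntegral.hasDerivAt_integral_of_dominated_loc_of_deriv_le (F := Φ) (F' := Ψ)
    (s := Ioo (-(δ / 2)) (δ / 2)) (bound := fun _ => C) (Ioo_mem_nhds (by linarith) (by linarith))
    ?_ ?_ ?_ ?_ intervalIntegrable_const ?_).2
  · filter_upwards [Ioo_mem_nhds h0.1 h0.2] with ε hε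
    exact ((hcut ε hε).mono huI).aestronglyMeasurable measurableSet_uIoc
  · exact ContinuousOn.intervalIntegrable (by rw [uIcc_of_le ht.le]; exact hcut 0 h0)
  · exact ((hcut' 0 h0).mono huI).aestronglyMeasurable measurableSet_uIoc
  · exact Filter.Eventually.of_forall fun t h ε hε =>
      hC (ε, t) ⟨Ioo_subset_Icc_self hε, huI h⟩
  · exact Filter.Eventually.of_forall fun t h ε hε =>
      hd ε ⟨by linarith [hε.1], by linarith [hε.2]⟩ t (huI h)

/-- The fundamental lemma of the calculus of variations, localized at an interior point. -/
lemma eq_zero_of_forall_integral_smul_eq_zero {t₀ t₁ τ η : ℝ} (hη : 0 < η) {g : ℝ → ℝ}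
    (hg : ContinuousOn g (Icc t₀ t₁)) (hτ : τ ∈ Ioo t₀ t₁)
    (h : ∀ f : ℝ → ℝ, ContDiff ℝ ∞ f → tsupport f ⊆ Ioo t₀ t₁ ∩ Metric.ball τ η →
      ∫ t in t₀..t₁, f t * g t = 0) : g τ = 0 := by
  -- Only positivity has to be excluded, as the hypotheses are stable under `g ↦ -g`. The test
  -- functions are confined to a ball around `τ` because homotopies are constructed only for
  -- variations supported near a given time.
  have key : ∀ g : ℝ → ℝ, ContinuousOn g (Icc t₀ t₁) →
      (∀ f : ℝ → ℝ, ContDiff ℝ ∞ f → tsupport f ⊆ Ioo t₀ t₁ ∩ Metric.ball τ η →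
      ∫ t in t₀..t₁, f t * g t = 0) → ¬ 0 < g τ := by
    intro g hg h hpos
    have hgc : ContinuousAt g τ := hg.continuousAt (Icc_mem_nhds hτ.1 hτ.2)
    have hU : {t | 0 < g t} ∩ (Ioo t₀ t₁ ∩ Metric.ball τ η) ∈ 𝓝 τ :=
      Filter.inter_mem (hgc.eventually (lt_mem_nhds hpos))
        (Filter.inter_mem (Ioo_mem_nhds hτ.1 hτ.2) (Metric.ball_mem_nhds _ hη))
    obtain ⟨r, hr, hrU⟩ := Metric.nhds_basis_closedBall.mem_iff.1 hU
    let ψ : ContDiffBump τ := ⟨r / 2, r, by linarith, by linarith⟩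
    have hsupp : tsupport ψ ⊆ {t | 0 < g t} ∩ (Ioo t₀ t₁ ∩ Metric.ball τ η) := by
      rw [ψ.tsupport_eq]; exact hrU
    have h0 := h ψ ψ.contDiff fun t ht => (hsupp ht).2
    refine (intervalIntegral.integral_pos (f := fun t => ψ t * g t) (hτ.1.trans hτ.2)
      (ψ.continuous.continuousOn.mul hg) (fun t _ => ?_) ⟨τ, Ioo_subset_Icc_self hτ, ?_⟩).ne' h0
    · by_cases ht : t ∈ tsupport ψ
      · exact mul_nonneg ψ.nonneg (hsupp ht).1.le
      · rw [image_eq_zero_of_notMem_tsupport ht, zero_mul]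
    · have : ψ τ = 1 := ψ.one_of_mem_closedBall (by simp [ψ]; linarith)
      rw [this, one_mul]; exact hpos
  rcases lt_trichotomy (g τ) 0 with h1 | h1 | h1
  · refine absurd ?_ (key (fun t => -g t) hg.neg fun f hf hs => ?_)
    · simpa using h1
    · simp [h f hf hs]
  · exact h1
  · exact absurd h1 (key g hg h)

end Calculus

/-! ### Fibrewise linear functions on a vector bundle -/

section FiberwiseLinear

variable {E : Type*} [NormedAddCommGroup E] [NormedSpace ℝ E]
  {Q : Type*} [TopologicalSpace Q] [ChartedSpace E Q]
  {K : Type*} [NormedAddCommGroup K] [NormedSpace ℝ K]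
  {W : Q → Type*} [TopologicalSpace (TotalSpace K W)]
  [∀ x, AddCommGroup (W x)] [∀ x, Module ℝ (W x)] [∀ x, TopologicalSpace (W x)]
  [FiberBundle K W] [VectorBundle ℝ K W]
  {EM : Type*} [NormedAddCommGroup EM] [NormedSpace ℝ EM]
  {HM : Type*} [TopologicalSpace HM] {IM : ModelWithCorners ℝ EM HM}
  {M : Type*} [TopologicalSpace M] [ChartedSpace HM M]

lemma sum_section_apply {ι : Type*} (t : Finset ι) (s : ι → Cₛ^∞⟮𝓘(ℝ, E); K, W⟯) (x : Q) :
    (∑ i ∈ t, s i) x = ∑ i ∈ t, s i x := by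
  have := congrFun (map_sum (ContMDiffSection.coeAddHom 𝓘(ℝ, E) K ∞ W) s t) x
  rw [Finset.sum_apply] at this
  exact this

/-- The fibre coordinate in a trivialization is linear. -/
lemma trivialization_sum_smul (x₀ : Q) {x : Q} (hx : x ∈ (trivializationAt K W x₀).baseSet)
    {ι : Type*} (t : Finset ι) (c : ι → ℝ) (w : ι → W x) :
    (trivializationAt K W x₀ ⟨x, ∑ i ∈ t, c i • w i⟩).2 =
      ∑ i ∈ t, c i • (trivializationAt K W x₀ ⟨x, w i⟩).2 := by
  have h : ∀ v : W x, (trivializationAt K W x₀ ⟨x, v⟩).2 =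
      (trivializationAt K W x₀).continuousLinearEquivAt ℝ x hx v := fun _ => rfl
  simp only [h, map_sum, map_smul]

/-- Paths and homotopies are written throughout as combinations of fixed global sections along a
base map, so their regularity reduces to that of the coefficients and of the base map. -/
lemma contMDiffWithinAt_sum_smul_section {n : WithTop ℕ∞} (hn : n ≤ ∞) {S : Set M} {m : M}
    {b : M → Q} (hb : ContMDiffWithinAt IM 𝓘(ℝ, E) n b S m) {ι : Type*} (t : Finset ι)
    {c : ι → M → ℝ} (hc : ∀ i ∈ t, ContMDiffWithinAt IM 𝓘(ℝ, ℝ) n (c i) S m)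
    (s : ι → Cₛ^∞⟮𝓘(ℝ, E); K, W⟯) :
    ContMDiffWithinAt IM (𝓘(ℝ, E).prod 𝓘(ℝ, K)) n
      (fun m => (⟨b m, ∑ i ∈ t, c i m • s i (b m)⟩ : TotalSpace K W)) S m := by
  rw [contMDiffWithinAt_totalSpace]
  refine ⟨hb, ?_⟩
  have hev : ∀ᶠ m' in 𝓝[insert m S] m, b m' ∈ (trivializationAt K W (b m)).baseSet :=
    hb.continuousWithinAt.insert.eventually_mem ((trivializationAt K W (b m)).open_baseSet.mem_nhds
      (FiberBundle.mem_baseSet_trivializationAt K W (b m)))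
  have h : ContMDiffWithinAt IM 𝓘(ℝ, K) n
      (fun m' => ∑ i ∈ t, c i m' • (trivializationAt K W (b m) ⟨b m', s i (b m')⟩).2) S m := by
    refine ContMDiffWithinAt.sum fun i hi => (hc i hi).smul ?_
    have h1 := ((s i).contMDiff (b m)).of_le hn
    rw [contMDiffAt_section] at h1
    exact ContMDiffAt.comp_contMDiffWithinAt (g := fun x => (trivializationAt K W (b m) ⟨x, s i x⟩).2)
      m h1 hb
  refine h.congr_of_eventuallyEq ?_ ?_
  · filter_upwards [nhdsWithin_mono m (subset_insert m S) hev] with m' hm'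
    exact trivialization_sum_smul _ hm' _ _ _
  · exact trivialization_sum_smul _ (FiberBundle.mem_baseSet_trivializationAt K W (b m)) _ _ _

section Linear
variable [∀ x, IsTopologicalAddGroup (W x)] [∀ x, ContinuousSMul ℝ (W x)]
  [IsManifold 𝓘(ℝ, E) ∞ Q] [ContMDiffVectorBundle ∞ K W 𝓘(ℝ, E)]

/-- The fibrewise linear function on `W` given by a section of the dual bundle. -/
def fiberLinear (σ : Cₛ^∞⟮𝓘(ℝ, E); K →L[ℝ] ℝ, DualFiber W⟯) (z : TotalSpace K W) : ℝ := σ z.1 z.2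

lemma contMDiff_fiberLinear (σ : Cₛ^∞⟮𝓘(ℝ, E); K →L[ℝ] ℝ, DualFiber W⟯) :
    ContMDiff (𝓘(ℝ, E).prod 𝓘(ℝ, K)) 𝓘(ℝ, ℝ) ∞ (fiberLinear σ) := by
  have h1 := σ.contMDiff.comp (contMDiff_proj W (IB := 𝓘(ℝ, E)) (n := ∞) (F := K))
  have h2 := ContMDiff.clm_bundle_apply (F₂ := ℝ) (E₂ := fun _ => ℝ) (b := π K W) (v := fun z => z.2)
    (ϕ := fun z => σ z.1) h1 contMDiff_id
  exact fun z => ((contMDiffAt_totalSpace).1 (h2 z)).2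

lemma mdifferentiableAt_fiberLinear (σ : Cₛ^∞⟮𝓘(ℝ, E); K →L[ℝ] ℝ, DualFiber W⟯)
    (z : TotalSpace K W) :
    MDifferentiableAt (𝓘(ℝ, E).prod 𝓘(ℝ, K)) 𝓘(ℝ, ℝ) (fiberLinear σ) z :=
  (contMDiff_fiberLinear σ).mdifferentiable (by simp) z

/-- The preferred chart of the total space at `z` is built from this very trivialization, in which
it becomes the identity. Tangent vectors at `z` can thus be read as pairs in `E × K`. -/
lemma hasMFDerivAt_trivializationAt (z : TotalSpace K W) :
    HasMFDerivAt (𝓘(ℝ, E).prod 𝓘(ℝ, K)) (𝓘(ℝ, E).prod 𝓘(ℝ, K)) (trivializationAt K W z.1) z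
      (ContinuousLinearMap.id ℝ (E × K)) := by
  refine ⟨(trivializationAt K W z.1).continuousAt
    (FiberBundle.mem_trivializationAt_proj_source), ?_⟩
  refine (hasFDerivWithinAt_id _ _).congr_of_eventuallyEq ?_ ?_
  · filter_upwards [extChartAt_target_mem_nhdsWithin (I := 𝓘(ℝ, E).prod 𝓘(ℝ, K)) z] with y hy
    exact FiberBundle.writtenInExtChartAt_trivializationAt hy
  · exact FiberBundle.writtenInExtChartAt_trivializationAt (mem_extChartAt_target z)

lemma mfderiv_proj_apply (z : TotalSpace K W) (u : E × K) :
    (mfderiv (𝓘(ℝ, E).prod 𝓘(ℝ, K)) 𝓘(ℝ, E) (π K W) z u : E) = u.1 := by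
  have h1 : HasMFDerivAt (𝓘(ℝ, E).prod 𝓘(ℝ, K)) 𝓘(ℝ, E)
      (Prod.fst ∘ (trivializationAt K W z.1)) z
      ((ContinuousLinearMap.fst ℝ E K).comp (ContinuousLinearMap.id ℝ (E × K))) :=
    HasMFDerivAt.comp z (hasMFDerivAt_fst _) (hasMFDerivAt_trivializationAt z)
  have h2 := h1.congr_of_eventuallyEq (f₁ := π K W) ?_
  · rw [h2.mfderiv]; rfl
  · filter_upwards [(trivializationAt K W z.1).open_source.mem_nhds
      (FiberBundle.mem_trivializationAt_proj_source)] with y hy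
    exact ((trivializationAt K W z.1).coe_fst hy).symm

variable [FiniteDimensional ℝ E] [FiniteDimensional ℝ K] [T2Space Q]

/-- Every covector in a trivialization extends to a section of the dual bundle, which is constant
in this trivialization near the given point. -/
lemma exists_dual_section_eventuallyEq (x : Q) (l : K →L[ℝ] ℝ) :
    ∃ σ : Cₛ^∞⟮𝓘(ℝ, E); K →L[ℝ] ℝ, DualFiber W⟯, ∀ᶠ y in 𝓝 x, ∀ w : W y,
      σ y w = l (trivializationAt K W x ⟨y, w⟩).2 := by
  set e := trivializationAt K W x with he
  have hx : x ∈ e.baseSet := FiberBundle.mem_baseSet_trivializationAt K W x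
  obtain ⟨ψ, -, hψ⟩ := (SmoothBumpFunction.nhds_basis_tsupport (I := 𝓘(ℝ, E)) x).mem_iff.1
    (e.open_baseSet.mem_nhds hx)
  -- A bump function supported in the trivialization makes pairing with `l` globally defined and
  -- `C^∞`-linear in the section, so the covector construction produces a smooth dual section.
  have hΘ : ∀ s : Cₛ^∞⟮𝓘(ℝ, E); K, W⟯, ContMDiff 𝓘(ℝ, E) 𝓘(ℝ, ℝ) ∞
      (fun y => ψ y • l (e ⟨y, s y⟩).2) := by
    intro s
    refine contMDiff_of_tsupport fun y hy => ?_
    have hy' : y ∈ e.baseSet := hψ (closure_mono (Function.support_smul_subset_left _ _) hy)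
    refine ψ.contMDiffAt.smul (l.contMDiff.contMDiffAt.comp y ?_)
    exact (e.contMDiffAt_section_iff hy').1 (s.contMDiff y)
  let Θ : Cₛ^∞⟮𝓘(ℝ, E); K, W⟯ → C^∞⟮𝓘(ℝ, E), Q; ℝ⟯ := fun s => ⟨_, hΘ s⟩
  have key : ∀ y (w : W y) (hy : y ∈ e.baseSet), (e ⟨y, w⟩).2 = e.continuousLinearEquivAt ℝ y hy w :=
    fun _ _ _ => rfl
  have hlin : IsFunctionLinear Θ := by
    refine ⟨fun s s' => ?_, fun f s => ?_⟩ <;> ext y <;> by_cases hy : y ∈ tsupport ψ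
    · change ψ y * l (e ⟨y, s y + s' y⟩).2 = ψ y * l (e ⟨y, s y⟩).2 + ψ y * l (e ⟨y, s' y⟩).2
      simp only [key y _ (hψ hy), map_add, mul_add]
    · change ψ y * l (e ⟨y, s y + s' y⟩).2 = ψ y * l (e ⟨y, s y⟩).2 + ψ y * l (e ⟨y, s' y⟩).2
      simp [image_eq_zero_of_notMem_tsupport hy]
    · change ψ y * l (e ⟨y, f y • s y⟩).2 = f y * (ψ y * l (e ⟨y, s y⟩).2)
      simp only [key y _ (hψ hy), map_smul, smul_eq_mul]
      ring
    · change ψ y * l (e ⟨y, f y • s y⟩).2 = f y * (ψ y * l (e ⟨y, s y⟩).2)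
      simp [image_eq_zero_of_notMem_tsupport hy]
  refine ⟨⟨hlin.covector, hlin.contMDiff_covector⟩, ?_⟩
  filter_upwards [ψ.eventuallyEq_one] with y hy w
  obtain ⟨s, rfl⟩ := exists_section_apply_eq (E := E) (F := K) y w
  refine (hlin.covector_apply y s).trans ?_
  simp [Θ, hy]

/-- A tangent vector of a vector bundle is determined by its projection to the base and by the
derivatives of the fibrewise linear functions. -/
lemma tangent_ext {z : TotalSpace K W} {u u' : E × K} (h1 : u.1 = u'.1)
    (h2 : ∀ σ : Cₛ^∞⟮𝓘(ℝ, E); K →L[ℝ] ℝ, DualFiber W⟯,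
      mvfderiv (𝓘(ℝ, E).prod 𝓘(ℝ, K)) (fiberLinear σ) z u =
        mvfderiv (𝓘(ℝ, E).prod 𝓘(ℝ, K)) (fiberLinear σ) z u') : u = u' := by
  refine Prod.ext h1 ?_
  by_contra hne
  -- If the fibre components differ, some `l` separates them. The function of the dual section
  -- extending `l` is `l` composed with the fibre coordinate near `z`, so its derivative detects the
  -- difference.
  obtain ⟨l, hl⟩ := SeparatingDual.exists_ne_zero (R := ℝ) (sub_ne_zero.2 hne)
  obtain ⟨σ, hσ⟩ := exists_dual_section_eventuallyEq (E := E) (K := K) (W := W) z.1 l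
  have hd : HasMFDerivAt (𝓘(ℝ, E).prod 𝓘(ℝ, K)) 𝓘(ℝ, ℝ)
      ((l ∘ Prod.snd) ∘ (trivializationAt K W z.1)) z
      ((l.comp (ContinuousLinearMap.snd ℝ E K)).comp (ContinuousLinearMap.id ℝ (E × K))) :=
    HasMFDerivAt.comp z (HasMFDerivAt.comp _ l.hasMFDerivAt (hasMFDerivAt_snd _))
      (hasMFDerivAt_trivializationAt z)
  have hd' := hd.congr_of_eventuallyEq (f₁ := fiberLinear σ) <| by
    have : Filter.Tendsto (π K W) (𝓝 z) (𝓝 z.1) :=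
      (FiberBundle.continuous_proj K W).continuousAt
    filter_upwards [this.eventually hσ] with y hy
    exact hy y.2
  have hv : ∀ u : E × K, mvfderiv (𝓘(ℝ, E).prod 𝓘(ℝ, K)) (fiberLinear σ) z u = l u.2 := by
    intro u
    change (mfderiv (𝓘(ℝ, E).prod 𝓘(ℝ, K)) 𝓘(ℝ, ℝ) (fiberLinear σ) z u : ℝ) = l u.2
    rw [hd'.mfderiv]; rfl
  have := h2 σ
  rw [hv, hv] at this
  exact hl (by rw [map_sub, this, sub_self])

end Linear

end FiberwiseLinear

/-! ### Vertical and horizontal lifts -/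

section Lifts

variable {E : Type*} [NormedAddCommGroup E] [NormedSpace ℝ E]
  {Q : Type*} [TopologicalSpace Q] [ChartedSpace E Q]
  {K : Type*} [NormedAddCommGroup K] [NormedSpace ℝ K]
  {W : Q → Type*} [TopologicalSpace (TotalSpace K W)]
  [∀ x, AddCommGroup (W x)] [∀ x, Module ℝ (W x)] [∀ x, TopologicalSpace (W x)]
  [FiberBundle K W] [VectorBundle ℝ K W]
  {EM : Type*} [NormedAddCommGroup EM] [NormedSpace ℝ EM]
  {HM : Type*} [TopologicalSpace HM] {IM : ModelWithCorners ℝ EM HM}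
  {M : Type*} [TopologicalSpace M] [ChartedSpace HM M]
  [∀ x, IsTopologicalAddGroup (W x)] [∀ x, ContinuousSMul ℝ (W x)]
  [IsManifold 𝓘(ℝ, E) ∞ Q] [ContMDiffVectorBundle ∞ K W 𝓘(ℝ, E)]

lemma mvfderiv_apply_of_hasMFDerivAt {g : M → ℝ} {m : M} {g' : TangentSpace IM m →L[ℝ] ℝ}
    (h : HasMFDerivAt IM 𝓘(ℝ, ℝ) g m g') (u : TangentSpace IM m) : mvfderiv IM g m u = g' u := by
  change (mfderiv IM 𝓘(ℝ, ℝ) g m u : ℝ) = g' u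
  rw [h.mfderiv]
  rfl

lemma mvfderiv_congr {g g' : M → ℝ} {m : M} (h : g =ᶠ[𝓝 m] g') (u : TangentSpace IM m) :
    mvfderiv IM g m u = mvfderiv IM g' m u :=
  congrArg (fun l : TangentSpace IM m →L[ℝ] ℝ => l u) (h.mfderiv_eq (I := IM) (I' := 𝓘(ℝ, ℝ)))

lemma hasMFDerivAt_sum_mul {ι : Type} {t : Finset ι} {c g : ι → M → ℝ} {m : M}
    {c' g' : ι → TangentSpace IM m →L[ℝ] ℝ} (hc : ∀ i ∈ t, HasMFDerivAt IM 𝓘(ℝ, ℝ) (c i) m (c' i))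
    (hg : ∀ i ∈ t, HasMFDerivAt IM 𝓘(ℝ, ℝ) (g i) m (g' i)) :
    HasMFDerivAt IM 𝓘(ℝ, ℝ) (fun m => ∑ i ∈ t, c i m * g i m) m
      (∑ i ∈ t, (c i m • g' i + g i m • c' i)) := by
  have h := HasMFDerivAt.sum (t := t) (f := fun i => c i * g i)
    (f' := fun i => c i m • g' i + g i m • c' i) fun i hi => (hc i hi).mul (hg i hi)
  refine h.congr_of_eventuallyEq (Filter.Eventually.of_forall fun m => ?_)
  simp

lemma mvfderiv_sum_mul {ι : Type} {t : Finset ι} {c g : ι → M → ℝ} {m : M}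
    (hc : ∀ i ∈ t, MDifferentiableAt IM 𝓘(ℝ, ℝ) (c i) m)
    (hg : ∀ i ∈ t, MDifferentiableAt IM 𝓘(ℝ, ℝ) (g i) m) (u : TangentSpace IM m) :
    mvfderiv IM (fun m => ∑ i ∈ t, c i m * g i m) m u =
      ∑ i ∈ t, (c i m * mvfderiv IM (g i) m u + g i m * mvfderiv IM (c i) m u) := by
  have h : ∀ c' g' : ι → EM →L[ℝ] ℝ, ∀ u, (∑ i ∈ t, (c i m • g' i + g i m • c' i)) u =
      ∑ i ∈ t, (c i m * g' i u + g i m * c' i u) := fun c' g' u => by simp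
  refine (mvfderiv_apply_of_hasMFDerivAt (hasMFDerivAt_sum_mul (c' := fun i => mvfderiv IM (c i) m)
    (g' := fun i => mvfderiv IM (g i) m) (fun i hi => (hc i hi).hasMFDerivAt)
    fun i hi => (hg i hi).hasMFDerivAt) u).trans ?_
  exact h _ _ u

lemma mvfderiv_one_of_hasDerivAt {g : ℝ → ℝ} {t g' : ℝ} (h : HasDerivAt g g' t) :
    mvfderiv 𝓘(ℝ, ℝ) g t (1 : ℝ) = g' := by
  refine (mvfderiv_apply_of_hasMFDerivAt h.hasFDerivAt.hasMFDerivAt (1 : ℝ)).trans ?_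
  exact (one_smul ℝ g')

lemma MDifferentiableAt.hasDerivAt_mvfderiv {g : ℝ → ℝ} {t : ℝ}
    (h : MDifferentiableAt 𝓘(ℝ, ℝ) 𝓘(ℝ, ℝ) g t) :
    HasDerivAt g (mvfderiv 𝓘(ℝ, ℝ) g t (1 : ℝ)) t := by
  have h1 := h.differentiableAt.hasDerivAt
  rwa [mvfderiv_one_of_hasDerivAt h1]

lemma mvfderiv_fiberLinear_vertLift (σ : Cₛ^∞⟮𝓘(ℝ, E); K →L[ℝ] ℝ, DualFiber W⟯)
    (z : TotalSpace K W) (w : W z.1) :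
    mvfderiv (𝓘(ℝ, E).prod 𝓘(ℝ, K)) (fiberLinear σ) z (vertLift (E := E) z w) = σ z.1 w := by
  have hc := (hasMFDerivAt_vertical (E := E) z w)
  have h0 : (⟨z.1, z.2 + (0 : ℝ) • w⟩ : TotalSpace K W) = z := by simp
  have h1 := mvfderiv_comp_apply_of_eq (f := fun ε : ℝ => (⟨z.1, z.2 + ε • w⟩ : TotalSpace K W))
    0 (mdifferentiableAt_fiberLinear σ z) hc.mdifferentiableAt h0 (1 : ℝ)
  refine h1.symm.trans (mvfderiv_one_of_hasDerivAt ?_)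
  have h2 : (fiberLinear σ ∘ fun ε : ℝ => (⟨z.1, z.2 + ε • w⟩ : TotalSpace K W)) =
      fun ε : ℝ => σ z.1 z.2 + ε * σ z.1 w := by
    funext ε
    simp [fiberLinear]
  rw [h2]
  simpa using ((hasDerivAt_id (0 : ℝ)).mul_const (σ z.1 w)).const_add (σ z.1 z.2)

lemma vertLift_apply (z : TotalSpace K W) (w : W z.1) : (vertLift (E := E) z w : E × K) =
    (0, (trivializationAt K W z.1).continuousLinearEquivAt ℝ z.1
      (FiberBundle.mem_baseSet_trivializationAt K W z.1) w) :=
  mfderiv_vertical z w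

lemma mfderiv_proj_vertLift (z : TotalSpace K W) (w : W z.1) :
    (vertLift (E := E) z w : E × K).1 = 0 := by
  rw [vertLift_apply]

/-- A tangent vector that projects to zero is a vertical lift. -/
lemma exists_vertLift_eq {z : TotalSpace K W} {u : E × K} (hu : u.1 = 0) :
    ∃ w : W z.1, (vertLift (E := E) z w : E × K) = u := by
  refine ⟨((trivializationAt K W z.1).continuousLinearEquivAt ℝ z.1
      (FiberBundle.mem_baseSet_trivializationAt K W z.1)).symm u.2, ?_⟩
  rw [vertLift_apply, ContinuousLinearEquiv.apply_symm_apply, ← hu]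

lemma mfderiv_section_fst {ξ : ∀ x, W x} {x : Q}
    (hξ : MDifferentiableAt 𝓘(ℝ, E) (𝓘(ℝ, E).prod 𝓘(ℝ, K)) (fun y => (⟨y, ξ y⟩ : TotalSpace K W)) x)
    (v : TangentSpace 𝓘(ℝ, E) x) :
    (mfderiv 𝓘(ℝ, E) (𝓘(ℝ, E).prod 𝓘(ℝ, K)) (fun y => (⟨y, ξ y⟩ : TotalSpace K W)) x v : E × K).1
      = v := by
  have h := mfderiv_comp_apply x (g := π K W) ((contMDiff_proj W (IB := 𝓘(ℝ, E)) (n := 1)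
    (F := K)).mdifferentiable (by simp) _) hξ v
  refine ((mfderiv_proj_apply _ _).symm.trans h.symm).trans ?_
  exact congrArg (fun f : TangentSpace 𝓘(ℝ, E) x →L[ℝ] E => f v) (mfderiv_id (I := 𝓘(ℝ, E)) (x := x))

lemma mfderiv_map_fst {f : M → TotalSpace K W} {m : M}
    (hf : MDifferentiableAt IM (𝓘(ℝ, E).prod 𝓘(ℝ, K)) f m) (u : TangentSpace IM m) :
    (mfderiv IM (𝓘(ℝ, E).prod 𝓘(ℝ, K)) f m u : E × K).1 =
      (mfderiv IM 𝓘(ℝ, E) (fun m => (f m).1) m u : E) := by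
  have h := mfderiv_comp_apply m (g := π K W) ((contMDiff_proj W (IB := 𝓘(ℝ, E)) (n := 1)
    (F := K)).mdifferentiable (by simp) _) hf u
  exact (mfderiv_proj_apply _ _).symm.trans h.symm

lemma horLift_apply (cov : CovariantDerivative 𝓘(ℝ, E) K W) (z : TotalSpace K W)
    (v : TangentSpace 𝓘(ℝ, E) z.1) : (horLift cov z v : E × K) =
    (fun a b : E × K => a - b) (mfderiv 𝓘(ℝ, E) (𝓘(ℝ, E).prod 𝓘(ℝ, K))
      (fun y => (⟨y, FiberBundle.extend K z.2 y⟩ : TotalSpace K W)) z.1 v)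
    (vertLift (E := E) z (cov (FiberBundle.extend K z.2) z.1 v)) := rfl

lemma horLift_fst (cov : CovariantDerivative 𝓘(ℝ, E) K W) (z : TotalSpace K W)
    (v : TangentSpace 𝓘(ℝ, E) z.1) : (horLift cov z v : E × K).1 = v := by
  rw [horLift_apply]
  refine (congrArg₂ (fun a b : E => a - b) (mfderiv_section_fst (ξ := FiberBundle.extend K z.2)
    (FiberBundle.mdifferentiableAt_extend ..) v) (mfderiv_proj_vertLift z _)).trans ?_
  exact sub_zero (G := E) v

lemma lift_fst (cov : CovariantDerivative 𝓘(ℝ, E) K W) (z : TotalSpace K W)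
    (w : W z.1) (v : TangentSpace 𝓘(ℝ, E) z.1) :
    (vertLift (E := E) z w + horLift cov z v : E × K).1 = v := by
  refine (congrArg₂ (fun a b : E => a + b) (mfderiv_proj_vertLift z w) (horLift_fst cov z v)).trans ?_
  exact zero_add (M := E) v

/-- Every tangent vector splits into a vertical and a horizontal part. -/
lemma exists_eq_vertLift_add_horLift (cov : CovariantDerivative 𝓘(ℝ, E) K W) (z : TotalSpace K W)
    (u : E × K) : ∃ w : W z.1, u = (vertLift (E := E) z w + horLift cov z u.1 : E × K) := by
  obtain ⟨w, hw⟩ := exists_vertLift_eq (z := z)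
    (u := (fun a b : E × K => a - b) u (horLift cov z u.1))
    ((congrArg (fun b : E => u.1 - b) (horLift_fst cov z u.1)).trans (sub_self u.1))
  exact ⟨w, sub_eq_iff_eq_add.1 hw.symm⟩

variable [FiniteDimensional ℝ E] [FiniteDimensional ℝ K] [T2Space Q]

/-- With `ξ` a section through `z`, the definition `H_z v = Tξ(v) - V_z(∇_v ξ)` gives `v[⟨σ, ξ⟩] -
⟨σ, ∇_v ξ⟩`, which is `⟨∇*_v σ, ξ⟩`. Together with `tangent_ext` this allows velocities to be
computed without Christoffel symbols. -/
lemma mvfderiv_fiberLinear_horLift (cov : CovariantDerivative 𝓘(ℝ, E) K W)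
    (σ : Cₛ^∞⟮𝓘(ℝ, E); K →L[ℝ] ℝ, DualFiber W⟯) (z : TotalSpace K W)
    (v : TangentSpace 𝓘(ℝ, E) z.1) :
    mvfderiv (𝓘(ℝ, E).prod 𝓘(ℝ, K)) (fiberLinear σ) z (horLift cov z v) =
      dualCov cov σ z.1 v z.2 := by
  have hz : (⟨z.1, FiberBundle.extend K z.2 z.1⟩ : TotalSpace K W) = z := by simp
  have hext : MDifferentiableAt 𝓘(ℝ, E) (𝓘(ℝ, E).prod 𝓘(ℝ, K))
      (fun y => (⟨y, FiberBundle.extend K z.2 y⟩ : TotalSpace K W)) z.1 :=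
    FiberBundle.mdifferentiableAt_extend ..
  have h1 := dualCov_apply cov (σ := σ) σ.mdifferentiableAt hext v
  have h2 := mvfderiv_comp_apply_of_eq (f := fun y => (⟨y, FiberBundle.extend K z.2 y⟩ : TotalSpace K W))
    z.1 (mdifferentiableAt_fiberLinear σ z) hext hz v
  have h3 := mvfderiv_fiberLinear_vertLift (E := E) σ z (cov (FiberBundle.extend K z.2) z.1 v)
  have h4 : mvfderiv (𝓘(ℝ, E).prod 𝓘(ℝ, K)) (fiberLinear σ) z (horLift cov z v) =
      mvfderiv (𝓘(ℝ, E).prod 𝓘(ℝ, K)) (fiberLinear σ) z (mfderiv 𝓘(ℝ, E) (𝓘(ℝ, E).prod 𝓘(ℝ, K))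
        (fun y => (⟨y, FiberBundle.extend K z.2 y⟩ : TotalSpace K W)) z.1 v) -
      mvfderiv (𝓘(ℝ, E).prod 𝓘(ℝ, K)) (fiberLinear σ) z
        (vertLift (E := E) z (cov (FiberBundle.extend K z.2) z.1 v)) :=
    map_sub (mvfderiv (𝓘(ℝ, E).prod 𝓘(ℝ, K)) (fiberLinear σ) z) _ _
  rw [h4, h3, ← h2]
  simp only [FiberBundle.extend_apply_self] at h1
  exact h1.symm

/-- The velocity of a combination `∑ cᵢ sᵢ` of sections along a map to the base. -/
lemma mfderiv_sum_smul_section (cov : CovariantDerivative 𝓘(ℝ, E) K W) {ι : Type} (t : Finset ι)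
    {b : M → Q} {m : M} (hb : MDifferentiableAt IM 𝓘(ℝ, E) b m) {c : ι → M → ℝ}
    (hc : ∀ i ∈ t, MDifferentiableAt IM 𝓘(ℝ, ℝ) (c i) m)
    (s : ι → Cₛ^∞⟮𝓘(ℝ, E); K, W⟯)
    (hf : MDifferentiableAt IM (𝓘(ℝ, E).prod 𝓘(ℝ, K))
      (fun m => (⟨b m, ∑ i ∈ t, c i m • s i (b m)⟩ : TotalSpace K W)) m)
    (u : TangentSpace IM m) :
    (mfderiv IM (𝓘(ℝ, E).prod 𝓘(ℝ, K))
      (fun m => (⟨b m, ∑ i ∈ t, c i m • s i (b m)⟩ : TotalSpace K W)) m u : E × K) =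
      (vertLift (E := E) (⟨b m, ∑ i ∈ t, c i m • s i (b m)⟩ : TotalSpace K W)
          (∑ i ∈ t, (mvfderiv IM (c i) m u • s i (b m) +
            c i m • cov (s i) (b m) (mfderiv IM 𝓘(ℝ, E) b m u))) +
        horLift cov (⟨b m, ∑ i ∈ t, c i m • s i (b m)⟩ : TotalSpace K W)
          (mfderiv IM 𝓘(ℝ, E) b m u) : E × K) := by
  -- Both sides project to the velocity of `b`. A dual section `σ` turns the curve into `∑ cᵢ ⟨σ,
  -- sᵢ⟩`, and the claim becomes the product rule together with the definition of `∇*`.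
  refine tangent_ext (z := ⟨b m, ∑ i ∈ t, c i m • s i (b m)⟩) ?_ fun σ => ?_
  · rw [mfderiv_map_fst hf, lift_fst]
  refine (mvfderiv_comp_apply (f := fun m => (⟨b m, ∑ i ∈ t, c i m • s i (b m)⟩ : TotalSpace K W)) m
      (mdifferentiableAt_fiberLinear σ _) hf u).symm.trans ?_
  refine Eq.trans ?_ (map_add (mvfderiv (𝓘(ℝ, E).prod 𝓘(ℝ, K)) (fiberLinear σ) _) _ _).symm
  rw [mvfderiv_fiberLinear_vertLift, mvfderiv_fiberLinear_horLift]
  have h1 : (fiberLinear σ ∘ fun m => (⟨b m, ∑ i ∈ t, c i m • s i (b m)⟩ : TotalSpace K W)) =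
      fun m => ∑ i ∈ t, c i m * pairing σ (s i) (b m) := by
    funext m; simp [fiberLinear, map_sum]
  have h2 : ∀ i ∈ t, HasMFDerivAt IM 𝓘(ℝ, ℝ) (fun m => pairing σ (s i) (b m)) m
      ((mvfderiv 𝓘(ℝ, E) (pairing σ (s i)) (b m)).comp (mfderiv IM 𝓘(ℝ, E) b m) :
        TangentSpace IM m →L[ℝ] ℝ) :=
    fun i _ => HasMFDerivAt.comp m
      ((pairing σ (s i)).contMDiff.mdifferentiable (by simp) (b m)).hasMFDerivAt hb.hasMFDerivAt
  rw [h1]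
  refine (mvfderiv_sum_mul hc (fun i hi => (h2 i hi).mdifferentiableAt) u).trans ?_
  have h5 : ∀ i ∈ t, mvfderiv IM (fun m => pairing σ (s i) (b m)) m u =
      dualCov cov σ (b m) (mfderiv IM 𝓘(ℝ, E) b m u) (s i (b m)) +
        σ (b m) (cov (s i) (b m) (mfderiv IM 𝓘(ℝ, E) b m u)) := fun i hi => by
    rw [dualCov_apply cov (σ := σ) σ.mdifferentiableAt (s i).mdifferentiableAt]
    exact (mvfderiv_apply_of_hasMFDerivAt (h2 i hi) u).trans (sub_add_cancel _ _).symm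
  rw [map_sum, map_sum, ← Finset.sum_add_distrib]
  refine Finset.sum_congr rfl fun i hi => ?_
  rw [map_add, map_smul, map_smul, map_smul, h5 i hi, pairing_apply]
  simp only [smul_eq_mul]
  ring

end Lifts

/-! ### Frames of global sections and the derivative of the duality pairing -/

section Frames

variable {E : Type*} [NormedAddCommGroup E] [NormedSpace ℝ E]
  {Q : Type*} [TopologicalSpace Q] [ChartedSpace E Q]
  {K : Type*} [NormedAddCommGroup K] [NormedSpace ℝ K]
  {W : Q → Type*} [TopologicalSpace (TotalSpace K W)]
  [∀ x, AddCommGroup (W x)] [∀ x, Module ℝ (W x)] [∀ x, TopologicalSpace (W x)]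
  [FiberBundle K W] [VectorBundle ℝ K W]
  {EM : Type*} [NormedAddCommGroup EM] [NormedSpace ℝ EM]
  {HM : Type*} [TopologicalSpace HM] {IM : ModelWithCorners ℝ EM HM}
  {M : Type*} [TopologicalSpace M] [ChartedSpace HM M]
  [∀ x, IsTopologicalAddGroup (W x)] [∀ x, ContinuousSMul ℝ (W x)]
  [IsManifold 𝓘(ℝ, E) ∞ Q] [ContMDiffVectorBundle ∞ K W 𝓘(ℝ, E)]
  [FiniteDimensional ℝ E] [FiniteDimensional ℝ K] [T2Space Q]

/-- Near every point there are a frame and its dual frame that consist of global sections. -/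
lemma exists_local_frame (x : Q) :
    ∃ (e : Fin (Module.finrank ℝ K) → Cₛ^∞⟮𝓘(ℝ, E); K, W⟯)
      (σ : Fin (Module.finrank ℝ K) → Cₛ^∞⟮𝓘(ℝ, E); K →L[ℝ] ℝ, DualFiber W⟯),
      ∀ᶠ y in 𝓝 x, (∀ w : W y, w = ∑ i, σ i y w • e i y) ∧
        ∀ i j, σ i y (e j y) = if i = j then 1 else 0 := by
  let t := trivializationAt K W x
  have hx : x ∈ t.baseSet := FiberBundle.mem_baseSet_trivializationAt K W x
  let b := Module.finBasis ℝ K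
  have he : ∀ i, ∃ e : Cₛ^∞⟮𝓘(ℝ, E); K, W⟯, ∀ᶠ y in 𝓝 x, e y = t.localFrame b i y := fun i =>
    exists_section_eventuallyEq t.open_baseSet hx (t.contMDiffOn_localFrame_baseSet ∞ b i)
  choose e he using he
  choose σ hσ using fun i => exists_dual_section_eventuallyEq (E := E) (W := W) x
    (LinearMap.toContinuousLinearMap (b.coord i))
  refine ⟨e, σ, ?_⟩
  filter_upwards [Filter.eventually_all.2 he, Filter.eventually_all.2 hσ,
    t.open_baseSet.mem_nhds hx] with y h1 h2 hy
  have h3 : ∀ i, t.continuousLinearEquivAt ℝ y hy (e i y) = b i := by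
    intro i
    rw [h1 i, t.localFrame_apply_of_mem_baseSet b hy]
    simp only [Trivialization.basisAt, Module.Basis.map_apply]
    exact (t.continuousLinearEquivAt ℝ y hy).apply_symm_apply (b i)
  have h4 : ∀ i (w : W y), σ i y w = b.repr (t.continuousLinearEquivAt ℝ y hy w) i := fun i w => h2 i w
  refine ⟨fun w => ?_, fun i j => ?_⟩
  · apply (t.continuousLinearEquivAt ℝ y hy).injective
    simp only [map_sum, map_smul, h3, h4, b.sum_repr]
  · rw [h4, h3, b.repr_self, Finsupp.single_apply]
    simp only [eq_comm]

/-- Over a compact set, finitely many global sections generate the bundle. -/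
lemma exists_frame_of_isCompact [SecondCountableTopology Q] {C : Set Q} (hC : IsCompact C) :
    ∃ (N : ℕ) (e : Fin N → Cₛ^∞⟮𝓘(ℝ, E); K, W⟯)
      (σ : Fin N → Cₛ^∞⟮𝓘(ℝ, E); K →L[ℝ] ℝ, DualFiber W⟯),
      ∀ y ∈ C, ∀ w : W y, w = ∑ i, σ i y w • e i y := by
  have : LocallyCompactSpace Q := Manifold.locallyCompact_of_finiteDimensional 𝓘(ℝ, E)
  choose e σ h using fun x : Q => exists_local_frame (E := E) (K := K) (W := W) x
  choose U hU hUo hxU using fun x => eventually_nhds_iff.1 (h x)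
  obtain ⟨T, -, hT⟩ := hC.elim_nhds_subcover U fun x _ => (hUo x).mem_nhds (hxU x)
  obtain ⟨φ, hφ⟩ := SmoothPartitionOfUnity.exists_isSubordinate 𝓘(ℝ, E) hC.isClosed
    (fun i : T => U i.1) (fun i => hUo _) (by simpa [iUnion_subtype] using hT)
  let ι := T × Fin (Module.finrank ℝ K)
  let eq := Fintype.equivFin ι
  let Φ : T → C^∞⟮𝓘(ℝ, E), Q; ℝ⟯ := fun j => ⟨φ j, (φ j).contMDiff⟩
  -- The local frames are kept and only the dual frames are multiplied by the partition of unity.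
  -- Each patch contributes `φ j y • w`, and these add up to `w`. The sections span but need not be
  -- independent.
  refine ⟨Fintype.card ι, fun i => e (eq.symm i).1.1 (eq.symm i).2,
    fun i => Φ (eq.symm i).1 •
      σ (eq.symm i).1.1 (eq.symm i).2, fun y hy w => ?_⟩
  rw [eq.symm.sum_comp (fun i : ι => ((Φ i.1 •
      σ i.1.1 i.2) y w • e i.1.1 i.2 y)), Fintype.sum_prod_type]
  have h1 : ∀ j : T, ∑ i, (Φ j • σ j.1 i) y w • e j.1 i y
      = φ j y • w := by
    intro j
    by_cases hj : y ∈ tsupport (φ j)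
    · conv_rhs => rw [(hU _ y (hφ j hj)).1 w, Finset.smul_sum]
      refine Finset.sum_congr rfl fun i _ => ?_
      rw [smul_smul]; rfl
    · have h0 : φ j y = 0 := image_eq_zero_of_notMem_tsupport hj
      rw [h0, zero_smul]
      refine Finset.sum_eq_zero fun i _ => ?_
      have : (Φ j • σ j.1 i) y w = φ j y * σ j.1 i y w := rfl
      rw [this, h0, zero_mul, zero_smul]
  simp only [h1]
  rw [← Finset.sum_smul]
  have h2 := φ.sum_eq_one hy
  rw [finsum_eq_sum_of_fintype] at h2
  rw [h2, one_smul]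

/-- The fibrewise linear function on the dual bundle given by a section. -/
def evalSection (s : Cₛ^∞⟮𝓘(ℝ, E); K, W⟯) :
    Cₛ^∞⟮𝓘(ℝ, E); (K →L[ℝ] ℝ) →L[ℝ] ℝ, DualFiber (DualFiber W)⟯ :=
  have h : IsFunctionLinear
      (fun τ : Cₛ^∞⟮𝓘(ℝ, E); K →L[ℝ] ℝ, DualFiber W⟯ => pairing τ s) :=
    ⟨fun τ τ' => by ext x; simp, fun f τ => by ext x; simp⟩
  ⟨h.covector, h.contMDiff_covector⟩

@[simp] lemma evalSection_apply (s : Cₛ^∞⟮𝓘(ℝ, E); K, W⟯) (x : Q) (τ : DualFiber W x) :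
    evalSection s x τ = τ (s x) := by
  obtain ⟨τ, rfl⟩ := exists_section_apply_eq (E := E) (F := K →L[ℝ] ℝ) (V := DualFiber W) x τ
  exact IsFunctionLinear.covector_apply _ x τ

lemma vertLift_injective (z : TotalSpace K W) {w w' : W z.1}
    (h : (vertLift (E := E) z w : E × K) = vertLift (E := E) z w') : w = w' := by
  rw [vertLift_apply, vertLift_apply] at h
  exact (ContinuousLinearEquiv.injective _) (Prod.ext_iff.1 h).2

/-- The derivative of the pairing of a path in the dual bundle with a path in the bundle. -/
lemma mvfderiv_pairing (cov : CovariantDerivative 𝓘(ℝ, E) K W) {b : M → Q} {α : ∀ m, W (b m)}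
    {β : ∀ m, DualFiber W (b m)} {m : M}
    (hα : MDifferentiableAt IM (𝓘(ℝ, E).prod 𝓘(ℝ, K)) (fun m => (⟨b m, α m⟩ : TotalSpace K W)) m)
    (hβ : MDifferentiableAt IM (𝓘(ℝ, E).prod 𝓘(ℝ, K →L[ℝ] ℝ))
      (fun m => (⟨b m, β m⟩ : TotalSpace (K →L[ℝ] ℝ) (DualFiber W))) m)
    {u : TangentSpace IM m} {v : TangentSpace 𝓘(ℝ, E) (b m)} {w : W (b m)} {r : DualFiber W (b m)}
    (h1 : (mfderiv IM (𝓘(ℝ, E).prod 𝓘(ℝ, K)) (fun m => (⟨b m, α m⟩ : TotalSpace K W)) m u : E × K) =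
      (vertLift (E := E) (⟨b m, α m⟩ : TotalSpace K W) w +
        horLift cov (⟨b m, α m⟩ : TotalSpace K W) v : E × K))
    (h2 : (mfderiv IM (𝓘(ℝ, E).prod 𝓘(ℝ, K →L[ℝ] ℝ))
        (fun m => (⟨b m, β m⟩ : TotalSpace (K →L[ℝ] ℝ) (DualFiber W))) m u : E × (K →L[ℝ] ℝ)) =
      (vertLift (E := E) (⟨b m, β m⟩ : TotalSpace (K →L[ℝ] ℝ) (DualFiber W)) r +
        horLift (dualCov cov) (⟨b m, β m⟩ : TotalSpace (K →L[ℝ] ℝ) (DualFiber W)) v :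
          E × (K →L[ℝ] ℝ))) :
    mvfderiv IM (fun m => β m (α m)) m u = r (α m) + β m w := by
  obtain ⟨e, σ, hσ⟩ := exists_local_frame (E := E) (K := K) (W := W) (b m)
  have hb : MDifferentiableAt IM 𝓘(ℝ, E) b m :=
    ((contMDiff_proj W (IB := 𝓘(ℝ, E)) (n := 1) (F := K)).mdifferentiable (by simp) _).comp m hα
  have hev := hb.continuousAt.eventually hσ
  let c : Fin (Module.finrank ℝ K) → M → ℝ := fun i m => σ i (b m) (α m)
  have hc : ∀ i, MDifferentiableAt IM 𝓘(ℝ, ℝ) (c i) m := fun i =>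
    (mdifferentiableAt_fiberLinear (σ i) _).comp m hα
  have heq : (fun m => (⟨b m, α m⟩ : TotalSpace K W)) =ᶠ[𝓝 m]
      fun m => ⟨b m, ∑ i, c i m • e i (b m)⟩ := hev.mono fun m' hm' =>
    congrArg (TotalSpace.mk (b m')) (hm'.1 (α m'))
  have hα' := hα.congr_of_eventuallyEq heq.symm
  have hm0 : α m = ∑ i, c i m • e i (b m) := hev.self_of_nhds.1 _
  have hv : mfderiv IM 𝓘(ℝ, E) b m u = v := by
    have := mfderiv_map_fst hα u
    rw [h1, lift_fst] at this
    exact this.symm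
  have h3 := mfderiv_sum_smul_section cov Finset.univ hb (fun i _ => hc i) e hα' u
  -- The frame expansion yields a second formula for the same velocity with the same horizontal
  -- part, so injectivity of the vertical lift determines `w`.
  have hw : w = ∑ i, (mvfderiv IM (c i) m u • e i (b m) + c i m • cov (e i) (b m) v) := by
    have h4 : (mfderiv IM (𝓘(ℝ, E).prod 𝓘(ℝ, K)) (fun m => (⟨b m, α m⟩ : TotalSpace K W)) m u :
        E × K) = mfderiv IM (𝓘(ℝ, E).prod 𝓘(ℝ, K))
          (fun m => (⟨b m, ∑ i, c i m • e i (b m)⟩ : TotalSpace K W)) m u :=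
      congrArg (fun l : TangentSpace IM m →L[ℝ] E × K => l u) heq.mfderiv_eq
    rw [hv, ← h4, h1, ← hm0] at h3
    exact vertLift_injective (E := E) (⟨b m, α m⟩ : TotalSpace K W) (add_right_cancel (G := E × K) h3)
  have hβe : ∀ i, MDifferentiableAt IM 𝓘(ℝ, ℝ) (fun m => β m (e i (b m))) m := fun i =>
    ((mdifferentiableAt_fiberLinear (evalSection (e i)) _).comp m hβ).congr_of_eventuallyEq
      (Filter.Eventually.of_forall fun m => (evalSection_apply (e i) (b m) (β m)).symm)
  -- Evaluation at `e i` is fibrewise linear on the dual bundle, so its horizontal derivative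
  -- involves the double dual connection. A section `ζ` through `β m` reduces this to `∇ (e i)` by
  -- using duality twice.
  have hβe' : ∀ i, mvfderiv IM (fun m => β m (e i (b m))) m u = r (e i (b m)) + β m (cov (e i) (b m) v) := by
    intro i
    obtain ⟨ζ, hζ⟩ := exists_section_apply_eq (E := E) (F := K →L[ℝ] ℝ) (V := DualFiber W) (b m) (β m)
    have h4 := mvfderiv_comp_apply (f := fun m => (⟨b m, β m⟩ : TotalSpace (K →L[ℝ] ℝ) (DualFiber W)))
      m (mdifferentiableAt_fiberLinear (evalSection (e i)) _) hβ u
    have h5 : (fiberLinear (evalSection (e i)) ∘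
        fun m => (⟨b m, β m⟩ : TotalSpace (K →L[ℝ] ℝ) (DualFiber W))) = fun m => β m (e i (b m)) :=
      funext fun m => evalSection_apply (e i) (b m) (β m)
    rw [h5] at h4
    have h6 := dualCov_apply (dualCov cov) (σ := evalSection (e i)) (s := ζ) (x := b m)
      (evalSection (e i)).mdifferentiableAt ζ.mdifferentiableAt v
    have h7 := dualCov_apply cov (σ := ζ) (s := e i) (x := b m) ζ.mdifferentiableAt
      (e i).mdifferentiableAt v
    simp only [evalSection_apply, hζ] at h6 h7
    refine h4.trans ((congrArg (mvfderiv (𝓘(ℝ, E).prod 𝓘(ℝ, K →L[ℝ] ℝ)) (fiberLinear (evalSection (e i)))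
      ⟨b m, β m⟩) h2).trans ((map_add (mvfderiv (𝓘(ℝ, E).prod 𝓘(ℝ, K →L[ℝ] ℝ))
        (fiberLinear (evalSection (e i))) ⟨b m, β m⟩) _ _).trans ?_))
    rw [mvfderiv_fiberLinear_vertLift, mvfderiv_fiberLinear_horLift, evalSection_apply]
    change r (e i (b m)) + dualCov (dualCov cov) (evalSection (e i)) (b m) v (β m) = _
    rw [h6, h7]
    ring
  have h5 : mvfderiv IM (fun m => β m (α m)) m u =
      mvfderiv IM (fun m => ∑ i, c i m * β m (e i (b m))) m u := by
    refine mvfderiv_congr ?_ u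
    filter_upwards [hev] with m' hm'
    have := congrArg (β m') (hm'.1 (α m'))
    simpa [map_sum, c] using this
  rw [h5, mvfderiv_sum_mul (fun i _ => hc i) (fun i _ => hβe i), hw, hm0, map_sum, map_sum,
    ← Finset.sum_add_distrib]
  refine Finset.sum_congr rfl fun i hi => ?_
  rw [map_add, map_smul, map_smul, map_smul, hβe']
  simp only [smul_eq_mul]
  ring

end Frames

/-! ### Derivatives of curves in a fibre -/

section TVS

variable {G G' : Type*} [AddCommGroup G] [Module ℝ G] [TopologicalSpace G] [ContinuousSMul ℝ G]
  [AddCommGroup G'] [Module ℝ G'] [TopologicalSpace G'] [ContinuousSMul ℝ G']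

/-- The fibres carry a vector space topology but no chosen norm, so the chain rule is obtained from
the little-o characterization in topological vector spaces. -/
lemma hasDerivAt_clm_comp (l : G →L[ℝ] G') {u : ℝ → G} {u' : G} {t : ℝ} (h : HasDerivAt u u' t) :
    HasDerivAt (fun τ => l (u τ)) (l u') t := by
  have h1 := hasFDerivAt_iff_isLittleOTVS.1 h.hasFDerivAt
  suffices H : HasFDerivAt (fun τ => l (u τ)) (l.comp (ContinuousLinearMap.toSpanSingleton ℝ u')) t by
    simpa using H.hasDerivAt
  refine hasFDerivAt_iff_isLittleOTVS.2 ?_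
  refine ((l.isBigOTVS_fun_comp (f := fun x' => u x' - u t -
    ContinuousLinearMap.toSpanSingleton ℝ u' (x' - t))).trans_isLittleOTVS h1).congr_left fun τ => ?_
  simp

end TVS

/-! ### Functions along curves in a manifold -/

section Curves

variable {EM : Type*} [NormedAddCommGroup EM] [NormedSpace ℝ EM]
  {HM : Type*} [TopologicalSpace HM] {IM : ModelWithCorners ℝ EM HM}
  {M : Type*} [TopologicalSpace M] [ChartedSpace HM M]

lemma hasDerivWithinAt_comp_curve {γ : ℝ → M} {J : Set ℝ} {t : ℝ} {G : M → ℝ}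
    (hG : MDifferentiableAt IM 𝓘(ℝ, ℝ) G (γ t)) (hγ : MDifferentiableWithinAt 𝓘(ℝ, ℝ) IM γ J t) :
    HasDerivWithinAt (fun τ => G (γ τ))
      (mvfderiv IM G (γ t) (mfderivWithin 𝓘(ℝ, ℝ) IM γ J t (1 : ℝ))) J t :=
  HasFDerivWithinAt.hasDerivWithinAt (f' := (mvfderiv IM G (γ t)).comp
      (mfderivWithin 𝓘(ℝ, ℝ) IM γ J t : ℝ →L[ℝ] TangentSpace IM (γ t)))
    (hasMFDerivWithinAt_iff_hasFDerivWithinAt.1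
      (hG.hasMFDerivAt.comp_hasMFDerivWithinAt t hγ.hasMFDerivWithinAt))

lemma hasDerivAt_comp_curve {γ : ℝ → M} {t : ℝ} {G : M → ℝ}
    (hG : MDifferentiableAt IM 𝓘(ℝ, ℝ) G (γ t)) (hγ : MDifferentiableAt 𝓘(ℝ, ℝ) IM γ t) :
    HasDerivAt (fun τ => G (γ τ)) (mvfderiv IM G (γ t) (mfderiv 𝓘(ℝ, ℝ) IM γ t (1 : ℝ))) t :=
  HasFDerivAt.hasDerivAt (f' := (mvfderiv IM G (γ t)).comp
      (mfderiv 𝓘(ℝ, ℝ) IM γ t : ℝ →L[ℝ] TangentSpace IM (γ t)))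
    (hasMFDerivAt_iff_hasFDerivAt.1 (hG.hasMFDerivAt.comp t hγ.hasMFDerivAt))

end Curves

/-! ### Covariant derivatives along `A`-paths and their product rules -/

section Along

variable {E : Type*} [NormedAddCommGroup E] [NormedSpace ℝ E]
  {Q : Type*} [TopologicalSpace Q] [ChartedSpace E Q]
  {F : Type*} [NormedAddCommGroup F] [NormedSpace ℝ F]
  {V : Q → Type*} [TopologicalSpace (TotalSpace F V)]
  [∀ x, AddCommGroup (V x)] [∀ x, Module ℝ (V x)] [∀ x, TopologicalSpace (V x)]
  [FiberBundle F V] [VectorBundle ℝ F V]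
  {K : Type*} [NormedAddCommGroup K] [NormedSpace ℝ K]
  {W : Q → Type*} [TopologicalSpace (TotalSpace K W)]
  [∀ x, AddCommGroup (W x)] [∀ x, Module ℝ (W x)] [∀ x, TopologicalSpace (W x)]
  [FiberBundle K W] [VectorBundle ℝ K W]
  [∀ x, IsTopologicalAddGroup (V x)] [∀ x, ContinuousSMul ℝ (V x)]
  [∀ x, IsTopologicalAddGroup (W x)] [∀ x, ContinuousSMul ℝ (W x)]
  [IsManifold 𝓘(ℝ, E) ∞ Q] [ContMDiffVectorBundle ∞ F V 𝓘(ℝ, E)] [ContMDiffVectorBundle ∞ K W 𝓘(ℝ, E)]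
  [FiniteDimensional ℝ E] [FiniteDimensional ℝ F] [FiniteDimensional ℝ K] [T2Space Q]

/-- A path over a compact interval is a combination of global sections. -/
lemma exists_path_eq_sum [SecondCountableTopology Q] {t₀ t₁ : ℝ} (ht : t₀ < t₁) {q : ℝ → Q}
    {u : ∀ t, W (q t)}
    (hu : ContMDiffOn 𝓘(ℝ, ℝ) (𝓘(ℝ, E).prod 𝓘(ℝ, K)) 1 (fun t => (⟨q t, u t⟩ : TotalSpace K W))
      (Icc t₀ t₁)) :
    ∃ (N : ℕ) (e : Fin N → Cₛ^∞⟮𝓘(ℝ, E); K, W⟯) (c : Fin N → ℝ → ℝ), (∀ i, ContDiff ℝ 1 (c i)) ∧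
      ∀ t ∈ Icc t₀ t₁, u t = ∑ i, c i t • e i (q t) := by
  have hq : ContinuousOn q (Icc t₀ t₁) :=
    (FiberBundle.continuous_proj K W).comp_continuousOn hu.continuousOn
  obtain ⟨N, e, σ, h⟩ := exists_frame_of_isCompact (E := E) (K := K) (W := W)
    (isCompact_Icc.image_of_continuousOn hq)
  have h1 : ∀ i, ContDiffOn ℝ 1 (fun t => σ i (q t) (u t)) (Icc t₀ t₁) := fun i =>
    contMDiffOn_iff_contDiffOn.1
      (((contMDiff_fiberLinear (σ i)).of_le (by simp)).comp_contMDiffOn hu)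
  -- Time-dependent sections are indexed by all of `ℝ` and must be `C¹` there, hence the
  -- coefficients are extended beyond the interval.
  choose c hc hc' using fun i => exists_contDiff_extension ht (h1 i)
  refine ⟨N, e, c, hc, fun t htJ => ?_⟩
  refine (h (q t) (mem_image_of_mem q htJ) (u t)).trans (Finset.sum_congr rfl fun i _ => ?_)
  rw [hc' i t htJ]

/-- This ensures that `AConnection.along` is given by its defining formula and not by the default
value `0`. -/
lemma exists_isTimeExtension [SecondCountableTopology Q] {t₀ t₁ : ℝ} (ht : t₀ < t₁) {q : ℝ → Q}
    {u : ∀ t, W (q t)}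
    (hu : ContMDiffOn 𝓘(ℝ, ℝ) (𝓘(ℝ, E).prod 𝓘(ℝ, K)) 1 (fun t => (⟨q t, u t⟩ : TotalSpace K W))
      (Icc t₀ t₁)) :
    ∃ η : ℝ → Cₛ^∞⟮𝓘(ℝ, E); K, W⟯, IsTimeExtension (Icc t₀ t₁) q u η := by
  obtain ⟨N, e, c, hc, h⟩ := exists_path_eq_sum ht hu
  refine ⟨fun t => ∑ i, c i t • e i, ?_, fun t htJ => ?_⟩
  · intro z
    have h1 := contMDiffWithinAt_sum_smul_section (IM := 𝓘(ℝ, ℝ).prod 𝓘(ℝ, E)) (n := 1) (by simp)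
      (S := univ) (m := z) (b := fun z : ℝ × Q => z.2) contMDiffWithinAt_snd Finset.univ
      (c := fun i z => c i z.1)
      (fun i _ => ((hc i).contMDiff.contMDiffAt.comp z contMDiffAt_fst).contMDiffWithinAt) e
    refine (contMDiffWithinAt_univ.1 h1).congr_of_eventuallyEq (Filter.Eventually.of_forall fun z => ?_)
    simp only [sum_section_apply]
    rfl
  · rw [sum_section_apply, h t htJ]
    rfl

lemma hasDerivAt_timeExtension {η : ℝ → Cₛ^∞⟮𝓘(ℝ, E); K, W⟯}
    (hη : ContMDiff (𝓘(ℝ, ℝ).prod 𝓘(ℝ, E)) (𝓘(ℝ, E).prod 𝓘(ℝ, K)) 1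
      (fun z : ℝ × Q => (⟨z.2, η z.1 z.2⟩ : TotalSpace K W))) (x : Q) (t : ℝ) :
    HasDerivAt (fun τ => η τ x) (deriv (fun τ => η τ x) t) t := by
  suffices h : DifferentiableAt ℝ (fun τ => η τ x) t from h.hasFDerivAt.hasDerivAt
  have hx := FiberBundle.mem_baseSet_trivializationAt K W x
  set κ := (trivializationAt K W x).continuousLinearEquivAt ℝ x hx
  have h1 : ContMDiffAt 𝓘(ℝ, ℝ) (𝓘(ℝ, E).prod 𝓘(ℝ, K)) 1 (fun τ => (⟨x, η τ x⟩ : TotalSpace K W)) t :=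
    (hη (t, x)).comp (f := fun τ : ℝ => (τ, x)) t (contMDiffAt_id.prodMk contMDiffAt_const)
  have h2 : ContDiffAt ℝ 1 (fun τ => κ (η τ x)) t :=
    contMDiffAt_iff_contDiffAt.1 ((contMDiffAt_totalSpace).1 h1).2
  have h3 := hasDerivAt_clm_comp (κ.symm : K →L[ℝ] W x) (h2.differentiableAt (by simp)).hasDerivAt
  simp only [ContinuousLinearEquiv.coe_coe, ContinuousLinearEquiv.symm_apply_apply] at h3
  exact ⟨_, h3.hasFDerivAt⟩

lemma eq_of_forall_dual_section (x : Q) {w w' : W x}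
    (h : ∀ σ : Cₛ^∞⟮𝓘(ℝ, E); K →L[ℝ] ℝ, DualFiber W⟯, σ x w = σ x w') : w = w' := by
  obtain ⟨e, σ, hσ⟩ := exists_local_frame (E := E) (K := K) (W := W) x
  rw [hσ.self_of_nhds.1 w, hσ.self_of_nhds.1 w']
  exact Finset.sum_congr rfl fun i _ => by rw [h]

/-- After pairing with a dual section, the expression is `C^∞`-linear in `X`, hence tensorial. The
choice of the section extending `a` is therefore immaterial. -/
lemma AConnection.toFun_apply_congr {L : LieAlgebroid E F V} (D : AConnection L K W)
    {X X' : Cₛ^∞⟮𝓘(ℝ, E); F, V⟯} {x : Q} (h : X x = X' x) (s : Cₛ^∞⟮𝓘(ℝ, E); K, W⟯) :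
    D.toFun X s x = D.toFun X' s x :=
  eq_of_forall_dual_section (E := E) (K := K) x fun σ =>
    IsFunctionLinear.apply_eq_of_eq (Θ := fun X => pairing σ (D.toFun X s))
      ⟨fun X Y => by ext y; simp [D.add_left], fun f X => by ext y; simp [D.smul_left]⟩ h

lemma AConnection.dual_apply_apply {L : LieAlgebroid E F V} (D : AConnection L K W)
    (X : Cₛ^∞⟮𝓘(ℝ, E); F, V⟯) (σ : Cₛ^∞⟮𝓘(ℝ, E); K →L[ℝ] ℝ, DualFiber W⟯)
    (s : Cₛ^∞⟮𝓘(ℝ, E); K, W⟯) (x : Q) :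
    D.dual.toFun X σ x (s x) =
      mvfderiv 𝓘(ℝ, E) (pairing σ s) x (L.anchor x (X x)) - σ x (D.toFun X s x) :=
  congrArg (fun f : C^∞⟮𝓘(ℝ, E), Q; ℝ⟯ => f x) (D.dual_apply X σ s)

/-- Biduality: two dualizations give back `D`. It turns the product rule for `D.dual` and evaluation
sections into the derivative of `⟨p, e⟩` for a path `p` in the dual bundle. -/
lemma AConnection.dual_dual_evalSection {L : LieAlgebroid E F V} (D : AConnection L K W)
    (X : Cₛ^∞⟮𝓘(ℝ, E); F, V⟯) (s : Cₛ^∞⟮𝓘(ℝ, E); K, W⟯) (x : Q) (τ : DualFiber W x) :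
    D.dual.dual.toFun X (evalSection s) x τ = τ (D.toFun X s x) := by
  obtain ⟨τ, rfl⟩ := exists_section_apply_eq (E := E) (F := K →L[ℝ] ℝ) (V := DualFiber W) x τ
  have h : (pairing (evalSection s) τ : C^∞⟮𝓘(ℝ, E), Q; ℝ⟯) = pairing τ s := by
    ext y; simp
  rw [D.dual.dual_apply_apply, evalSection_apply, D.dual_apply_apply, h]
  ring

section APath
variable [SecondCountableTopology Q] {L : LieAlgebroid E F V} {t₀ t₁ : ℝ} {q : ℝ → Q}
  {a : ∀ t, V (q t)}

/-- The covariant derivative along an `A`-path satisfies the product rule with dual sections. -/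
lemma hasDerivWithinAt_section_path (D : AConnection L K W) (ht : t₀ < t₁)
    (ha : L.IsAPath (Icc t₀ t₁) (fun t => (⟨q t, a t⟩ : TotalSpace F V))) {u : ∀ t, W (q t)}
    (hu : ContMDiffOn 𝓘(ℝ, ℝ) (𝓘(ℝ, E).prod 𝓘(ℝ, K)) 1 (fun t => (⟨q t, u t⟩ : TotalSpace K W))
      (Icc t₀ t₁)) {t : ℝ} (htJ : t ∈ Icc t₀ t₁) {X : Cₛ^∞⟮𝓘(ℝ, E); F, V⟯} (hX : X (q t) = a t)
    (σ : Cₛ^∞⟮𝓘(ℝ, E); K →L[ℝ] ℝ, DualFiber W⟯) :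
    HasDerivWithinAt (fun τ => σ (q τ) (u τ))
      (σ (q t) (D.along (Icc t₀ t₁) q a u t) + D.dual.toFun X σ (q t) (u t)) (Icc t₀ t₁) t := by
  have h : (∃ ξ : ℝ → Cₛ^∞⟮𝓘(ℝ, E); F, V⟯, IsTimeExtension (Icc t₀ t₁) q a ξ) ∧
      (∃ η : ℝ → Cₛ^∞⟮𝓘(ℝ, E); K, W⟯, IsTimeExtension (Icc t₀ t₁) q u η) :=
    ⟨exists_isTimeExtension ht ha.1.1, exists_isTimeExtension ht hu⟩
  have halong : D.along (Icc t₀ t₁) q a u t =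
      deriv (fun τ => h.2.choose τ (q t)) t + D.toFun (h.1.choose t) (h.2.choose t) (q t) := dif_pos h
  obtain ⟨hη, hηu⟩ := h.2.choose_spec
  obtain ⟨-, hξa⟩ := h.1.choose_spec
  set η := h.2.choose
  set ξ := h.1.choose
  rw [halong, D.toFun_apply_congr (X' := X) ((hξa t htJ).trans hX.symm)]
  -- The function `⟨σ, η⟩` on `ℝ × Q` is differentiated along `(τ, q τ)`. The time derivative gives
  -- `⟨σ, ∂_t η⟩`; the space derivative is in the direction `q̇ = ρ(a)`, where the definition of the
  -- dual connection applies. The resulting formula shows that `along` does not depend on the chosen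
  -- extensions.
  let g : ℝ × Q → ℝ := fun z => σ z.2 (η z.1 z.2)
  have hg : MDifferentiableAt (𝓘(ℝ, ℝ).prod 𝓘(ℝ, E)) 𝓘(ℝ, ℝ) g (t, q t) :=
    (mdifferentiableAt_fiberLinear σ _).comp (t, q t) (hη.mdifferentiable (by simp) (t, q t))
  have hq : MDifferentiableWithinAt 𝓘(ℝ, ℝ) 𝓘(ℝ, E) q (Icc t₀ t₁) t :=
    (ha.1.2.mdifferentiableOn (by simp)) t htJ
  have hqd := hasDerivWithinAt_comp_curve (γ := fun τ => (τ, q τ)) hg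
    (mdifferentiableWithinAt_id.prodMk hq)
  have hval : mvfderiv (𝓘(ℝ, ℝ).prod 𝓘(ℝ, E)) g (t, q t)
      (mfderivWithin 𝓘(ℝ, ℝ) (𝓘(ℝ, ℝ).prod 𝓘(ℝ, E)) (fun τ => (τ, q τ)) (Icc t₀ t₁) t (1 : ℝ)) =
      σ (q t) (deriv (fun τ => η τ (q t)) t + D.toFun X (η t) (q t)) + D.dual.toFun X σ (q t) (u t) := by
    have hu1 : UniqueMDiffWithinAt 𝓘(ℝ, ℝ) (Icc t₀ t₁) t :=
      (uniqueDiffOn_Icc ht t htJ).uniqueMDiffWithinAt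
    have h1 : (mfderivWithin 𝓘(ℝ, ℝ) (𝓘(ℝ, ℝ).prod 𝓘(ℝ, E)) (fun τ => (τ, q τ)) (Icc t₀ t₁) t
        (1 : ℝ) : ℝ × E) = ((1 : ℝ), L.anchor (q t) (a t)) := by
      have h5 := (mdifferentiableWithinAt_id.hasMFDerivWithinAt.prodMk
        hq.hasMFDerivWithinAt).mfderivWithin hu1
      refine (congrArg (fun l : ℝ →L[ℝ] ℝ × E => l 1) h5).trans (Prod.ext ?_ (ha.2 t htJ))
      exact congrArg (fun l : ℝ →L[ℝ] ℝ => l 1) (mfderivWithin_id hu1)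
    have h2 := mfderiv_prod_eq_add_apply (p := (t, q t)) (v := (((1 : ℝ), L.anchor (q t) (a t)) : ℝ × E)) hg
    refine (congrArg (mvfderiv (𝓘(ℝ, ℝ).prod 𝓘(ℝ, E)) g (t, q t)) h1).trans (h2.trans ?_)
    have h3 : mvfderiv 𝓘(ℝ, ℝ) (fun τ => g (τ, q t)) t (1 : ℝ) =
        σ (q t) (deriv (fun τ => η τ (q t)) t) :=
      mvfderiv_one_of_hasDerivAt (hasDerivAt_clm_comp (σ (q t)) (hasDerivAt_timeExtension hη (q t) t))
    have h4 := D.dual_apply_apply X σ (η t) (q t)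
    rw [hX, hηu t htJ] at h4
    rw [map_add, h4]
    refine (congrArg₂ (fun x y : ℝ => x + y) h3 (rfl :
      _ = mvfderiv 𝓘(ℝ, E) (pairing σ (η t)) (q t) (L.anchor (q t) (a t)))).trans ?_
    ring
  rw [hval] at hqd
  refine hqd.congr (fun τ hτ => ?_) ?_
  · simp only [g, hηu τ hτ]
  · simp only [g, hηu t htJ]

/-- The covariant derivative of a combination of sections along an `A`-path. -/
lemma along_sum_smul (D : AConnection L K W) (ht : t₀ < t₁)
    (ha : L.IsAPath (Icc t₀ t₁) (fun t => (⟨q t, a t⟩ : TotalSpace F V)))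
    {u : ∀ t, W (q t)}
    (hu : ContMDiffOn 𝓘(ℝ, ℝ) (𝓘(ℝ, E).prod 𝓘(ℝ, K)) 1 (fun t => (⟨q t, u t⟩ : TotalSpace K W))
      (Icc t₀ t₁)) {t : ℝ} (htJ : t ∈ Icc t₀ t₁) {X : Cₛ^∞⟮𝓘(ℝ, E); F, V⟯} (hX : X (q t) = a t)
    {ι : Type*} [Fintype ι] {c : ι → ℝ → ℝ} {c' : ι → ℝ} (e : ι → Cₛ^∞⟮𝓘(ℝ, E); K, W⟯)
    (hc : ∀ i, HasDerivWithinAt (c i) (c' i) (Icc t₀ t₁) t)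
    (hu' : ∀ τ ∈ Icc t₀ t₁, u τ = ∑ i, c i τ • e i (q τ)) :
    D.along (Icc t₀ t₁) q a u t = ∑ i, (c' i • e i (q t) + c i t • D.toFun X (e i) (q t)) := by
  refine eq_of_forall_dual_section (E := E) (K := K) (q t) fun σ => ?_
  have h1 := hasDerivWithinAt_section_path D ht ha hu htJ hX σ
  have h2 : ∀ i, HasDerivWithinAt (fun τ => pairing σ (e i) (q τ))
      (mvfderiv 𝓘(ℝ, E) (pairing σ (e i)) (q t) (L.anchor (q t) (a t))) (Icc t₀ t₁) t := fun i => by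
    have := hasDerivWithinAt_comp_curve (γ := q)
      ((pairing σ (e i)).contMDiff.mdifferentiable (by simp) (q t))
      ((ha.1.2.mdifferentiableOn (by simp)) t htJ)
    rwa [ha.2 t htJ] at this
  have h3 := HasDerivWithinAt.fun_sum (u := Finset.univ) fun i _ => (hc i).mul (h2 i)
  have h4 := h3.congr (f₁ := fun τ => σ (q τ) (u τ))
    (fun τ hτ => by rw [hu' τ hτ]; simp [map_sum]) (by rw [hu' t htJ]; simp [map_sum])
  -- The derivative of `σ(u)` has been computed in two ways. Derivatives within the interval are
  -- unique also at its endpoints, so the values of `σ` on both sides can be compared.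
  have h5 := (uniqueDiffOn_Icc ht t htJ).eq_deriv _ h1 h4
  rw [hu' t htJ, map_sum] at h5
  rw [map_sum, eq_sub_of_add_eq h5, ← Finset.sum_sub_distrib]
  refine Finset.sum_congr rfl fun i _ => ?_
  rw [map_smul, D.dual_apply_apply, hX, map_add, map_smul, map_smul, pairing_apply]
  simp only [smul_eq_mul]
  ring

/-- The product rule for the covariant derivatives of `D` and its dual along an `A`-path. -/
lemma hasDerivWithinAt_pairing_path (D : AConnection L K W) (ht : t₀ < t₁)
    (ha : L.IsAPath (Icc t₀ t₁) (fun t => (⟨q t, a t⟩ : TotalSpace F V)))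
    {u : ∀ t, W (q t)} {p : ∀ t, DualFiber W (q t)}
    (hu : ContMDiffOn 𝓘(ℝ, ℝ) (𝓘(ℝ, E).prod 𝓘(ℝ, K)) 1 (fun t => (⟨q t, u t⟩ : TotalSpace K W))
      (Icc t₀ t₁))
    (hp : ContMDiffOn 𝓘(ℝ, ℝ) (𝓘(ℝ, E).prod 𝓘(ℝ, K →L[ℝ] ℝ)) 1
      (fun t => (⟨q t, p t⟩ : TotalSpace (K →L[ℝ] ℝ) (DualFiber W))) (Icc t₀ t₁))
    {t : ℝ} (htJ : t ∈ Icc t₀ t₁) :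
    HasDerivWithinAt (fun τ => p τ (u τ))
      (D.dual.along (Icc t₀ t₁) q a p t (u t) + p t (D.along (Icc t₀ t₁) q a u t))
      (Icc t₀ t₁) t := by
  obtain ⟨X, hX⟩ := exists_section_apply_eq (E := E) (F := F) (q t) (a t)
  obtain ⟨N, e, c, hc, h⟩ := exists_path_eq_sum ht hu
  have hc' : ∀ i, HasDerivWithinAt (c i) (deriv (c i) t) (Icc t₀ t₁) t := fun i =>
    (((hc i).differentiable (by simp)) t).hasDerivAt.hasDerivWithinAt
  have h1 : ∀ i, HasDerivWithinAt (fun τ => p τ (e i (q τ)))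
      (D.dual.along (Icc t₀ t₁) q a p t (e i (q t)) + p t (D.toFun X (e i) (q t)))
      (Icc t₀ t₁) t := fun i => by
    have := hasDerivWithinAt_section_path D.dual ht ha hp htJ hX (evalSection (e i))
    simpa only [evalSection_apply, D.dual_dual_evalSection] using this
  have h3 := HasDerivWithinAt.fun_sum (u := Finset.univ) fun i _ => (hc' i).mul (h1 i)
  have h4 := h3.congr (f₁ := fun τ => p τ (u τ))
    (fun τ hτ => by rw [h τ hτ]; simp [map_sum]) (by rw [h t htJ]; simp [map_sum])
  refine h4.congr_deriv ?_
  rw [along_sum_smul D ht ha hu htJ hX e hc' h, h t htJ, map_sum, map_sum, ← Finset.sum_add_distrib]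
  refine Finset.sum_congr rfl fun i _ => ?_
  rw [map_add, map_smul, map_smul, map_smul]
  simp only [smul_eq_mul]
  ring

end APath

end Along

/-! ### A flow that preserves the anchor relation, in coordinates -/

section AnchoredFlow

variable {E : Type*} [NormedAddCommGroup E] [NormedSpace ℝ E]
  {ι : Type*} [Fintype ι]

/-- The vector field `(x, y) ↦ (X(x), -M(x) y)`. -/
def transportField (X : E → E) (M : ι → ι → E → ℝ) (z : E × (ι → ℝ)) : E × (ι → ℝ) :=
  (X z.1, fun i => -∑ j, M i j z.1 * z.2 j)

lemma contDiffAt_transportField {X : E → E} {M : ι → ι → E → ℝ} {n : WithTop ℕ∞} {z : E × (ι → ℝ)}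
    (hX : ContDiffAt ℝ n X z.1) (hM : ∀ i j, ContDiffAt ℝ n (M i j) z.1) :
    ContDiffAt ℝ n (transportField X M) z := by
  refine (hX.comp z contDiffAt_fst).prodMk (contDiffAt_pi.2 fun i => ?_)
  refine (ContDiffAt.sum fun j _ => ?_).neg
  exact ((hM i j).comp z contDiffAt_fst).mul
    ((contDiff_apply ℝ ℝ j).contDiffAt.comp z contDiffAt_snd)

lemma hasDerivWithinAt_fst {G G' : Type*} [NormedAddCommGroup G] [NormedSpace ℝ G]
    [NormedAddCommGroup G'] [NormedSpace ℝ G'] {f : ℝ → G × G'} {f' : G × G'} {J : Set ℝ} {t : ℝ}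
    (h : HasDerivWithinAt f f' J t) : HasDerivWithinAt (fun τ => (f τ).1) f'.1 J t :=
  (ContinuousLinearMap.fst ℝ G G').hasFDerivAt.comp_hasDerivWithinAt t h

lemma hasDerivWithinAt_snd {G G' : Type*} [NormedAddCommGroup G] [NormedSpace ℝ G]
    [NormedAddCommGroup G'] [NormedSpace ℝ G'] {f : ℝ → G × G'} {f' : G × G'} {J : Set ℝ} {t : ℝ}
    (h : HasDerivWithinAt f f' J t) : HasDerivWithinAt (fun τ => (f τ).2) f'.2 J t :=
  (ContinuousLinearMap.snd ℝ G G').hasFDerivAt.comp_hasDerivWithinAt t h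

/-- If `[X, R_j] = ∑ᵢ M_ij R_i`, then the flow of the vector field `(X, -M)` preserves the relation
`ẋ = ∑ y_j R_j(x)`. -/
theorem exists_anchored_flow [FiniteDimensional ℝ E] {X : E → E} {R : ι → E → E}
    {M : ι → ι → E → ℝ} {z₀ : E × (ι → ℝ)} (hX : ContDiffAt ℝ 2 X z₀.1)
    (hR : ∀ j, ContDiffAt ℝ 2 (R j) z₀.1) (hM : ∀ i j, ContDiffAt ℝ 2 (M i j) z₀.1)
    (hbr : ∀ᶠ x in 𝓝 z₀.1, ∀ j, fderiv ℝ (R j) x (X x) - fderiv ℝ X x (R j x) =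
      ∑ i, M i j x • R i x) {N : Set (E × (ι → ℝ))} (hN : N ∈ 𝓝 z₀) :
    ∃ δ > 0, ∃ U : Set (E × (ι → ℝ)), IsOpen U ∧ z₀ ∈ U ∧
      ∃ φ : ℝ → E × (ι → ℝ) → E × (ι → ℝ), (∀ z ∈ U, φ 0 z = z) ∧
      (∀ τ ∈ Ioo (-δ) δ, ∀ z ∈ U, φ τ z ∈ N ∧
        HasDerivAt (fun σ => φ σ z) (transportField X M (φ τ z)) τ ∧
        ContDiffAt ℝ 1 (Function.uncurry φ) (τ, z)) ∧
      ∀ (x : ℝ → E) (y : ℝ → ι → ℝ) (y' : ι → ℝ) (g : ℝ → ℝ) (g' : ℝ) (J : Set ℝ) (t : ℝ),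
        HasDerivWithinAt x (∑ j, y t j • R j (x t)) J t → HasDerivWithinAt y y' J t →
        HasDerivWithinAt g g' J t → g t ∈ Ioo (-δ) δ → (x t, y t) ∈ U →
        HasDerivWithinAt (fun τ => (φ (g τ) (x τ, y τ)).1)
          (g' • X (φ (g t) (x t, y t)).1 +
            ∑ j, (φ (g t) (x t, y t)).2 j • R j (φ (g t) (x t, y t)).1) J t := by
  have hZ : ContDiffAt ℝ 2 (transportField X M) z₀ := contDiffAt_transportField hX hM
  have hX1 : ContDiffAt ℝ 1 (fderiv ℝ X) z₀.1 := hX.fderiv_right (by norm_num)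
  obtain ⟨C, hC⟩ : ∃ C : ℝ, ∀ᶠ x in 𝓝 z₀.1, ‖fderiv ℝ X x‖ ≤ C :=
    ⟨‖fderiv ℝ X z₀.1‖ + 1, (hX1.continuousAt.norm.eventually_lt_const
      (lt_add_one _)).mono fun _ h => h.le⟩
  have hgood : ∀ᶠ z in 𝓝 z₀, z ∈ N ∧ ‖fderiv ℝ X z.1‖ ≤ C ∧ ContDiffAt ℝ 2 X z.1 ∧
      (∀ j, ContDiffAt ℝ 2 (R j) z.1) ∧ (∀ i j, ContDiffAt ℝ 2 (M i j) z.1) ∧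
      ∀ j, fderiv ℝ (R j) z.1 (X z.1) - fderiv ℝ X z.1 (R j z.1) = ∑ i, M i j z.1 • R i z.1 := by
    refine Filter.Eventually.and hN (Filter.Tendsto.eventually (f := Prod.fst)
      (p := fun x => ‖fderiv ℝ X x‖ ≤ C ∧ ContDiffAt ℝ 2 X x ∧
      (∀ j, ContDiffAt ℝ 2 (R j) x) ∧ (∀ i j, ContDiffAt ℝ 2 (M i j) x) ∧
      ∀ j, fderiv ℝ (R j) x (X x) - fderiv ℝ X x (R j x) = ∑ i, M i j x • R i x)
      continuousAt_fst ?_)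
    filter_upwards [hC, hX.eventually (by simp),
      Filter.eventually_all.2 fun j => (hR j).eventually (by simp),
      Filter.eventually_all.2 fun i => Filter.eventually_all.2 fun j => (hM i j).eventually (by simp),
      hbr] with x h1 h2 h3 h4 h5
    exact ⟨h1, h2, h3, h4, h5⟩
  obtain ⟨δ, hδ, U, hU, hzU, φ, A, h0, hφ⟩ := exists_local_flow hZ hgood
  refine ⟨δ, hδ, U, hU, hzU, φ, fun z hz => (h0 z hz).1,
    fun τ hτ z hz => ⟨(hφ τ hτ z hz).1.1, (hφ τ hτ z hz).2.1, (hφ τ hτ z hz).2.2.2.2⟩, ?_⟩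
  -- Along a trajectory both sides solve `ξ' = DX ξ` with the same initial value. For the right side
  -- this is the bracket relation: the terms from `ẏ = -M y` cancel those from `[X, R_j]`. The
  -- vector `w` does not matter, because `X` does not involve `y`. Grönwall with zero forcing gives
  -- equality.
  have key : ∀ z ∈ U, ∀ w : ι → ℝ, ∀ τ ∈ Ioo (-δ) δ,
      (A τ z (∑ j, z.2 j • R j z.1, w)).1 = ∑ j, (φ τ z).2 j • R j (φ τ z).1 := by
    intro z hz w τ hτ
    have hsub : ∀ σ ∈ Ioo (-δ) δ, HasDerivAt
        (fun σ => (A σ z (∑ j, z.2 j • R j z.1, w)).1 - ∑ j, (φ σ z).2 j • R j (φ σ z).1)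
        (fderiv ℝ X (φ σ z).1 ((A σ z (∑ j, z.2 j • R j z.1, w)).1 -
          ∑ j, (φ σ z).2 j • R j (φ σ z).1)) σ := by
      intro σ hσ
      obtain ⟨⟨-, -, hXσ, hRσ, hMσ, hbrσ⟩, h1, h2, -, -⟩ := hφ σ hσ z hz
      have h3 : HasDerivAt (fun σ => (A σ z (∑ j, z.2 j • R j z.1, w)).1)
          (fderiv ℝ X (φ σ z).1 (A σ z (∑ j, z.2 j • R j z.1, w)).1) σ := by
        have h4 := hasDerivWithinAt_univ.1 (hasDerivWithinAt_fst (hasDerivWithinAt_univ.2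
          (h2.clm_apply (hasDerivAt_const σ (∑ j, z.2 j • R j z.1, w)))))
        refine h4.congr_deriv ?_
        have h5 : HasFDerivAt (fun z => (transportField X M z).1)
            ((fderiv ℝ X (φ σ z).1).comp (ContinuousLinearMap.fst ℝ E (ι → ℝ))) (φ σ z) :=
          ((hXσ.differentiableAt (by simp)).hasFDerivAt).comp (φ σ z) hasFDerivAt_fst
        have h6 := ((contDiffAt_transportField hXσ hMσ).differentiableAt (by simp)).hasFDerivAt.fst
        have h7 := h6.unique h5
        simpa using congrArg (fun l => l (A σ z (∑ j, z.2 j • R j z.1, w))) h7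
      have hfst := hasDerivWithinAt_univ.1 (hasDerivWithinAt_fst (hasDerivWithinAt_univ.2 h1))
      have hsnd := hasDerivWithinAt_univ.1 (hasDerivWithinAt_snd (hasDerivWithinAt_univ.2 h1))
      have h8 : HasDerivAt (fun σ => ∑ j, (φ σ z).2 j • R j (φ σ z).1)
          (∑ j, ((φ σ z).2 j • fderiv ℝ (R j) (φ σ z).1 (X (φ σ z).1) +
            (-∑ k, M j k (φ σ z).1 * (φ σ z).2 k) • R j (φ σ z).1)) σ := by
        refine HasDerivAt.fun_sum fun j _ => ?_
        refine HasDerivAt.smul (hasDerivAt_pi.1 hsnd j) ?_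
        exact ((hRσ j).differentiableAt (by simp)).hasFDerivAt.comp_hasDerivAt σ hfst
      refine (HasDerivAt.sub h3 h8).congr_deriv ?_
      rw [map_sub, map_sum]
      congr 1
      simp only [map_smul, neg_smul, ← sub_eq_add_neg, Finset.sum_sub_distrib]
      rw [sub_eq_iff_eq_add, ← sub_eq_iff_eq_add', ← Finset.sum_sub_distrib]
      simp only [← smul_sub, hbrσ, Finset.smul_sum, Finset.sum_smul, smul_smul]
      rw [Finset.sum_comm]
      exact Finset.sum_congr rfl fun i _ => Finset.sum_congr rfl fun j _ => by rw [mul_comm]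
    have h9 := norm_le_gronwallBound_abs (K := C) (c := 0) hsub
      (by rw [(h0 z hz).1, (h0 z hz).2]; simp)
      (fun σ hσ => by
        rw [add_zero]
        exact (ContinuousLinearMap.le_opNorm _ _).trans
          (mul_le_mul_of_nonneg_right (hφ σ hσ z hz).1.2.1 (norm_nonneg _))) hτ
    rw [gronwallBound_eq_mul, zero_mul] at h9
    exact sub_eq_zero.1 (norm_le_zero_iff.1 h9)
  intro x y y' g g' J t hx hy hg hgt hU'
  obtain ⟨-, h1, -, h2, h3⟩ := hφ (g t) hgt _ hU'
  have h4 := (h3.differentiableAt (by simp)).hasFDerivAt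
  have h5 : HasDerivWithinAt (fun τ => Function.uncurry φ (g τ, (x τ, y τ))) _ J t :=
    h4.comp_hasDerivWithinAt (f := fun τ => (g τ, (x τ, y τ))) t (hg.prodMk (hx.prodMk hy))
  refine (hasDerivWithinAt_fst h5).congr_deriv ?_
  -- The velocity is split into a time part, on which the derivative is the vector field itself, and
  -- an initial-value part, on which it is `A` and `key` applies.
  have h6 : (g', (∑ j, y t j • R j (x t), y')) =
      g' • ((1 : ℝ), (0 : E × (ι → ℝ))) + ((0 : ℝ), (∑ j, y t j • R j (x t), y')) := by simp
  have h7 : fderiv ℝ (Function.uncurry φ) (g t, (x t, y t)) ((1 : ℝ), (0 : E × (ι → ℝ))) =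
      transportField X M (φ (g t) (x t, y t)) := by
    have := h4.comp_hasDerivAt (g t) (f := fun σ => (σ, (x t, y t)))
      ((hasDerivAt_id (g t)).prodMk (hasDerivAt_const _ _))
    exact this.unique h1
  have h8 : ∀ v, fderiv ℝ (Function.uncurry φ) (g t, (x t, y t)) ((0 : ℝ), v) =
      A (g t) (x t, y t) v := by
    intro v
    have := h4.comp (x t, y t) (f := fun z => (g t, z))
      ((hasFDerivAt_const _ _).prodMk (hasFDerivAt_id (x t, y t)))
    exact congrArg (fun l : E × (ι → ℝ) →L[ℝ] E × (ι → ℝ) => l v) (this.unique h2)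
  rw [h6, map_add, map_smul, h7, h8, Prod.fst_add, key _ hU' _ _ hgt]
  rfl

end AnchoredFlow

/-! ### Local coordinates by globally defined functions -/

section Coordinates

variable {E : Type*} [NormedAddCommGroup E] [NormedSpace ℝ E] [FiniteDimensional ℝ E]
  {Q : Type*} [TopologicalSpace Q] [ChartedSpace E Q] [IsManifold 𝓘(ℝ, E) ∞ Q]

/-- The map to the model space with the given components. -/
def coordMap (χ : Fin (Module.finrank ℝ E) → C^∞⟮𝓘(ℝ, E), Q; ℝ⟯) (y : Q) : E :=
  ∑ m, χ m y • Module.finBasis ℝ E m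

variable (E Q) in
/-- Local coordinates that are the restrictions of globally defined smooth functions. -/
structure GlobalCoordinates where
  χ : Fin (Module.finrank ℝ E) → C^∞⟮𝓘(ℝ, E), Q; ℝ⟯
  ψ : E → Q
  source : Set Q
  target : Set E
  isOpen_source : IsOpen source
  isOpen_target : IsOpen target
  map_source : ∀ y ∈ source, coordMap χ y ∈ target
  map_target : ∀ x ∈ target, ψ x ∈ source
  left_inv : ∀ y ∈ source, ψ (coordMap χ y) = y
  right_inv : ∀ x ∈ target, coordMap χ (ψ x) = x
  contMDiffOn_symm : ContMDiffOn 𝓘(ℝ, E) 𝓘(ℝ, E) ∞ ψ target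

lemma contMDiff_coordMap (χ : Fin (Module.finrank ℝ E) → C^∞⟮𝓘(ℝ, E), Q; ℝ⟯) :
    ContMDiff 𝓘(ℝ, E) 𝓘(ℝ, E) ∞ (coordMap χ) := fun _ =>
  ContMDiffAt.sum fun m _ => (χ m).contMDiff.contMDiffAt.smul contMDiffAt_const

/-- The components of a chart are cut off to global functions. Global functions are needed because
`anchorDeriv` acts on `C^∞⟮𝓘(ℝ, E), Q; ℝ⟯` and has to be applied to coordinates, even twice. -/
lemma exists_globalCoordinates [T2Space Q] (x : Q) :
    ∃ c : GlobalCoordinates E Q, x ∈ c.source := by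
  let κ := extChartAt 𝓘(ℝ, E) x
  let b := Module.finBasis ℝ E
  have hG : ∀ m, ∃ f : C^∞⟮𝓘(ℝ, E), Q; ℝ⟯, ∀ᶠ y in 𝓝 x, f y = b.coord m (κ y) := fun m => by
    refine exists_function_eventuallyEq (u := κ.source) (isOpen_extChartAt_source x)
      (mem_extChartAt_source x) ?_
    have h := contMDiffOn_extChartAt (I := 𝓘(ℝ, E)) (x := x) (n := ∞)
    rw [← extChartAt_source 𝓘(ℝ, E)] at h
    exact (LinearMap.toContinuousLinearMap (b.coord m)).contMDiff.comp_contMDiffOn h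
  choose χ hχ using hG
  obtain ⟨S, hS, hSo, hxS⟩ := eventually_nhds_iff.1 ((Filter.eventually_all.2 hχ).and
    ((isOpen_extChartAt_source (I := 𝓘(ℝ, E)) x).mem_nhds (mem_extChartAt_source x)))
  have hcoord : ∀ y ∈ S, coordMap χ y = κ y := fun y hy => by
    simp only [coordMap, (hS y hy).1]
    exact b.sum_repr (κ y)
  have hT : IsOpen (κ.target ∩ κ.symm ⁻¹' S) :=
    (continuousOn_extChartAt_symm x).isOpen_inter_preimage (isOpen_extChartAt_target x) hSo
  exact ⟨⟨χ, κ.symm, S, κ.target ∩ κ.symm ⁻¹' S, hSo, hT,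
    fun y hy => by
      rw [hcoord y hy]
      exact ⟨κ.map_source (hS y hy).2, by rw [mem_preimage, κ.left_inv (hS y hy).2]; exact hy⟩,
    fun x hx => hx.2,
    fun y hy => by rw [hcoord y hy, κ.left_inv (hS y hy).2],
    fun x hx => by rw [hcoord _ hx.2, κ.right_inv hx.1],
    (contMDiffOn_extChartAt_symm x).mono inter_subset_left⟩, hxS⟩

namespace GlobalCoordinates

variable (c : GlobalCoordinates E Q)

lemma mfderiv_coordMap (χ : Fin (Module.finrank ℝ E) → C^∞⟮𝓘(ℝ, E), Q; ℝ⟯) (y : Q)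
    (v : TangentSpace 𝓘(ℝ, E) y) : (mfderiv 𝓘(ℝ, E) 𝓘(ℝ, E) (coordMap χ) y v : E) =
      ∑ m, mvfderiv 𝓘(ℝ, E) (χ m) y v • Module.finBasis ℝ E m := by
  let b := Module.finBasis ℝ E
  refine b.repr.injective (Finsupp.ext fun m => ?_)
  have h1 : b.repr (∑ m, mvfderiv 𝓘(ℝ, E) (χ m) y v • b m) m = mvfderiv 𝓘(ℝ, E) (χ m) y v :=
    congrFun (b.repr_sum_self _) m
  refine Eq.trans ?_ h1.symm
  let l : E →L[ℝ] ℝ := LinearMap.toContinuousLinearMap (b.coord m)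
  have h2 : HasMFDerivAt 𝓘(ℝ, E) 𝓘(ℝ, ℝ) (l ∘ coordMap χ) y
      (l.comp (mfderiv 𝓘(ℝ, E) 𝓘(ℝ, E) (coordMap χ) y : TangentSpace 𝓘(ℝ, E) y →L[ℝ] E)) :=
    HasMFDerivAt.comp y l.hasMFDerivAt
      ((contMDiff_coordMap χ).mdifferentiable (by simp) y).hasMFDerivAt
  have h3 : (l ∘ coordMap χ) = χ m := funext fun y => congrFun (b.repr_sum_self (fun m => χ m y)) m
  rw [h3] at h2
  exact (mvfderiv_apply_of_hasMFDerivAt h2 v).symm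

lemma mdifferentiableAt_symm {x : E} (hx : x ∈ c.target) :
    MDifferentiableAt 𝓘(ℝ, E) 𝓘(ℝ, E) c.ψ x :=
  (c.contMDiffOn_symm.contMDiffAt (c.isOpen_target.mem_nhds hx)).mdifferentiableAt (by simp)

lemma contDiffAt_comp_symm {G : Type*} [NormedAddCommGroup G] [NormedSpace ℝ G] {h : Q → G}
    (hh : ContMDiff 𝓘(ℝ, E) 𝓘(ℝ, G) ∞ h) {x : E} (hx : x ∈ c.target) :
    ContDiffAt ℝ ∞ (fun x => h (c.ψ x)) x :=
  contMDiffAt_iff_contDiffAt.1 (hh.contMDiffAt.comp x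
    (c.contMDiffOn_symm.contMDiffAt (c.isOpen_target.mem_nhds hx)))

lemma mvfderiv_eq_fderiv (h : C^∞⟮𝓘(ℝ, E), Q; ℝ⟯) {y : Q} (hy : y ∈ c.source)
    (v : TangentSpace 𝓘(ℝ, E) y) : mvfderiv 𝓘(ℝ, E) h y v =
      fderiv ℝ (fun x => h (c.ψ x)) (coordMap c.χ y)
        (∑ m, mvfderiv 𝓘(ℝ, E) (c.χ m) y v • Module.finBasis ℝ E m) := by
  have h1 : (h : Q → ℝ) =ᶠ[𝓝 y] (fun x => h (c.ψ x)) ∘ coordMap c.χ := by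
    filter_upwards [c.isOpen_source.mem_nhds hy] with z hz
    simp [c.left_inv z hz]
  rw [mvfderiv_congr h1]
  have h2 := (c.contDiffAt_comp_symm h.contMDiff (c.map_source y hy)).differentiableAt (by simp)
  have h3 : HasMFDerivAt 𝓘(ℝ, E) 𝓘(ℝ, ℝ) ((fun x => h (c.ψ x)) ∘ coordMap c.χ) y
      ((fderiv ℝ (fun x => h (c.ψ x)) (coordMap c.χ y)).comp
        (mfderiv 𝓘(ℝ, E) 𝓘(ℝ, E) (coordMap c.χ) y : TangentSpace 𝓘(ℝ, E) y →L[ℝ] E)) :=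
    HasMFDerivAt.comp y h2.hasFDerivAt.hasMFDerivAt
      ((contMDiff_coordMap c.χ).mdifferentiable (by simp) y).hasMFDerivAt
  refine (mvfderiv_apply_of_hasMFDerivAt h3 v).trans ?_
  exact congrArg (fderiv ℝ (fun x => h (c.ψ x)) (coordMap c.χ y)) (mfderiv_coordMap c.χ y v)

/-- Tangent vectors are determined by the derivatives of the coordinates. -/
lemma tangent_ext {y : Q} (hy : y ∈ c.source) {v v' : TangentSpace 𝓘(ℝ, E) y}
    (h : ∀ m, mvfderiv 𝓘(ℝ, E) (c.χ m) y v = mvfderiv 𝓘(ℝ, E) (c.χ m) y v') : v = v' := by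
  have key : ∀ v : TangentSpace 𝓘(ℝ, E) y,
      v = mfderiv 𝓘(ℝ, E) 𝓘(ℝ, E) c.ψ (coordMap c.χ y)
        (∑ m, mvfderiv 𝓘(ℝ, E) (c.χ m) y v • Module.finBasis ℝ E m) := by
    intro v
    have h1 : (c.ψ ∘ coordMap c.χ) =ᶠ[𝓝 y] id := by
      filter_upwards [c.isOpen_source.mem_nhds hy] with z hz
      exact c.left_inv z hz
    have h2 := mfderiv_comp_apply y (c.mdifferentiableAt_symm (c.map_source y hy))
      ((contMDiff_coordMap c.χ).mdifferentiable (by simp) y) v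
    have h3 : (mfderiv 𝓘(ℝ, E) 𝓘(ℝ, E) (c.ψ ∘ coordMap c.χ) y v : E) = v := by
      refine (congrArg (fun l : TangentSpace 𝓘(ℝ, E) y →L[ℝ] E => l v)
        (h1.mfderiv_eq (I := 𝓘(ℝ, E)) (I' := 𝓘(ℝ, E)))).trans ?_
      exact congrArg (fun l : TangentSpace 𝓘(ℝ, E) y →L[ℝ] E => l v) (mfderiv_id (I := 𝓘(ℝ, E)))
    refine h3.symm.trans (h2.trans ?_)
    exact congrArg (mfderiv 𝓘(ℝ, E) 𝓘(ℝ, E) c.ψ (coordMap c.χ y)) (mfderiv_coordMap c.χ y v)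
  rw [key v, key v']
  simp only [h]
  rfl

end GlobalCoordinates

end Coordinates

/-! ### The anchor as a morphism of Lie algebras, and the regularity of base paths -/

section Anchor

variable {E : Type*} [NormedAddCommGroup E] [NormedSpace ℝ E]
  {Q : Type*} [TopologicalSpace Q] [ChartedSpace E Q]
  {F : Type*} [NormedAddCommGroup F] [NormedSpace ℝ F]
  {V : Q → Type*} [TopologicalSpace (TotalSpace F V)]
  [∀ x, AddCommGroup (V x)] [∀ x, Module ℝ (V x)] [∀ x, TopologicalSpace (V x)]
  [FiberBundle F V] [VectorBundle ℝ F V]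
  [∀ x, IsTopologicalAddGroup (V x)] [∀ x, ContinuousSMul ℝ (V x)]
  [IsManifold 𝓘(ℝ, E) ∞ Q] [ContMDiffVectorBundle ∞ F V 𝓘(ℝ, E)]
  [FiniteDimensional ℝ E] [FiniteDimensional ℝ F] [T2Space Q]

namespace LieAlgebroid

variable (L : LieAlgebroid E F V)

lemma bracket_fsmul (X : Cₛ^∞⟮𝓘(ℝ, E); F, V⟯) (f : C^∞⟮𝓘(ℝ, E), Q; ℝ⟯) (Y : Cₛ^∞⟮𝓘(ℝ, E); F, V⟯) :
    L.bracket X (f • Y) = L.anchorDeriv X f • Y + f • L.bracket X Y :=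
  ContMDiffSection.ext fun x => L.leibniz X f Y x

/-- The anchor is a morphism of Lie algebras. -/
lemma anchorDeriv_bracket (X Y : Cₛ^∞⟮𝓘(ℝ, E); F, V⟯) (f : C^∞⟮𝓘(ℝ, E), Q; ℝ⟯) (x : Q) :
    L.anchorDeriv (L.bracket X Y) f x =
      L.anchorDeriv X (L.anchorDeriv Y f) x - L.anchorDeriv Y (L.anchorDeriv X f) x := by
  -- The Jacobi identity for `X`, `Y`, `f Z` is expanded by the Leibniz rule. Subtracting `f` times
  -- the identity for `X`, `Y`, `Z` leaves the claimed difference times `Z x`, which is cancelled if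
  -- `Z x ≠ 0`. In a zero fibre all anchored derivatives vanish.
  by_cases hV : ∃ w : V x, w ≠ 0
  · obtain ⟨w, hw⟩ := hV
    obtain ⟨Z, rfl⟩ := exists_section_apply_eq (E := E) (F := F) x w
    have hJ := congrArg (fun s : Cₛ^∞⟮𝓘(ℝ, E); F, V⟯ => s x) (L.jacobi X Y (f • Z))
    have hJ' := congrArg (fun s : Cₛ^∞⟮𝓘(ℝ, E); F, V⟯ => s x) (L.jacobi X Y Z)
    simp only [L.bracket_fsmul, L.bracket_add, ContMDiffSection.coe_add, Pi.add_apply,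
      fsmul_apply] at hJ hJ'
    rw [hJ'] at hJ
    have h : (L.anchorDeriv (L.bracket X Y) f x - (L.anchorDeriv X (L.anchorDeriv Y f) x -
        L.anchorDeriv Y (L.anchorDeriv X f) x)) • Z x = 0 := by
      rw [← sub_eq_zero] at hJ
      rw [← neg_eq_zero, ← hJ]
      module
    exact sub_eq_zero.1 ((smul_eq_zero.1 h).resolve_right hw)
  · push Not at hV
    simp [hV]

lemma anchorDeriv_add_left (X Y : Cₛ^∞⟮𝓘(ℝ, E); F, V⟯) (f : C^∞⟮𝓘(ℝ, E), Q; ℝ⟯) :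
    L.anchorDeriv (X + Y) f = L.anchorDeriv X f + L.anchorDeriv Y f := by
  ext x; simp

/-- The section `ρ^* df` of the dual bundle. -/
def anchorDifferential (f : C^∞⟮𝓘(ℝ, E), Q; ℝ⟯) : Cₛ^∞⟮𝓘(ℝ, E); F →L[ℝ] ℝ, DualFiber V⟯ :=
  have h : IsFunctionLinear (fun X : Cₛ^∞⟮𝓘(ℝ, E); F, V⟯ => L.anchorDeriv X f) :=
    ⟨fun X Y => L.anchorDeriv_add_left X Y f, fun g X => by ext x; simp⟩
  ⟨h.covector, h.contMDiff_covector⟩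

lemma anchorDifferential_apply (f : C^∞⟮𝓘(ℝ, E), Q; ℝ⟯) (x : Q) (w : V x) :
    L.anchorDifferential f x w = mvfderiv 𝓘(ℝ, E) f x (L.anchor x w) := by
  obtain ⟨X, rfl⟩ := exists_section_apply_eq (E := E) (F := F) x w
  exact IsFunctionLinear.covector_apply _ x X

/-- A `C¹` path in `A` whose base path satisfies `q̇ = ρ(a)` has a base path of class `C²`. -/
lemma isAPath_of_contMDiffOn {t₀ t₁ : ℝ} (ht : t₀ < t₁) {γ : ℝ → TotalSpace F V}
    (hγ : ContMDiffOn 𝓘(ℝ, ℝ) (𝓘(ℝ, E).prod 𝓘(ℝ, F)) 1 γ (Icc t₀ t₁))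
    (hq : ∀ t ∈ Icc t₀ t₁, mfderivWithin 𝓘(ℝ, ℝ) 𝓘(ℝ, E) (fun τ => (γ τ).1) (Icc t₀ t₁) t (1 : ℝ) =
      L.anchor (γ t).1 (γ t).2) : L.IsAPath (Icc t₀ t₁) γ := by
  refine ⟨⟨hγ, fun t htJ => ?_⟩, hq⟩
  have hqc : ContMDiffOn 𝓘(ℝ, ℝ) 𝓘(ℝ, E) 1 (fun τ => (γ τ).1) (Icc t₀ t₁) :=
    (contMDiff_proj V (IB := 𝓘(ℝ, E)) (n := 1) (F := F)).comp_contMDiffOn hγ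
  obtain ⟨c, hc⟩ := exists_globalCoordinates (E := E) (γ t).1
  -- By the anchor equation, the derivative of a coordinate of the base path is a smooth fibrewise
  -- linear function of the `C¹` path `γ`. Hence it is `C¹`, and the coordinate is `C²`.
  have h1 : ∀ m, ∀ τ ∈ Icc t₀ t₁, HasDerivWithinAt (fun τ => c.χ m (γ τ).1)
      (fiberLinear (L.anchorDifferential (c.χ m)) (γ τ)) (Icc t₀ t₁) τ := fun m τ hτ => by
    have := hasDerivWithinAt_comp_curve (γ := fun τ => (γ τ).1)
      ((c.χ m).contMDiff.mdifferentiable (by simp) (γ τ).1) (hqc.mdifferentiableOn (by simp) τ hτ)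
    rw [hq τ hτ] at this
    rw [fiberLinear, anchorDifferential_apply]
    exact this
  have h2 : ∀ m, ContDiffOn ℝ 2 (fun τ => c.χ m (γ τ).1) (Icc t₀ t₁) := fun m => by
    have h21 : (2 : WithTop ℕ∞) = 1 + 1 := by norm_num
    rw [h21, contDiffOn_succ_iff_derivWithin (uniqueDiffOn_Icc ht)]
    refine ⟨fun τ hτ => (h1 m τ hτ).differentiableWithinAt, by simp, ?_⟩
    have h3 : ContDiffOn ℝ 1 (fun τ => fiberLinear (L.anchorDifferential (c.χ m)) (γ τ))
        (Icc t₀ t₁) := contMDiffOn_iff_contDiffOn.1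
      (((contMDiff_fiberLinear _).of_le (by simp)).comp_contMDiffOn hγ)
    exact h3.congr fun τ hτ => (h1 m τ hτ).derivWithin (uniqueDiffOn_Icc ht τ hτ)
  have h4 : ContMDiffWithinAt 𝓘(ℝ, ℝ) 𝓘(ℝ, E) 2 (fun τ => coordMap c.χ (γ τ).1) (Icc t₀ t₁) t :=
    ContMDiffWithinAt.sum fun m _ => (contMDiffWithinAt_iff_contDiffWithinAt.2 (h2 m t htJ)).smul
      contMDiffWithinAt_const
  have h5 : ContMDiffAt 𝓘(ℝ, E) 𝓘(ℝ, E) 2 c.ψ (coordMap c.χ (γ t).1) :=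
    (c.contMDiffOn_symm.contMDiffAt (c.isOpen_target.mem_nhds (c.map_source _ hc))).of_le
      ENat.LEInfty.out
  refine (h5.comp_contMDiffWithinAt t h4).congr_of_eventuallyEq ?_ ?_
  · filter_upwards [(hqc t htJ).continuousWithinAt.eventually_mem (c.isOpen_source.mem_nhds hc)]
      with τ hτ
    exact (c.left_inv _ hτ).symm
  · exact (c.left_inv _ hc).symm

end LieAlgebroid

end Anchor

/-! ### Deforming an `A`-path by the flow of a section -/

section Homotopy

variable {E : Type*} [NormedAddCommGroup E] [NormedSpace ℝ E]
  {Q : Type*} [TopologicalSpace Q] [ChartedSpace E Q]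
  {F : Type*} [NormedAddCommGroup F] [NormedSpace ℝ F]
  {V : Q → Type*} [TopologicalSpace (TotalSpace F V)]
  [∀ x, AddCommGroup (V x)] [∀ x, Module ℝ (V x)] [∀ x, TopologicalSpace (V x)]
  [FiberBundle F V] [VectorBundle ℝ F V]
  [∀ x, IsTopologicalAddGroup (V x)] [∀ x, ContinuousSMul ℝ (V x)]
  [IsManifold 𝓘(ℝ, E) ∞ Q] [ContMDiffVectorBundle ∞ F V 𝓘(ℝ, E)]
  [FiniteDimensional ℝ E] [FiniteDimensional ℝ F] [T2Space Q]

namespace LieAlgebroid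

variable (L : LieAlgebroid E F V) (c : GlobalCoordinates E Q)

/-- The coordinate representation of the vector field `ρ(X)`. -/
def coordAnchor (X : Cₛ^∞⟮𝓘(ℝ, E); F, V⟯) (x : E) : E :=
  ∑ m, L.anchorDeriv X (c.χ m) (c.ψ x) • Module.finBasis ℝ E m

lemma finBasis_coord_coordAnchor (X : Cₛ^∞⟮𝓘(ℝ, E); F, V⟯) (x : E) (m) :
    (Module.finBasis ℝ E).coord m (L.coordAnchor c X x) = L.anchorDeriv X (c.χ m) (c.ψ x) :=
  congrFun ((Module.finBasis ℝ E).repr_sum_self _) m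

lemma contDiffAt_coordAnchor (X : Cₛ^∞⟮𝓘(ℝ, E); F, V⟯) {x : E} (hx : x ∈ c.target) :
    ContDiffAt ℝ ∞ (L.coordAnchor c X) x :=
  ContDiffAt.sum fun m _ => (c.contDiffAt_comp_symm (L.anchorDeriv X (c.χ m)).contMDiff hx).smul
    contDiffAt_const

lemma fderiv_coordAnchor (X : Cₛ^∞⟮𝓘(ℝ, E); F, V⟯) (h : C^∞⟮𝓘(ℝ, E), Q; ℝ⟯) {x : E}
    (hx : x ∈ c.target) :
    fderiv ℝ (fun x => h (c.ψ x)) x (L.coordAnchor c X x) = L.anchorDeriv X h (c.ψ x) := by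
  have := c.mvfderiv_eq_fderiv h (c.map_target x hx) (L.anchor (c.ψ x) (X (c.ψ x)))
  rw [c.right_inv x hx] at this
  exact this.symm

/-- This is the morphism property of the anchor in coordinates; it supplies the bracket hypothesis
of `exists_anchored_flow`. -/
lemma coordAnchor_bracket (X Y : Cₛ^∞⟮𝓘(ℝ, E); F, V⟯) {x : E} (hx : x ∈ c.target) :
    fderiv ℝ (L.coordAnchor c Y) x (L.coordAnchor c X x) -
      fderiv ℝ (L.coordAnchor c X) x (L.coordAnchor c Y x) =
    L.coordAnchor c (L.bracket X Y) x := by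
  have h : ∀ X Y : Cₛ^∞⟮𝓘(ℝ, E); F, V⟯, fderiv ℝ (L.coordAnchor c Y) x (L.coordAnchor c X x) =
      ∑ m, L.anchorDeriv X (L.anchorDeriv Y (c.χ m)) (c.ψ x) • Module.finBasis ℝ E m := by
    intro X Y
    have h1 : HasFDerivAt (L.coordAnchor c Y)
        (∑ m, (fderiv ℝ (fun x => L.anchorDeriv Y (c.χ m) (c.ψ x)) x).smulRight
          (Module.finBasis ℝ E m)) x := by
      refine HasFDerivAt.fun_sum fun m _ => ?_
      exact ((c.contDiffAt_comp_symm (L.anchorDeriv Y (c.χ m)).contMDiff hx).differentiableAt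
        (by simp)).hasFDerivAt.smul_const _
    rw [h1.fderiv]
    simp only [sum_apply, ContinuousLinearMap.smulRight_apply, L.fderiv_coordAnchor c X _ hx]
  rw [h, h, ← Finset.sum_sub_distrib]
  exact Finset.sum_congr rfl fun m _ => by rw [← sub_smul, ← L.anchorDeriv_bracket]

lemma anchorDeriv_eq_sum {ι : Type*} [Fintype ι] {X : Cₛ^∞⟮𝓘(ℝ, E); F, V⟯}
    {s : ι → Cₛ^∞⟮𝓘(ℝ, E); F, V⟯} {r : ι → ℝ} {y : Q} (h : X y = ∑ i, r i • s i y)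
    (f : C^∞⟮𝓘(ℝ, E), Q; ℝ⟯) : L.anchorDeriv X f y = ∑ i, r i * L.anchorDeriv (s i) f y := by
  simp only [anchorDeriv_apply, h, map_sum, map_smul, smul_eq_mul]

lemma coordAnchor_eq_sum {ι : Type*} [Fintype ι] {X : Cₛ^∞⟮𝓘(ℝ, E); F, V⟯}
    {s : ι → Cₛ^∞⟮𝓘(ℝ, E); F, V⟯} {r : ι → ℝ} {x : E} (h : X (c.ψ x) = ∑ i, r i • s i (c.ψ x)) :
    L.coordAnchor c X x = ∑ i, r i • L.coordAnchor c (s i) x := by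
  simp only [coordAnchor, L.anchorDeriv_eq_sum h, Finset.sum_smul, Finset.smul_sum, mul_smul]
  exact Finset.sum_comm

/-- The flow of a section of a Lie algebroid deforms an `A`-path near a given time. -/
theorem exists_local_family {t₀ t₁ : ℝ} {q : ℝ → Q} {a : ∀ t, V (q t)}
    (ha : L.IsAPath (Icc t₀ t₁) (fun t => (⟨q t, a t⟩ : TotalSpace F V)))
    (e : Cₛ^∞⟮𝓘(ℝ, E); F, V⟯) {t' : ℝ} (ht' : t' ∈ Ioo t₀ t₁) :
    ∃ (n : ℕ) (s : Fin n → Cₛ^∞⟮𝓘(ℝ, E); F, V⟯) (M : Fin n → Fin n → Q → ℝ),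
    ∃ η > 0, Metric.ball t' η ⊆ Ioo t₀ t₁ ∧
      (∀ t ∈ Metric.ball t' η, ∀ k, L.bracket e (s k) (q t) = ∑ j, M j k (q t) • s j (q t)) ∧
      ∀ f : ℝ → ℝ, ContDiff ℝ ∞ f → tsupport f ⊆ Metric.ball t' η →
      ∃ δ > 0, ∃ (b : ℝ → ℝ → Q) (Y : Fin n → ℝ → ℝ → ℝ),
        ContMDiffOn 𝓘(ℝ, ℝ × ℝ) 𝓘(ℝ, E) 1 (fun z : ℝ × ℝ => b z.1 z.2)
          (Ioo (-δ) δ ×ˢ Metric.ball t' η) ∧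
        (∀ j, ContDiffOn ℝ 1 (fun z : ℝ × ℝ => Y j z.1 z.2) (Ioo (-δ) δ ×ˢ Metric.ball t' η)) ∧
        (∀ t ∈ Metric.ball t' η, ∀ ε, ε = 0 ∨ f t = 0 →
          b ε t = q t ∧ ∑ j, Y j ε t • s j (q t) = a t) ∧
        (∀ ε ∈ Ioo (-δ) δ, ∀ t ∈ Metric.ball t' η,
          mfderivWithin 𝓘(ℝ, ℝ) 𝓘(ℝ, E) (b ε) (Icc t₀ t₁) t (1 : ℝ) =
            L.anchor (b ε t) (∑ j, Y j ε t • s j (b ε t) + (ε * deriv f t) • e (b ε t))) ∧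
        ∀ t ∈ Metric.ball t' η,
          (mfderiv 𝓘(ℝ, ℝ) 𝓘(ℝ, E) (fun ε => b ε t) 0 (1 : ℝ) =
            L.anchor (b 0 t) (f t • e (b 0 t))) ∧
          ∀ j, HasDerivAt (fun ε => Y j ε t) (f t * -∑ k, M j k (q t) * Y k 0 t) 0 := by
  obtain ⟨s, σ, hsσ⟩ := exists_local_frame (E := E) (K := F) (W := V) (q t')
  obtain ⟨S, hS, hSo, hxS⟩ := eventually_nhds_iff.1 hsσ
  obtain ⟨c, hc⟩ := exists_globalCoordinates (E := E) (q t')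
  -- The coefficients of `[e, s_k]` in the frame. A combination `∑ y_j s_j` along the flow of `ρ(e)`
  -- is invariant under `e` exactly when `ẏ = -M y`.
  let M : Fin (Module.finrank ℝ F) → Fin (Module.finrank ℝ F) → C^∞⟮𝓘(ℝ, E), Q; ℝ⟯ :=
    fun j k => pairing (σ j) (L.bracket e (s k))
  have hM : ∀ y ∈ S, ∀ k, L.bracket e (s k) y = ∑ j, M j k y • s j y := fun y hy k =>
    (hS y hy).1 _
  have hIcc : Icc t₀ t₁ ∈ 𝓝 t' := Icc_mem_nhds ht'.1 ht'.2
  let X := L.coordAnchor c e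
  let R := fun j => L.coordAnchor c (s j)
  let M' := fun j k x => M j k (c.ψ x)
  let x : ℝ → E := fun t => coordMap c.χ (q t)
  let y : ℝ → Fin (Module.finrank ℝ F) → ℝ := fun t j => σ j (q t) (a t)
  have hqc : ContMDiffOn 𝓘(ℝ, ℝ) 𝓘(ℝ, E) 1 q (Icc t₀ t₁) := ha.1.2.of_le (by norm_num)
  have hx1 : ContDiffOn ℝ 1 x (Icc t₀ t₁) := contMDiffOn_iff_contDiffOn.1
    (((contMDiff_coordMap c.χ).of_le (by simp)).comp_contMDiffOn hqc)
  have hy1 : ContDiffOn ℝ 1 y (Icc t₀ t₁) := contDiffOn_pi.2 fun j =>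
    contMDiffOn_iff_contDiffOn.1
      (((contMDiff_fiberLinear (σ j)).of_le (by simp)).comp_contMDiffOn ha.1.1)
  have hT : c.target ∩ c.ψ ⁻¹' S ∈ 𝓝 (x t') := by
    refine (c.contMDiffOn_symm.continuousOn.isOpen_inter_preimage c.isOpen_target hSo).mem_nhds
      ⟨c.map_source _ hc, ?_⟩
    rw [mem_preimage, c.left_inv _ hc]
    exact hxS
  have hxT : x t' ∈ c.target := c.map_source _ hc
  obtain ⟨δ₀, hδ₀, U, hU, hzU, φ, hφ0, hφ, hcurve⟩ := exists_anchored_flow (X := X) (R := R)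
    (M := M') (z₀ := (x t', y t'))
    ((L.contDiffAt_coordAnchor c e hxT).of_le ENat.LEInfty.out)
    (fun j => (L.contDiffAt_coordAnchor c (s j) hxT).of_le ENat.LEInfty.out)
    (fun i j => (c.contDiffAt_comp_symm (M i j).contMDiff hxT).of_le ENat.LEInfty.out)
    (by
      filter_upwards [hT] with x hx j
      rw [L.coordAnchor_bracket c _ _ hx.1]
      exact L.coordAnchor_eq_sum c (hM _ hx.2 j))
    (N := (c.target ∩ c.ψ ⁻¹' S) ×ˢ univ) (prod_mem_nhds hT Filter.univ_mem)
  have hev : ∀ᶠ t in 𝓝 t', t ∈ Ioo t₀ t₁ ∧ q t ∈ S ∧ q t ∈ c.source ∧ (x t, y t) ∈ U := by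
    have hqt := (hqc.continuousOn.continuousAt hIcc)
    have hxyt : ContinuousAt (fun t => (x t, y t)) t' :=
      (hx1.continuousOn.continuousAt hIcc).prodMk (hy1.continuousOn.continuousAt hIcc)
    exact Filter.Eventually.and (Ioo_mem_nhds ht'.1 ht'.2)
      ((hqt.eventually (hSo.mem_nhds hxS)).and
      ((hqt.eventually (c.isOpen_source.mem_nhds hc)).and (hxyt.eventually (hU.mem_nhds hzU))))
  obtain ⟨η, hη, hB⟩ := Metric.mem_nhds_iff.1 hev
  refine ⟨_, s, fun j k => M j k, η, hη, fun t ht => (hB ht).1, fun t ht => hM _ (hB ht).2.1,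
    fun f hf hfs => ?_⟩
  have hfc : HasCompactSupport f := Metric.isCompact_of_isClosed_isBounded (isClosed_tsupport f)
    (Metric.isBounded_ball.subset hfs)
  obtain ⟨C, hC⟩ := hf.continuous.bounded_above_of_compact_support hfc
  have hC0 : 0 ≤ C := (norm_nonneg _).trans (hC 0)
  -- The flow time is `ε f(t)` with `|f| ≤ C`; the denominator `C + 1` is positive even if `C = 0`.
  have hδ : ∀ ε ∈ Ioo (-(δ₀ / (C + 1))) (δ₀ / (C + 1)), ∀ t, ε * f t ∈ Ioo (-δ₀) δ₀ := by
    intro ε hε t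
    have hε' := abs_lt.2 hε
    refine abs_lt.1 ?_
    rw [abs_mul]
    rw [lt_div_iff₀ (by linarith)] at hε'
    have := hC t
    rw [Real.norm_eq_abs] at this
    nlinarith [abs_nonneg ε, abs_nonneg (f t)]
  have hδ0 : (0 : ℝ) ∈ Ioo (-δ₀) δ₀ := ⟨by linarith, hδ₀⟩
  -- The flow time depends on `t`, which adds `ε f'(t) ρ(e)` to the velocity of the base path. The
  -- extra multiple of `e` in the anchor equation of the family accounts for this term.
  let P : ℝ → ℝ → E × (Fin (Module.finrank ℝ F) → ℝ) := fun ε t => φ (ε * f t) (x t, y t)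
  have hP : ∀ t ∈ Metric.ball t' η, ∀ ε, ε = 0 ∨ f t = 0 → P ε t = (x t, y t) := by
    intro t ht ε h
    have : ε * f t = 0 := by rcases h with h | h <;> simp [h]
    simp only [P, this]
    exact hφ0 _ (hB ht).2.2.2
  have hPd : ContDiffOn ℝ 1 (fun z : ℝ × ℝ => P z.1 z.2)
      (Ioo (-(δ₀ / (C + 1))) (δ₀ / (C + 1)) ×ˢ Metric.ball t' η) := by
    intro z hz
    have hzI : Icc t₀ t₁ ∈ 𝓝 z.2 := Icc_mem_nhds (hB hz.2).1.1 (hB hz.2).1.2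
    have h1 := (hφ _ (hδ z.1 hz.1 z.2) _ (hB hz.2).2.2.2).2.2
    have h2 : ContDiffAt ℝ 1 (fun z : ℝ × ℝ => (z.1 * f z.2, (x z.2, y z.2))) z := by
      refine (contDiffAt_fst.mul ((hf.of_le (by simp)).contDiffAt.comp z contDiffAt_snd)).prodMk
        (ContDiffAt.prodMk ?_ ?_)
      · exact (hx1.contDiffAt hzI).comp z contDiffAt_snd
      · exact (hy1.contDiffAt hzI).comp z contDiffAt_snd
    exact (h1.comp z h2).contDiffWithinAt
  have hPT : ∀ ε ∈ Ioo (-(δ₀ / (C + 1))) (δ₀ / (C + 1)), ∀ t ∈ Metric.ball t' η,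
      (P ε t).1 ∈ c.target := fun ε hε t ht =>
    ((hφ _ (hδ ε hε t) _ (hB ht).2.2.2).1).1.1
  have hPS : ∀ ε ∈ Ioo (-(δ₀ / (C + 1))) (δ₀ / (C + 1)), ∀ t ∈ Metric.ball t' η,
      c.ψ (P ε t).1 ∈ c.source := fun ε hε t ht => c.map_target _ (hPT ε hε t ht)
  have hδ' : 0 < δ₀ / (C + 1) := by positivity
  have h0mem : (0 : ℝ) ∈ Ioo (-(δ₀ / (C + 1))) (δ₀ / (C + 1)) := ⟨by linarith, hδ'⟩
  refine ⟨δ₀ / (C + 1), hδ', fun ε t => c.ψ (P ε t).1, fun j ε t => (P ε t).2 j,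
    ?_, ?_, ?_, ?_, ?_⟩
  · refine (c.contMDiffOn_symm.of_le (by simp)).comp (t := c.target)
      (f := fun z : ℝ × ℝ => (P z.1 z.2).1) ?_ fun z hz => hPT _ hz.1 _ hz.2
    exact contMDiffOn_iff_contDiffOn.2 hPd.fst
  · exact fun j => contDiffOn_pi.1 hPd.snd j
  · intro t ht ε h
    have h1 : c.ψ (P ε t).1 = q t := by rw [hP t ht ε h]; exact c.left_inv _ (hB ht).2.2.1
    refine ⟨h1, ?_⟩
    simp only [hP t ht ε h]
    exact ((hS _ (hB ht).2.1).1 (a t)).symm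
  · intro ε hε t ht
    have htJ : t ∈ Icc t₀ t₁ := Ioo_subset_Icc_self (hB ht).1
    have huniq : UniqueDiffWithinAt ℝ (Icc t₀ t₁) t := uniqueDiffWithinAt_of_mem_nhds
      (Icc_mem_nhds (hB ht).1.1 (hB ht).1.2)
    have hxd : HasDerivWithinAt x (∑ j, y t j • R j (x t)) (Icc t₀ t₁) t := by
      have h1 : ∀ m, HasDerivWithinAt (fun τ => c.χ m (q τ))
          (mvfderiv 𝓘(ℝ, E) (c.χ m) (q t) (L.anchor (q t) (a t))) (Icc t₀ t₁) t := fun m => by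
        have := hasDerivWithinAt_comp_curve (γ := q)
          ((c.χ m).contMDiff.mdifferentiable (by simp) (q t)) (hqc.mdifferentiableOn (by simp) t htJ)
        rwa [ha.2 t htJ] at this
      refine (HasDerivWithinAt.fun_sum (u := Finset.univ) fun m _ =>
        (h1 m).smul_const (Module.finBasis ℝ E m)).congr_deriv ?_
      obtain ⟨Z, hZ⟩ := exists_section_apply_eq (E := E) (F := F) (q t) (a t)
      have hψ : c.ψ (x t) = q t := c.left_inv _ (hB ht).2.2.1
      rw [← L.coordAnchor_eq_sum c (X := Z) (s := s) (by rw [hψ, hZ]; exact (hS _ (hB ht).2.1).1 (a t))]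
      simp only [coordAnchor, anchorDeriv_apply]
      rw [hψ, hZ]
    have hPt := hcurve x y _ (fun τ => ε * f τ) (ε * deriv f t) (Icc t₀ t₁) t hxd
      ((hy1.differentiableOn (by simp) t htJ).hasDerivWithinAt)
      (((hf.differentiable (by simp) t).hasDerivAt.const_mul ε).hasDerivWithinAt)
      (hδ ε hε t) (hB ht).2.2.2
    have hψd : MDifferentiableWithinAt 𝓘(ℝ, ℝ) 𝓘(ℝ, E) (fun τ => c.ψ (P ε τ).1) (Icc t₀ t₁) t :=
      (c.mdifferentiableAt_symm (hPT ε hε t ht)).comp_mdifferentiableWithinAt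
        (f := fun τ => (P ε τ).1) t hPt.differentiableWithinAt.mdifferentiableWithinAt
    refine c.tangent_ext (hPS ε hε t ht) fun m => ?_
    have h2 := hasDerivWithinAt_comp_curve
      ((c.χ m).contMDiff.mdifferentiable (by simp) (c.ψ (P ε t).1)) hψd
    let l : E →L[ℝ] ℝ := LinearMap.toContinuousLinearMap ((Module.finBasis ℝ E).coord m)
    have hl : ∀ x ∈ c.target, l x = c.χ m (c.ψ x) := fun x hx => by
      conv_lhs => rw [← c.right_inv x hx]
      exact congrFun ((Module.finBasis ℝ E).repr_sum_self _) m
    have h3 := l.hasFDerivAt.comp_hasDerivWithinAt t hPt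
    have h4 := h3.congr_of_eventuallyEq (f₁ := fun τ => c.χ m (c.ψ (P ε τ).1)) (by
      filter_upwards [mem_nhdsWithin_of_mem_nhds (Metric.isOpen_ball.mem_nhds ht)] with τ hτ
      exact (hl _ (hPT ε hε τ hτ)).symm) (hl _ (hPT ε hε t ht)).symm
    refine (huniq.eq_deriv _ h2 h4).trans ?_
    have hlX : ∀ Z x, l (L.coordAnchor c Z x) = L.anchorDeriv Z (c.χ m) (c.ψ x) := fun Z x =>
      L.finBasis_coord_coordAnchor c Z x m
    simp only [map_add, map_smul, map_sum, X, R, hlX, anchorDeriv_apply]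
    exact add_comm _ _
  · intro t ht
    have h1 := (hφ 0 hδ0 _ (hB ht).2.2.2).2.1
    rw [hφ0 _ (hB ht).2.2.2] at h1
    have hPt : HasDerivAt (fun ε => P ε t) (f t • transportField X M' (x t, y t)) 0 := by
      have h2 : HasDerivAt (fun ε : ℝ => ε * f t) (f t) 0 := by
        simpa using (hasDerivAt_id (0 : ℝ)).mul_const (f t)
      exact HasDerivAt.scomp_of_eq (h := fun ε : ℝ => ε * f t) (0 : ℝ) h1 h2 (by simp)
    have hPt1 := hasDerivWithinAt_univ.1 (hasDerivWithinAt_fst hPt.hasDerivWithinAt)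
    have hPt2 := hasDerivWithinAt_univ.1 (hasDerivWithinAt_snd hPt.hasDerivWithinAt)
    have hψ : c.ψ (x t) = q t := c.left_inv _ (hB ht).2.2.1
    have hP0 := hP t ht 0 (Or.inl rfl)
    constructor
    · have hψd : MDifferentiableAt 𝓘(ℝ, ℝ) 𝓘(ℝ, E) (fun ε => c.ψ (P ε t).1) 0 :=
        (c.mdifferentiableAt_symm (hPT 0 h0mem t ht)).comp
          (f := fun ε => (P ε t).1) 0 hPt1.differentiableAt.mdifferentiableAt
      refine c.tangent_ext (hPS 0 h0mem t ht) fun m => ?_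
      have h2 := hasDerivAt_comp_curve
        ((c.χ m).contMDiff.mdifferentiable (by simp) (c.ψ (P 0 t).1)) hψd
      let l : E →L[ℝ] ℝ := LinearMap.toContinuousLinearMap ((Module.finBasis ℝ E).coord m)
      have hl : ∀ x ∈ c.target, l x = c.χ m (c.ψ x) := fun x hx => by
        conv_lhs => rw [← c.right_inv x hx]
        exact congrFun ((Module.finBasis ℝ E).repr_sum_self _) m
      have h3 := l.hasFDerivAt.comp_hasDerivAt 0 hPt1
      have h4 := h3.congr_of_eventuallyEq (f₁ := fun ε => c.χ m (c.ψ (P ε t).1)) (by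
        filter_upwards [Ioo_mem_nhds h0mem.1 h0mem.2] with ε hε
        exact (hl _ (hPT ε hε t ht)).symm)
      refine (h2.unique h4).trans ?_
      have hlX : ∀ Z x, l (L.coordAnchor c Z x) = L.anchorDeriv Z (c.χ m) (c.ψ x) := fun Z x =>
        L.finBasis_coord_coordAnchor c Z x m
      have h5 : (f t • transportField X M' (x t, y t)).1 = f t • L.coordAnchor c e (x t) := rfl
      have h6 : x t = (P 0 t).1 := by rw [hP0]
      rw [h5, map_smul, hlX, anchorDeriv_apply, h6]
      exact ((congrArg (mvfderiv 𝓘(ℝ, E) (c.χ m) (c.ψ (P 0 t).1)) (map_smul (L.anchor _) _ _)).trans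
        (map_smul (mvfderiv 𝓘(ℝ, E) (c.χ m) (c.ψ (P 0 t).1)) _ _)).symm
    · intro j
      refine (hasDerivAt_pi.1 hPt2 j).congr_deriv ?_
      have h5 : (f t • transportField X M' (x t, y t)).2 j =
        f t * -∑ k, M j k (c.ψ (x t)) * y t k := rfl
      rw [h5, hψ]
      simp only [hP0]

end LieAlgebroid

end Homotopy

/-! ### Realizing localized admissible variations by homotopies -/

section Variations

variable {E : Type*} [NormedAddCommGroup E] [NormedSpace ℝ E]
  {Q : Type*} [TopologicalSpace Q] [ChartedSpace E Q]
  {F : Type*} [NormedAddCommGroup F] [NormedSpace ℝ F]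
  {V : Q → Type*} [TopologicalSpace (TotalSpace F V)]
  [∀ x, AddCommGroup (V x)] [∀ x, Module ℝ (V x)] [∀ x, TopologicalSpace (V x)]
  [FiberBundle F V] [VectorBundle ℝ F V]
  [∀ x, IsTopologicalAddGroup (V x)] [∀ x, ContinuousSMul ℝ (V x)]
  [IsManifold 𝓘(ℝ, E) ∞ Q] [ContMDiffVectorBundle ∞ F V 𝓘(ℝ, E)]
  [FiniteDimensional ℝ E] [FiniteDimensional ℝ F] [T2Space Q]

lemma AConnection.toFun_apply_sum {K : Type*} [NormedAddCommGroup K] [NormedSpace ℝ K]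
    {W : Q → Type*} [TopologicalSpace (TotalSpace K W)]
    [∀ x, AddCommGroup (W x)] [∀ x, Module ℝ (W x)] [∀ x, TopologicalSpace (W x)]
    [FiberBundle K W] [VectorBundle ℝ K W]
    [∀ x, IsTopologicalAddGroup (W x)] [∀ x, ContinuousSMul ℝ (W x)]
    [ContMDiffVectorBundle ∞ K W 𝓘(ℝ, E)] [FiniteDimensional ℝ K] {L : LieAlgebroid E F V}
    (D : AConnection L K W) {ι : Type*} [Fintype ι]
    {X : Cₛ^∞⟮𝓘(ℝ, E); F, V⟯} {Y : ι → Cₛ^∞⟮𝓘(ℝ, E); F, V⟯} {r : ι → ℝ} {x : Q}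
    (h : X x = ∑ i, r i • Y i x) (s : Cₛ^∞⟮𝓘(ℝ, E); K, W⟯) :
    D.toFun X s x = ∑ i, r i • D.toFun (Y i) s x := by
  refine eq_of_forall_dual_section (E := E) (K := K) x fun σ => ?_
  have hΘ : IsFunctionLinear (fun X => pairing σ (D.toFun X s)) :=
    ⟨fun X Y => by ext y; simp [D.add_left], fun f X => by ext y; simp [D.smul_left]⟩
  have h1 := hΘ.covector_apply x X
  rw [h, map_sum] at h1
  simp only [map_smul, hΘ.covector_apply] at h1
  rw [map_sum]
  simp only [map_smul]
  exact h1.symm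

variable [SecondCountableTopology Q] (L : LieAlgebroid E F V)

section Path

variable {t₀ t₁ : ℝ} {q : ℝ → Q} {a : ∀ t, V (q t)}


lemma contMDiffOn_smul_section_path {q : ℝ → Q} {J : Set ℝ} {n : WithTop ℕ∞} (hn : n ≤ ∞)
    (hq : ContMDiffOn 𝓘(ℝ, ℝ) 𝓘(ℝ, E) n q J) {f : ℝ → ℝ} (hf : ContDiff ℝ n f)
    (e : Cₛ^∞⟮𝓘(ℝ, E); F, V⟯) :
    ContMDiffOn 𝓘(ℝ, ℝ) (𝓘(ℝ, E).prod 𝓘(ℝ, F)) n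
      (fun t => (⟨q t, f t • e (q t)⟩ : TotalSpace F V)) J := fun t htJ => by
  have := contMDiffWithinAt_sum_smul_section hn (hq t htJ) (Finset.univ : Finset Unit)
    (c := fun _ => f) (fun _ _ => hf.contMDiff.contMDiffAt.contMDiffWithinAt) (fun _ => e)
  simpa using this

lemma along_smul_section (ht : t₀ < t₁)
    (ha : L.IsAPath (Icc t₀ t₁) (fun t => (⟨q t, a t⟩ : TotalSpace F V))) (D : AConnection L F V) {f : ℝ → ℝ} (hf : ContDiff ℝ 1 f)
    (e : Cₛ^∞⟮𝓘(ℝ, E); F, V⟯) {t : ℝ} (htJ : t ∈ Icc t₀ t₁) {X : Cₛ^∞⟮𝓘(ℝ, E); F, V⟯}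
    (hX : X (q t) = a t) :
    D.along (Icc t₀ t₁) q a (fun t => f t • e (q t)) t =
      deriv f t • e (q t) + f t • D.toFun X e (q t) := by
  have h := along_sum_smul D ht ha (contMDiffOn_smul_section_path (by simp)
    (ha.1.2.of_le (by norm_num)) hf e) htJ hX (c := fun _ : Unit => f) (c' := fun _ => deriv f t)
    (fun _ => e) (fun _ => (hf.differentiable (by simp) t).hasDerivAt.hasDerivWithinAt)
    (fun τ _ => by simp)
  simpa using h

/-- Every section of a Lie algebroid gives, multiplied by a bump function, an admissible variation
that is realized by a homotopy. -/
theorem LieAlgebroid.exists_local_homotopy (cov : CovariantDerivative 𝓘(ℝ, E) F V)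
    [CovariantDerivative.ContMDiffCovariantDerivative cov ∞] (ht : t₀ < t₁)
    (ha : L.IsAPath (Icc t₀ t₁) (fun t => (⟨q t, a t⟩ : TotalSpace F V)))
    (e : Cₛ^∞⟮𝓘(ℝ, E); F, V⟯) {t' : ℝ} (ht' : t' ∈ Ioo t₀ t₁) :
    ∃ η > 0, Metric.ball t' η ⊆ Ioo t₀ t₁ ∧
      ∀ f : ℝ → ℝ, ContDiff ℝ ∞ f → tsupport f ⊆ Metric.ball t' η →
      ∃ δ > 0, ∃ Γ : ℝ → ℝ → TotalSpace F V,
        L.IsAHomotopy (Icc t₀ t₁) (fun t => ⟨q t, a t⟩) δ Γ ∧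
        ∀ t ∈ Icc t₀ t₁,
          (mfderiv 𝓘(ℝ, ℝ) (𝓘(ℝ, E).prod 𝓘(ℝ, F)) (fun ε => Γ ε t) 0 (1 : ℝ) : E × F) =
            admissibleTangent L cov t₀ t₁ q a (fun t => f t • e (q t)) t := by
  classical
  obtain ⟨n, s, M, η, hη, hB, hM, hfam⟩ := L.exists_local_family ha e ht'
  refine ⟨η, hη, hB, fun f hf hfs => ?_⟩
  obtain ⟨δ, hδ, b, Y, hb, hY, hstart, hbd, hvel⟩ := hfam f hf hfs
  set B := Metric.ball t' η
  have hBo : IsOpen B := Metric.isOpen_ball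
  have hq1 : ContMDiffOn 𝓘(ℝ, ℝ) 𝓘(ℝ, E) 1 q (Icc t₀ t₁) := ha.1.2.of_le (by norm_num)
  -- The index `none` carries the correction `ε f' e`, the indices `some j` the transported frame
  -- coefficients. The whole family is thus one combination of global sections.
  let S : Option (Fin n) → Cₛ^∞⟮𝓘(ℝ, E); F, V⟯ := fun o => o.elim e s
  let C : Option (Fin n) → ℝ → ℝ → ℝ := fun o ε t => o.elim (ε * deriv f t) fun j => Y j ε t
  let G : ℝ → ℝ → TotalSpace F V := fun ε t => ⟨b ε t, ∑ o, C o ε t • S o (b ε t)⟩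
  -- Within the ball but off `tsupport f` the deformed path equals the original one, so the two
  -- definitions agree on an open overlap and the glued family remains `C¹`.
  let Γ : ℝ → ℝ → TotalSpace F V := fun ε t => if t ∈ B then G ε t else ⟨q t, a t⟩
  have hΓB : ∀ ε, ∀ t ∈ B, Γ ε t = G ε t := fun ε t ht => if_pos ht
  have hf0 : ∀ t ∉ tsupport f, f t = 0 ∧ deriv f t = 0 := fun t ht => by
    have h : f =ᶠ[𝓝 t] fun _ => 0 := notMem_tsupport_iff_eventuallyEq.1 ht
    exact ⟨h.self_of_nhds, by rw [h.deriv_eq]; simp⟩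
  have hG0 : ∀ ε, ∀ t ∈ B, ε = 0 ∨ t ∉ tsupport f → G ε t = ⟨q t, a t⟩ := by
    intro ε t ht h
    have h1 := hstart t ht ε (h.imp_right fun h => (hf0 t h).1)
    have h2 : ε * deriv f t = 0 := by
      rcases h with h | h
      · rw [h, zero_mul]
      · rw [(hf0 t h).2, mul_zero]
    have h3 : ∀ x, x = q t → (⟨x, ∑ o, C o ε t • S o x⟩ : TotalSpace F V) = ⟨q t, a t⟩ := by
      rintro x rfl
      congr 1
      rw [Fintype.sum_option, ← h1.2]
      simp [C, S, h2]
    exact h3 _ h1.1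
  have hΓ0 : ∀ ε, ∀ t ∉ tsupport f, Γ ε t = ⟨q t, a t⟩ := by
    intro ε t ht
    by_cases h : t ∈ B
    · rw [hΓB ε t h, hG0 ε t h (Or.inr ht)]
    · exact if_neg h
  have hGC : ∀ z ∈ Ioo (-δ) δ ×ˢ B, ContMDiffAt 𝓘(ℝ, ℝ × ℝ) (𝓘(ℝ, E).prod 𝓘(ℝ, F)) 1
      (fun z : ℝ × ℝ => G z.1 z.2) z := by
    intro z hz
    refine (contMDiffWithinAt_sum_smul_section (n := 1) (by simp) (hb z hz) Finset.univ
      (c := fun o z => C o z.1 z.2) (fun o _ => ?_) S).contMDiffAt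
      ((isOpen_Ioo.prod hBo).mem_nhds hz)
    rcases o with _ | j
    · have h2 : ContDiff ℝ 1 (deriv f) := by
        have : ContDiff ℝ (1 + 1) f := hf.of_le (by rw [one_add_one_eq_two]; exact ENat.LEInfty.out)
        exact (contDiff_succ_iff_deriv.1 this).2.2
      have h3 : ContDiff ℝ 1 (fun z : ℝ × ℝ => z.1 * deriv f z.2) :=
        contDiff_fst.mul (h2.comp contDiff_snd)
      exact h3.contMDiff.contMDiffAt.contMDiffWithinAt
    · exact contMDiffOn_iff_contDiffOn.2 (hY j) z hz
  have hΓC : ContMDiffOn 𝓘(ℝ, ℝ × ℝ) (𝓘(ℝ, E).prod 𝓘(ℝ, F)) 1 (fun z : ℝ × ℝ => Γ z.1 z.2)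
      (Ioo (-δ) δ ×ˢ Icc t₀ t₁) := by
    intro z hz
    by_cases h : z.2 ∈ tsupport f
    · refine ((hGC z ⟨hz.1, hfs h⟩).congr_of_eventuallyEq ?_).contMDiffWithinAt
      filter_upwards [(isOpen_Ioo.prod hBo).mem_nhds ⟨hz.1, hfs h⟩] with w hw
      exact hΓB _ _ hw.2
    · have h1 : ContMDiffWithinAt 𝓘(ℝ, ℝ × ℝ) (𝓘(ℝ, E).prod 𝓘(ℝ, F)) 1
          (fun z : ℝ × ℝ => (⟨q z.2, a z.2⟩ : TotalSpace F V)) (Ioo (-δ) δ ×ˢ Icc t₀ t₁) z :=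
        (ha.1.1 z.2 hz.2).comp (g := fun t => (⟨q t, a t⟩ : TotalSpace F V)) (f := Prod.snd) z
          (contDiff_snd.contMDiff.contMDiffAt.contMDiffWithinAt) fun w hw => hw.2
      refine h1.congr_of_eventuallyEq ?_ (hΓ0 _ _ h)
      refine mem_nhdsWithin_of_mem_nhds ?_
      have h2 : ∀ᶠ w : ℝ × ℝ in 𝓝 z, w.2 ∉ tsupport f :=
        continuousAt_snd.eventually ((isClosed_tsupport f).isOpen_compl.mem_nhds h)
      filter_upwards [h2] with w hw
      exact hΓ0 _ _ hw
  refine ⟨δ, hδ, Γ, ⟨hΓC, fun ε hε => ?_, fun t _ => ?_⟩, fun t htJ => ?_⟩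
  -- The flow is only known to be `C¹`; the `C²` base path required of an `A`-path comes from the
  -- anchor equation.
  · refine L.isAPath_of_contMDiffOn ht ?_ fun t htJ => ?_
    · exact hΓC.comp (f := fun t => (ε, t))
        (contDiff_const.prodMk contDiff_id).contMDiff.contMDiffOn fun t htJ => ⟨hε, htJ⟩
    · let ρ : TotalSpace F V → E := fun z => L.anchor z.1 z.2
      by_cases h : t ∈ tsupport f
      · have h1 : (fun τ => (Γ ε τ).1) =ᶠ[𝓝 t] b ε := by
          filter_upwards [hBo.mem_nhds (hfs h)] with τ hτ
          rw [hΓB ε τ hτ]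
        have h2 : ρ (Γ ε t) = ρ (G ε t) := by rw [hΓB ε t (hfs h)]
        refine Eq.trans ?_ h2.symm
        refine (congrArg (fun l : ℝ →L[ℝ] E => l 1)
          ((h1.filter_mono nhdsWithin_le_nhds).mfderivWithin_eq h1.self_of_nhds)).trans ?_
        refine (hbd ε hε t (hfs h)).trans (congrArg (L.anchor (b ε t)) ?_)
        refine Eq.trans ?_ (Fintype.sum_option fun o => C o ε t • S o (b ε t)).symm
        exact add_comm _ _
      · have h1 : (fun τ => (Γ ε τ).1) =ᶠ[𝓝 t] q := by
          filter_upwards [(isClosed_tsupport f).isOpen_compl.mem_nhds h] with τ hτ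
          rw [hΓ0 ε τ hτ]
        have h2 : ρ (Γ ε t) = ρ ⟨q t, a t⟩ := by rw [hΓ0 ε t h]
        refine Eq.trans ?_ h2.symm
        refine (congrArg (fun l : ℝ →L[ℝ] E => l 1)
          ((h1.filter_mono nhdsWithin_le_nhds).mfderivWithin_eq h1.self_of_nhds)).trans ?_
        exact ha.2 t htJ
  · by_cases h : t ∈ B
    · rw [hΓB 0 t h, hG0 0 t h (Or.inl rfl)]
    · exact if_neg h
  · obtain ⟨X, hX⟩ := exists_section_apply_eq (E := E) (F := F) (q t) (a t)
    have halong := along_smul_section L ht ha (AConnection.bar L cov)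
      (hf.of_le (by simp)) e htJ hX
    by_cases h : t ∈ B
    · have h0 : (0 : ℝ) ∈ Ioo (-δ) δ := ⟨by linarith, hδ⟩
      let C' : Option (Fin n) → ℝ := fun o =>
        o.elim (deriv f t) fun j => f t * -∑ k, M j k (q t) * Y k 0 t
      have hC' : ∀ o, HasDerivAt (fun ε => C o ε t) (C' o) 0 := by
        rintro (_ | j)
        · exact ((hasDerivAt_id (0 : ℝ)).mul_const (deriv f t)).congr_deriv (one_mul _)
        · exact (hvel t h).2 j
      -- The base point `b 0 t` is only propositionally equal to `q t`. The velocity is therefore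
      -- written as a function of the point of the total space, with values in the fixed space `E ×
      -- F`, and transported along `G 0 t = ⟨q t, a t⟩`.
      let Ψ : TotalSpace F V → E × F := fun z =>
        (fun a b : E × F => a + b) (vertLift (E := E) z (∑ o, (C' o • S o z.1 +
          C o 0 t • cov (S o) z.1 (L.anchor z.1 (f t • e z.1)))))
          (horLift cov z (L.anchor z.1 (f t • e z.1)))
      have hcurve : ContMDiff 𝓘(ℝ, ℝ) 𝓘(ℝ, ℝ × ℝ) 1 (fun ε : ℝ => (ε, t)) :=
        (contDiff_id.prodMk contDiff_const).contMDiff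
      have hbm : MDifferentiableAt 𝓘(ℝ, ℝ) 𝓘(ℝ, E) (fun ε => b ε t) 0 :=
        (((hb.contMDiffAt ((isOpen_Ioo.prod hBo).mem_nhds (x := (0, t)) ⟨h0, h⟩)).comp (0 : ℝ)
          (f := fun ε : ℝ => (ε, t)) (hcurve 0))).mdifferentiableAt (by simp)
      have hGm : MDifferentiableAt 𝓘(ℝ, ℝ) (𝓘(ℝ, E).prod 𝓘(ℝ, F)) (fun ε => G ε t) 0 :=
        ((hGC (0, t) ⟨h0, h⟩).comp (0 : ℝ) (f := fun ε : ℝ => (ε, t)) (hcurve 0)).mdifferentiableAt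
          (by simp)
      have h1 := mfderiv_sum_smul_section cov Finset.univ hbm (c := fun o ε => C o ε t)
        (fun o _ => (hC' o).differentiableAt.mdifferentiableAt) S hGm (1 : ℝ)
      have h2 : (mfderiv 𝓘(ℝ, ℝ) (𝓘(ℝ, E).prod 𝓘(ℝ, F)) (fun ε => G ε t) 0 (1 : ℝ) : E × F) =
          Ψ (G 0 t) := by
        refine h1.trans ?_
        simp only [fun o => mvfderiv_one_of_hasDerivAt (hC' o), (hvel t h).1]
        rfl
      have h3 : (fun ε => Γ ε t) = fun ε => G ε t := funext fun ε => hΓB ε t h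
      refine (congrArg (fun c : ℝ → TotalSpace F V =>
        (mfderiv 𝓘(ℝ, ℝ) (𝓘(ℝ, E).prod 𝓘(ℝ, F)) c 0 (1 : ℝ) : E × F)) h3).trans
        (h2.trans ((congrArg Ψ (hG0 0 t h (Or.inl rfl))).trans ?_))
      refine congrArg₂ (fun a b : E × F => a + b) (congrArg (fun w : V (q t) =>
        (vertLift (E := E) (⟨q t, a t⟩ : TotalSpace F V) w : E × F)) ?_) rfl
      -- The vertical part obtained is `f' e - f ∑ M_jk Y_k s_j + f ∑ Y_j ∇_{ρ(e)} s_j`. Expanding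
      -- `∇̄_a e` over `a = ∑ Y_j s_j`, with `∇̄_{s_j} e = ∇_{ρ(e)} s_j - [e, s_j]`, identifies it
      -- with `f' e + f ∇̄_a e`.
      have hat : X (q t) = ∑ j, Y j 0 t • s j (q t) := hX.trans (hstart t h 0 (Or.inl rfl)).2.symm
      rw [halong, (AConnection.bar L cov).toFun_apply_sum hat e, Fintype.sum_option]
      simp only [C, C', S, Option.elim, AConnection.bar_apply, zero_mul, zero_smul, add_zero,
        map_smul]
      congr 1
      rw [Finset.smul_sum]
      simp only [L.bracket_skew (s _) e, ContMDiffSection.coe_neg, Pi.neg_apply, hM t h, smul_add,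
        Finset.sum_add_distrib, smul_neg, Finset.smul_sum, Finset.sum_neg_distrib, mul_neg, neg_smul,
        Finset.mul_sum, Finset.sum_smul, smul_smul]
      rw [add_comm]
      congr 1
      · exact Finset.sum_congr rfl fun i _ => by rw [mul_comm]
      · rw [Finset.sum_comm]
        simp only [mul_comm]
    · have h3 : (fun ε => Γ ε t) = fun _ => ⟨q t, a t⟩ := funext fun ε => if_neg h
      have h4 := hf0 t fun h' => h (hfs h')
      refine (congrArg (fun c : ℝ → TotalSpace F V =>
        (mfderiv 𝓘(ℝ, ℝ) (𝓘(ℝ, E).prod 𝓘(ℝ, F)) c 0 (1 : ℝ) : E × F)) h3).trans ?_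
      rw [mfderiv_const, admissibleTangent, halong, h4.1, h4.2]
      simp only [zero_smul, add_zero, map_zero]
      rfl

end Path

end Variations

/-! ### Homotopies of `(A ⊕ A*)`-paths -/

section SumBundle

variable {E : Type*} [NormedAddCommGroup E] [NormedSpace ℝ E]
  {Q : Type*} [TopologicalSpace Q] [ChartedSpace E Q]
  {F : Type*} [NormedAddCommGroup F] [NormedSpace ℝ F]
  {V : Q → Type*} [TopologicalSpace (TotalSpace F V)]
  [∀ x, AddCommGroup (V x)] [∀ x, Module ℝ (V x)] [∀ x, TopologicalSpace (V x)]
  [FiberBundle F V] [VectorBundle ℝ F V]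
  [∀ x, IsTopologicalAddGroup (V x)] [∀ x, ContinuousSMul ℝ (V x)]
  [IsManifold 𝓘(ℝ, E) ∞ Q] [ContMDiffVectorBundle ∞ F V 𝓘(ℝ, E)]
  {EM : Type*} [NormedAddCommGroup EM] [NormedSpace ℝ EM]
  {HM : Type*} [TopologicalSpace HM] {IM : ModelWithCorners ℝ EM HM}
  {M : Type*} [TopologicalSpace M] [ChartedSpace HM M]

lemma mdifferentiableAt_slice {Γ : ℝ → ℝ → M} {δ : ℝ} {J : Set ℝ}
    (hΓ : ContMDiffOn 𝓘(ℝ, ℝ × ℝ) IM 1 (fun z : ℝ × ℝ => Γ z.1 z.2) (Ioo (-δ) δ ×ˢ J)) (hδ : 0 < δ)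
    {t : ℝ} (htJ : t ∈ J) : MDifferentiableAt 𝓘(ℝ, ℝ) IM (fun ε => Γ ε t) 0 := by
  have h0 : (0 : ℝ) ∈ Ioo (-δ) δ := ⟨by linarith, hδ⟩
  have h1 : ContMDiffOn 𝓘(ℝ, ℝ) IM 1 (fun ε => Γ ε t) (Ioo (-δ) δ) :=
    hΓ.comp (f := fun ε : ℝ => (ε, t)) (contDiff_id.prodMk contDiff_const).contMDiff.contMDiffOn
      fun ε hε => ⟨hε, htJ⟩
  exact (h1.contMDiffAt (Ioo_mem_nhds h0.1 h0.2)).mdifferentiableAt (by simp)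

/-- The trivialization of the direct sum is the product of the two trivializations; the condition on
the base map merely occurs twice on the right. -/
lemma contMDiffWithinAt_sumTotal_iff {n : WithTop ℕ∞} {f : M → SumTotal F V} {S : Set M} {m : M} :
    ContMDiffWithinAt IM (𝓘(ℝ, E).prod 𝓘(ℝ, F × (F →L[ℝ] ℝ))) n f S m ↔
      ContMDiffWithinAt IM (𝓘(ℝ, E).prod 𝓘(ℝ, F)) n (fun m => toA (f m)) S m ∧
      ContMDiffWithinAt IM (𝓘(ℝ, E).prod 𝓘(ℝ, F →L[ℝ] ℝ)) n (fun m => toDual (f m)) S m := by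
  rw [contMDiffWithinAt_totalSpace, contMDiffWithinAt_totalSpace, contMDiffWithinAt_totalSpace,
    and_and_and_comm]
  refine and_congr (and_self_iff (a := ContMDiffWithinAt IM 𝓘(ℝ, E) n
    (fun m => (f m).1) S m)).symm ?_
  exact contMDiffWithinAt_prod_module_iff _

lemma contMDiffOn_sumTotal_iff {n : WithTop ℕ∞} {f : M → SumTotal F V} {S : Set M} :
    ContMDiffOn IM (𝓘(ℝ, E).prod 𝓘(ℝ, F × (F →L[ℝ] ℝ))) n f S ↔
      ContMDiffOn IM (𝓘(ℝ, E).prod 𝓘(ℝ, F)) n (fun m => toA (f m)) S ∧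
      ContMDiffOn IM (𝓘(ℝ, E).prod 𝓘(ℝ, F →L[ℝ] ℝ)) n (fun m => toDual (f m)) S :=
  ⟨fun h => ⟨fun m hm => (contMDiffWithinAt_sumTotal_iff.1 (h m hm)).1,
    fun m hm => (contMDiffWithinAt_sumTotal_iff.1 (h m hm)).2⟩,
    fun h m hm => contMDiffWithinAt_sumTotal_iff.2 ⟨h.1 m hm, h.2 m hm⟩⟩

lemma isBundlePath_sumTotal_iff {J : Set ℝ} {γ : ℝ → SumTotal F V} :
    IsBundlePath E J γ ↔ IsBundlePath E J (fun t => toA (γ t)) ∧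
      ContMDiffOn 𝓘(ℝ, ℝ) (𝓘(ℝ, E).prod 𝓘(ℝ, F →L[ℝ] ℝ)) 1 (fun t => toDual (γ t)) J := by
  unfold IsBundlePath
  rw [contMDiffOn_sumTotal_iff]
  constructor
  · exact fun h => ⟨⟨h.1.1, h.2⟩, h.1.2⟩
  · exact fun h => ⟨⟨h.1.1, h.2⟩, h.1.2⟩

variable (L : LieAlgebroid E F V) (cov : CovariantDerivative 𝓘(ℝ, E) F V)
  [CovariantDerivative.ContMDiffCovariantDerivative cov ∞]

lemma LieAlgebroid.isSumPath_iff {J : Set ℝ} {γ : ℝ → SumTotal F V} :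
    L.IsSumPath J γ ↔ L.IsAPath J (fun t => toA (γ t)) ∧
      ContMDiffOn 𝓘(ℝ, ℝ) (𝓘(ℝ, E).prod 𝓘(ℝ, F →L[ℝ] ℝ)) 1 (fun t => toDual (γ t)) J := by
  unfold LieAlgebroid.IsSumPath
  rw [isBundlePath_sumTotal_iff]
  exact ⟨fun h => ⟨h.2, h.1.2⟩, fun h => ⟨⟨h.1.1, h.2⟩, h.1⟩⟩

/-- The `A`-connection `∇_{ρ(X)} s` induced by a `TQ`-connection. -/
def AConnection.ofCov : AConnection L F V where
  toFun X s := anchorCov L cov s X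
  add_left X Y s := ContMDiffSection.ext fun x => by simp [anchorCov_apply]
  smul_left f X s := ContMDiffSection.ext fun x => by simp [anchorCov_apply]
  add_right X s s' := ContMDiffSection.ext fun x => by
    have h : cov (⇑s + ⇑s') x = cov s x + cov s' x := cov.isCovariantDerivativeOnUniv.add
      (s.mdifferentiableAt (x := x)) (s'.mdifferentiableAt)
    simp [anchorCov_apply, h]
  leibniz X f s := ContMDiffSection.ext fun x => by
    have h : cov ((f : Q → ℝ) • ⇑s) x = f x • cov s x + (mvfderiv 𝓘(ℝ, E) f x).smulRight (s x) :=
      cov.isCovariantDerivativeOnUniv.leibniz (s.mdifferentiableAt (x := x))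
        (f.contMDiff.mdifferentiable (by simp) x)
    have h' : (⇑(f • s) : ∀ x, V x) = (f : Q → ℝ) • ⇑s := rfl
    simp only [anchorCov_apply, ContMDiffSection.coe_add, Pi.add_apply, h', h, fsmul_apply,
      add_apply, smul_apply, ContinuousLinearMap.smulRight_apply, LieAlgebroid.anchorDeriv_apply]
    module

variable [FiniteDimensional ℝ E] [FiniteDimensional ℝ F] [T2Space Q]

/-- `dualCov` is defined pointwise, whereas the dual of an `A`-connection maps smooth sections to
smooth sections. This identity exhibits `∇*_{ρ(X)} σ` as a smooth section. -/
lemma AConnection.ofCov_dual_apply (X : Cₛ^∞⟮𝓘(ℝ, E); F, V⟯)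
    (σ : Cₛ^∞⟮𝓘(ℝ, E); F →L[ℝ] ℝ, DualFiber V⟯) (x : Q) :
    (AConnection.ofCov L cov).dual.toFun X σ x = dualCov cov σ x (L.anchor x (X x)) := by
  refine AConnection.dual_ext (E := E) (K := F) x fun s => ?_
  rw [dualCov_apply cov σ.mdifferentiableAt s.mdifferentiableAt]
  exact AConnection.dual_apply_apply _ X σ s x

variable [SecondCountableTopology Q] {t₀ t₁ : ℝ} {q : ℝ → Q} {a : ∀ t, V (q t)}
  {p : ∀ t, DualFiber V (q t)}

lemma AConnection.along_zero {K : Type*} [NormedAddCommGroup K] [NormedSpace ℝ K]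
    {W : Q → Type*} [TopologicalSpace (TotalSpace K W)]
    [∀ x, AddCommGroup (W x)] [∀ x, Module ℝ (W x)] [∀ x, TopologicalSpace (W x)]
    [FiberBundle K W] [VectorBundle ℝ K W]
    [∀ x, IsTopologicalAddGroup (W x)] [∀ x, ContinuousSMul ℝ (W x)]
    [ContMDiffVectorBundle ∞ K W 𝓘(ℝ, E)] [FiniteDimensional ℝ K] {L : LieAlgebroid E F V}
    (D : AConnection L K W) (ht : t₀ < t₁)
    (ha : L.IsAPath (Icc t₀ t₁) (fun t => (⟨q t, a t⟩ : TotalSpace F V))) {t : ℝ}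
    (htJ : t ∈ Icc t₀ t₁) : D.along (Icc t₀ t₁) q a (fun _ => 0) t = 0 := by
  obtain ⟨X, hX⟩ := exists_section_apply_eq (E := E) (F := F) (q t) (a t)
  have hu : ContMDiffOn 𝓘(ℝ, ℝ) (𝓘(ℝ, E).prod 𝓘(ℝ, K)) 1 (fun t => (⟨q t, 0⟩ : TotalSpace K W))
      (Icc t₀ t₁) := fun τ hτ => by
    simpa using contMDiffWithinAt_sum_smul_section (K := K) (W := W) (by simp)
      (ha.1.2.of_le (by norm_num : (1 : WithTop ℕ∞) ≤ 2) τ hτ) (∅ : Finset Unit)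
      (c := fun _ _ => 0) (by simp) (fun _ => 0)
  have h := along_sum_smul D ht ha hu htJ hX (ι := Empty) (c := fun _ _ => 0) (c' := fun _ => 0)
    (fun _ => 0) (fun i => i.elim) (by simp)
  simpa using h

lemma admissibleTangent_zero (ht : t₀ < t₁)
    (ha : L.IsAPath (Icc t₀ t₁) (fun t => (⟨q t, a t⟩ : TotalSpace F V))) {t : ℝ}
    (htJ : t ∈ Icc t₀ t₁) :
    (admissibleTangent L cov t₀ t₁ q a (fun _ => 0) t : E × F) = 0 := by
  refine (congrArg₂ (fun u v : E × F => u + v)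
    ((congrArg (vertLift (E := E) (⟨q t, a t⟩ : TotalSpace F V))
      (AConnection.along_zero _ ht ha htJ)).trans (ContinuousLinearMap.map_zero _))
    ((congrArg (horLift cov (⟨q t, a t⟩ : TotalSpace F V))
      (ContinuousLinearMap.map_zero (L.anchor (q t)))).trans
      (ContinuousLinearMap.map_zero _))).trans ?_
  exact add_zero (0 : E × F)

lemma admissibleTangentDual_zero (r : ∀ t, DualFiber V (q t)) (t : ℝ) :
    (admissibleTangentDual L cov q p (fun _ => 0) r t : E × (F →L[ℝ] ℝ)) =
      vertLift (E := E) (⟨q t, p t⟩ : TotalSpace (F →L[ℝ] ℝ) (DualFiber V)) (r t) := by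
  refine (congrArg (fun v : E × (F →L[ℝ] ℝ) => (fun a b : E × (F →L[ℝ] ℝ) => a + b)
    (vertLift (E := E) (⟨q t, p t⟩ : TotalSpace (F →L[ℝ] ℝ) (DualFiber V)) (r t)) v)
    ((congrArg (horLift (dualCov cov) (⟨q t, p t⟩ : TotalSpace (F →L[ℝ] ℝ) (DualFiber V)))
      (ContinuousLinearMap.map_zero (L.anchor (q t)))).trans
      (ContinuousLinearMap.map_zero _))).trans ?_
  exact add_zero (M := E × (F →L[ℝ] ℝ)) _

/-- It serves both for the homotopy `p + ε r` and for the continuity of fibre derivatives along a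
path. -/
lemma contMDiffOn_add_smul_path {K : Type*} [NormedAddCommGroup K] [NormedSpace ℝ K]
    {W : Q → Type*} [TopologicalSpace (TotalSpace K W)]
    [∀ x, AddCommGroup (W x)] [∀ x, Module ℝ (W x)] [∀ x, TopologicalSpace (W x)]
    [FiberBundle K W] [VectorBundle ℝ K W]
    [∀ x, IsTopologicalAddGroup (W x)] [∀ x, ContinuousSMul ℝ (W x)]
    [ContMDiffVectorBundle ∞ K W 𝓘(ℝ, E)] [FiniteDimensional ℝ K] (ht : t₀ < t₁)
    {u w : ∀ t, W (q t)} {S : Set ℝ}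
    (hu : ContMDiffOn 𝓘(ℝ, ℝ) (𝓘(ℝ, E).prod 𝓘(ℝ, K)) 1
      (fun t => (⟨q t, u t⟩ : TotalSpace K W)) (Icc t₀ t₁))
    (hw : ContMDiffOn 𝓘(ℝ, ℝ) (𝓘(ℝ, E).prod 𝓘(ℝ, K)) 1
      (fun t => (⟨q t, w t⟩ : TotalSpace K W)) (Icc t₀ t₁)) :
    ContMDiffOn 𝓘(ℝ, ℝ × ℝ) (𝓘(ℝ, E).prod 𝓘(ℝ, K)) 1
      (fun z : ℝ × ℝ => (⟨q z.2, u z.2 + z.1 • w z.2⟩ : TotalSpace K W)) (S ×ˢ Icc t₀ t₁) := by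
  obtain ⟨N, σ, c, hc, hpc⟩ := exists_path_eq_sum ht hu
  obtain ⟨N', σ', c', hc', hrc⟩ := exists_path_eq_sum ht hw
  have hq : ContMDiffOn 𝓘(ℝ, ℝ) 𝓘(ℝ, E) 1 q (Icc t₀ t₁) :=
    (contMDiff_proj W (IB := 𝓘(ℝ, E)) (n := 1) (F := K)).comp_contMDiffOn hu
  intro z hz
  have h1 := contMDiffWithinAt_sum_smul_section (IM := 𝓘(ℝ, ℝ × ℝ)) (n := 1)
    (S := S ×ˢ Icc t₀ t₁) (by simp)
    ((hq z.2 hz.2).comp (f := Prod.snd) z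
        (contDiff_snd.contMDiff.contMDiffAt.contMDiffWithinAt) fun w hw => hw.2)
    (Finset.univ : Finset (Fin N ⊕ Fin N'))
    (c := fun i z => i.elim (fun i => c i z.2) fun i => z.1 * c' i z.2) (fun i _ => ?_)
    (fun i => i.elim σ σ')
  · refine h1.congr_of_mem (fun w hw => ?_) hz
    refine congrArg (TotalSpace.mk' K (E := W) (q w.2)) ?_
    refine Eq.trans ?_ (Fintype.sum_sum_type _).symm
    rw [hpc w.2 hw.2, hrc w.2 hw.2, Finset.smul_sum]
    simp only [smul_smul]
    rfl
  · rcases i with i | i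
    · exact ((hc i).comp contDiff_snd).contMDiff.contMDiffAt.contMDiffWithinAt
    · exact (contDiff_fst.mul ((hc' i).comp contDiff_snd)).contMDiff.contMDiffAt.contMDiffWithinAt

/-- Varying only the component in `A*` of an `(A ⊕ A*)`-path. -/
lemma LieAlgebroid.exists_vertical_homotopy (ht : t₀ < t₁)
    (hap : L.IsSumPath (Icc t₀ t₁) (sumPath q a p)) {r : ∀ t, DualFiber V (q t)}
    (hr : ContMDiffOn 𝓘(ℝ, ℝ) (𝓘(ℝ, E).prod 𝓘(ℝ, F →L[ℝ] ℝ)) 1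
      (fun t => (⟨q t, r t⟩ : TotalSpace (F →L[ℝ] ℝ) (DualFiber V))) (Icc t₀ t₁)) :
    ∃ Γ : ℝ → ℝ → SumTotal F V, L.IsSumHomotopy (Icc t₀ t₁) (sumPath q a p) 1 Γ ∧
      (∀ t ∈ Icc t₀ t₁,
        (mfderiv 𝓘(ℝ, ℝ) (𝓘(ℝ, E).prod 𝓘(ℝ, F)) (fun ε => toA (Γ ε t)) 0 (1 : ℝ) : E × F) =
          admissibleTangent L cov t₀ t₁ q a (fun _ => 0) t) ∧
      (∀ t ∈ Icc t₀ t₁,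
        (mfderiv 𝓘(ℝ, ℝ) (𝓘(ℝ, E).prod 𝓘(ℝ, F →L[ℝ] ℝ)) (fun ε => toDual (Γ ε t)) 0 (1 : ℝ) :
            E × (F →L[ℝ] ℝ)) =
          admissibleTangentDual L cov q p (fun _ => 0) r t) := by
  have ha : L.IsAPath (Icc t₀ t₁) (fun t => (⟨q t, a t⟩ : TotalSpace F V)) := hap.2
  have hp : ContMDiffOn 𝓘(ℝ, ℝ) (𝓘(ℝ, E).prod 𝓘(ℝ, F →L[ℝ] ℝ)) 1
      (fun t => (⟨q t, p t⟩ : TotalSpace (F →L[ℝ] ℝ) (DualFiber V))) (Icc t₀ t₁) :=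
    (L.isSumPath_iff.1 hap).2
  have hD : ContMDiffOn 𝓘(ℝ, ℝ × ℝ) (𝓘(ℝ, E).prod 𝓘(ℝ, F →L[ℝ] ℝ)) 1
      (fun z : ℝ × ℝ => (⟨q z.2, p z.2 + z.1 • r z.2⟩ : TotalSpace (F →L[ℝ] ℝ) (DualFiber V)))
      (Ioo (-1) 1 ×ˢ Icc t₀ t₁) := contMDiffOn_add_smul_path ht hp hr
  have hA : ContMDiffOn 𝓘(ℝ, ℝ × ℝ) (𝓘(ℝ, E).prod 𝓘(ℝ, F)) 1
      (fun z : ℝ × ℝ => (⟨q z.2, a z.2⟩ : TotalSpace F V)) (Ioo (-1) 1 ×ˢ Icc t₀ t₁) := fun z hz =>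
    (ha.1.1 z.2 hz.2).comp (g := fun t => (⟨q t, a t⟩ : TotalSpace F V)) (f := Prod.snd) z
      (contDiff_snd.contMDiff.contMDiffAt.contMDiffWithinAt) fun w hw => hw.2
  refine ⟨fun ε t => ⟨q t, (a t, p t + ε • r t)⟩,
    ⟨contMDiffOn_sumTotal_iff.2 ⟨hA, hD⟩, fun ε hε => L.isSumPath_iff.2 ⟨ha, ?_⟩, fun t _ => ?_⟩,
    fun t htJ => ?_, fun t htJ => ?_⟩
  · exact hD.comp (f := fun t => (ε, t))
      (contDiff_const.prodMk contDiff_id).contMDiff.contMDiffOn fun t htJ => ⟨hε, htJ⟩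
  · simp [sumPath]
  · change (mfderiv 𝓘(ℝ, ℝ) (𝓘(ℝ, E).prod 𝓘(ℝ, F))
      (fun _ : ℝ => (⟨q t, a t⟩ : TotalSpace F V)) 0 (1 : ℝ) : E × F) = _
    rw [mfderiv_const]
    exact (admissibleTangent_zero L cov ht ha htJ).symm
  · exact (admissibleTangentDual_zero L cov r t).symm

/-- A homotopy of `A`-paths that realizes the admissible variation given by `f • (e ∘ q)` lifts to
a homotopy of `(A ⊕ A*)`-paths. -/
lemma LieAlgebroid.exists_lift_homotopy (ht : t₀ < t₁)
    (hap : L.IsSumPath (Icc t₀ t₁) (sumPath q a p)) {f : ℝ → ℝ} (hf : ContDiff ℝ 1 f)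
    (e : Cₛ^∞⟮𝓘(ℝ, E); F, V⟯) {δ : ℝ} (hδ : 0 < δ) {Γ : ℝ → ℝ → TotalSpace F V}
    (hΓ : L.IsAHomotopy (Icc t₀ t₁) (fun t => ⟨q t, a t⟩) δ Γ)
    (hΓ' : ∀ t ∈ Icc t₀ t₁,
      (mfderiv 𝓘(ℝ, ℝ) (𝓘(ℝ, E).prod 𝓘(ℝ, F)) (fun ε => Γ ε t) 0 (1 : ℝ) : E × F) =
        admissibleTangent L cov t₀ t₁ q a (fun t => f t • e (q t)) t) :
    ∃ r : ∀ t, DualFiber V (q t),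
      IsBundlePath E (Icc t₀ t₁) (sumPath (F := F) q (fun t => f t • e (q t)) r) ∧
      ∃ Γ' : ℝ → ℝ → SumTotal F V, L.IsSumHomotopy (Icc t₀ t₁) (sumPath q a p) δ Γ' ∧
      (∀ ε t, toA (Γ' ε t) = Γ ε t) ∧
      (∀ t ∈ Icc t₀ t₁,
        (mfderiv 𝓘(ℝ, ℝ) (𝓘(ℝ, E).prod 𝓘(ℝ, F →L[ℝ] ℝ)) (fun ε => toDual (Γ' ε t)) 0 (1 : ℝ) :
            E × (F →L[ℝ] ℝ)) =
          admissibleTangentDual L cov q p (fun t => f t • e (q t)) r t) := by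
  have ha : L.IsAPath (Icc t₀ t₁) (fun t => (⟨q t, a t⟩ : TotalSpace F V)) := hap.2
  have hp : ContMDiffOn 𝓘(ℝ, ℝ) (𝓘(ℝ, E).prod 𝓘(ℝ, F →L[ℝ] ℝ)) 1
      (fun t => (⟨q t, p t⟩ : TotalSpace (F →L[ℝ] ℝ) (DualFiber V))) (Icc t₀ t₁) :=
    (L.isSumPath_iff.1 hap).2
  have hq1 : ContMDiffOn 𝓘(ℝ, ℝ) 𝓘(ℝ, E) 1 q (Icc t₀ t₁) := ha.1.2.of_le (by norm_num)
  obtain ⟨N, σ, c, hc, hpc⟩ := exists_path_eq_sum ht hp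
  have hb : ContMDiffOn 𝓘(ℝ, ℝ × ℝ) 𝓘(ℝ, E) 1 (fun z : ℝ × ℝ => (Γ z.1 z.2).1)
      (Ioo (-δ) δ ×ˢ Icc t₀ t₁) :=
    (contMDiff_proj V (IB := 𝓘(ℝ, E)) (n := 1) (F := F)).comp_contMDiffOn hΓ.1
  -- With `p = ∑ c_j σ_j(q)`, the coefficients are kept and only the base point moves with `Γ`. The
  -- vertical part of the velocity is then `r = f ∑ c_j ∇*_{ρ(e)} σ_j`, a `C¹` path.
  let G : ℝ → ℝ → TotalSpace (F →L[ℝ] ℝ) (DualFiber V) := fun ε t =>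
    ⟨(Γ ε t).1, ∑ j, c j t • σ j (Γ ε t).1⟩
  have hG : ContMDiffOn 𝓘(ℝ, ℝ × ℝ) (𝓘(ℝ, E).prod 𝓘(ℝ, F →L[ℝ] ℝ)) 1
      (fun z : ℝ × ℝ => G z.1 z.2) (Ioo (-δ) δ ×ˢ Icc t₀ t₁) := fun z hz =>
    contMDiffWithinAt_sum_smul_section (n := 1) (by simp) (hb z hz) Finset.univ
      (c := fun j z => c j z.2)
      (fun j _ => ((hc j).comp contDiff_snd).contMDiff.contMDiffAt.contMDiffWithinAt) σ
  have hG0 : ∀ z : TotalSpace F V, ∀ t ∈ Icc t₀ t₁, z = ⟨q t, a t⟩ →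
      (⟨z.1, (z.2, ∑ j, c j t • σ j z.1)⟩ : SumTotal F V) = sumPath q a p t := by
    rintro _ t htJ rfl
    exact congrArg (fun w => (⟨q t, (a t, w)⟩ : SumTotal F V)) (hpc t htJ).symm
  refine ⟨fun t => f t • ∑ j, c j t • (AConnection.ofCov L cov).dual.toFun e (σ j) (q t),
    isBundlePath_sumTotal_iff.2 ⟨⟨contMDiffOn_smul_section_path (by simp) hq1 hf e, ha.1.2⟩, ?_⟩,
    fun ε t => ⟨(Γ ε t).1, ((Γ ε t).2, ∑ j, c j t • σ j (Γ ε t).1)⟩,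
    ⟨contMDiffOn_sumTotal_iff.2 ⟨hΓ.1, hG⟩,
      fun ε hε => L.isSumPath_iff.2 ⟨hΓ.2.1 ε hε, ?_⟩, fun t htJ => hG0 _ t htJ (hΓ.2.2 t htJ)⟩,
    fun ε t => rfl, fun t htJ => ?_⟩
  · intro t htJ
    refine (contMDiffWithinAt_sum_smul_section (n := 1) (by simp) (hq1 t htJ) Finset.univ
      (c := fun j t => f t * c j t)
      (fun j _ => (hf.mul (hc j)).contMDiff.contMDiffAt.contMDiffWithinAt)
      fun j => (AConnection.ofCov L cov).dual.toFun e (σ j)).congr_of_mem (fun w hw => ?_) htJ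
    refine congrArg (TotalSpace.mk' (F →L[ℝ] ℝ) (E := DualFiber V) (q w)) ?_
    refine Finset.smul_sum.trans ?_
    simp only [smul_smul]
  · exact hG.comp (f := fun t => (ε, t))
      (contDiff_const.prodMk contDiff_id).contMDiff.contMDiffOn fun t htJ => ⟨hε, htJ⟩
  · have hΓm : MDifferentiableAt 𝓘(ℝ, ℝ) (𝓘(ℝ, E).prod 𝓘(ℝ, F)) (fun ε => Γ ε t) 0 :=
      mdifferentiableAt_slice hΓ.1 hδ htJ
    have hGm : MDifferentiableAt 𝓘(ℝ, ℝ) (𝓘(ℝ, E).prod 𝓘(ℝ, F →L[ℝ] ℝ)) (fun ε => G ε t) 0 :=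
      mdifferentiableAt_slice hG hδ htJ
    let ρ : Q → E := fun x => L.anchor x (f t • e x)
    have hΓ0 : (Γ 0 t).1 = q t := congrArg TotalSpace.proj (hΓ.2.2 t htJ)
    have hv : (mfderiv 𝓘(ℝ, ℝ) 𝓘(ℝ, E) (fun ε => (Γ ε t).1) 0 (1 : ℝ) : E) = ρ (Γ 0 t).1 := by
      refine (mfderiv_map_fst hΓm (1 : ℝ)).symm.trans ?_
      refine ((congrArg Prod.fst (hΓ' t htJ)).trans (lift_fst cov _ _ _)).trans ?_
      exact (congrArg ρ hΓ0).symm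
    have h1 := mfderiv_sum_smul_section (dualCov cov) Finset.univ
      (b := fun ε => (Γ ε t).1)
      (mdifferentiableAt_slice (Γ := fun ε t => (Γ ε t).1) hb hδ htJ) (c := fun j _ => c j t)
      (fun j _ => mdifferentiableAt_const) σ hGm (1 : ℝ)
    let Ψ : TotalSpace (F →L[ℝ] ℝ) (DualFiber V) → E × (F →L[ℝ] ℝ) := fun z =>
      (fun a b : E × (F →L[ℝ] ℝ) => a + b) (vertLift (E := E) z (∑ j, ((0 : ℝ) • σ j z.1 +
        c j t • dualCov cov (σ j) z.1 (L.anchor z.1 (f t • e z.1)))))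
        (horLift (dualCov cov) z (L.anchor z.1 (f t • e z.1)))
    have h2 : (mfderiv 𝓘(ℝ, ℝ) (𝓘(ℝ, E).prod 𝓘(ℝ, F →L[ℝ] ℝ)) (fun ε => G ε t) 0 (1 : ℝ) :
        E × (F →L[ℝ] ℝ)) = Ψ (G 0 t) := by
      refine h1.trans ?_
      simp only [fun j => mvfderiv_one_of_hasDerivAt (hasDerivAt_const (0 : ℝ) (c j t)), hv]
      rfl
    have h3 : G 0 t = ⟨q t, p t⟩ := congrArg toDual (hG0 _ t htJ (hΓ.2.2 t htJ))
    refine h2.trans ((congrArg Ψ h3).trans ?_)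
    refine congrArg₂ (fun a b : E × (F →L[ℝ] ℝ) => a + b) (congrArg (fun w : DualFiber V (q t) =>
      (vertLift (E := E) (⟨q t, p t⟩ : TotalSpace (F →L[ℝ] ℝ) (DualFiber V)) w :
        E × (F →L[ℝ] ℝ))) ?_) rfl
    refine Eq.trans (Finset.sum_congr rfl fun j _ => ?_) Finset.smul_sum.symm
    rw [AConnection.ofCov_dual_apply, zero_smul, zero_add, map_smul, map_smul, smul_comm]

end SumBundle

/-! ### Continuity of differentials on the tangent bundle -/

section TangentContinuity

variable {EM : Type*} [NormedAddCommGroup EM] [NormedSpace ℝ EM]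
  {HM : Type*} [TopologicalSpace HM] {IM : ModelWithCorners ℝ EM HM}
  {M : Type*} [TopologicalSpace M] [ChartedSpace HM M] [IsManifold IM 1 M]

lemma continuous_mvfderiv {g : M → ℝ} (hg : ContMDiff IM 𝓘(ℝ, ℝ) ∞ g) :
    Continuous fun Z : TangentBundle IM M => mvfderiv IM g Z.1 Z.2 := by
  have h2 : ContMDiff IM.tangent 𝓘(ℝ, ℝ).tangent 0 (tangentMap IM 𝓘(ℝ, ℝ) g) :=
    (hg.of_le (by simp : (1 : WithTop ℕ∞) ≤ ∞)).contMDiff_tangentMap (by simp)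
  exact ((contMDiff_snd_tangentBundle_modelSpace ℝ 𝓘(ℝ, ℝ) (n := 0)).comp h2).continuous

end TangentContinuity

/-! ### Vertical and horizontal derivatives along curves -/

section FirstVariation

variable {E : Type*} [NormedAddCommGroup E] [NormedSpace ℝ E]
  {Q : Type*} [TopologicalSpace Q] [ChartedSpace E Q]
  {F : Type*} [NormedAddCommGroup F] [NormedSpace ℝ F]
  {V : Q → Type*} [TopologicalSpace (TotalSpace F V)]
  [∀ x, AddCommGroup (V x)] [∀ x, Module ℝ (V x)] [∀ x, TopologicalSpace (V x)]
  [FiberBundle F V] [VectorBundle ℝ F V]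
  {K : Type*} [NormedAddCommGroup K] [NormedSpace ℝ K]
  {W : Q → Type*} [TopologicalSpace (TotalSpace K W)]
  [∀ x, AddCommGroup (W x)] [∀ x, Module ℝ (W x)] [∀ x, TopologicalSpace (W x)]
  [FiberBundle K W] [VectorBundle ℝ K W]
  [∀ x, IsTopologicalAddGroup (V x)] [∀ x, ContinuousSMul ℝ (V x)]
  [∀ x, IsTopologicalAddGroup (W x)] [∀ x, ContinuousSMul ℝ (W x)]
  [IsManifold 𝓘(ℝ, E) ∞ Q] [ContMDiffVectorBundle ∞ F V 𝓘(ℝ, E)] [ContMDiffVectorBundle ∞ K W 𝓘(ℝ, E)]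
  [FiniteDimensional ℝ E] [FiniteDimensional ℝ F] [FiniteDimensional ℝ K] [T2Space Q]

lemma mvfderiv_vertLift_add_horLift (cov : CovariantDerivative 𝓘(ℝ, E) K W)
    (G : TotalSpace K W → ℝ) (z : TotalSpace K W) (w : W z.1) (v : TangentSpace 𝓘(ℝ, E) z.1)
    {u : E × K} (hu : u = (vertLift (E := E) z w + horLift cov z v : E × K)) :
    mvfderiv (𝓘(ℝ, E).prod 𝓘(ℝ, K)) G z u = verDeriv (E := E) G z w + horDeriv cov G z v := by
  rw [hu]
  exact map_add (mvfderiv (𝓘(ℝ, E).prod 𝓘(ℝ, K)) G z) _ _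

lemma hasDerivAt_comp_lift (cov : CovariantDerivative 𝓘(ℝ, E) K W) {G : TotalSpace K W → ℝ}
    {γ : ℝ → TotalSpace K W} {z : TotalSpace K W} (h0 : γ 0 = z)
    (hG : MDifferentiableAt (𝓘(ℝ, E).prod 𝓘(ℝ, K)) 𝓘(ℝ, ℝ) G z)
    (hγ : MDifferentiableAt 𝓘(ℝ, ℝ) (𝓘(ℝ, E).prod 𝓘(ℝ, K)) γ 0) {w : W z.1}
    {v : TangentSpace 𝓘(ℝ, E) z.1}
    (h : (mfderiv 𝓘(ℝ, ℝ) (𝓘(ℝ, E).prod 𝓘(ℝ, K)) γ 0 (1 : ℝ) : E × K) =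
      (vertLift (E := E) z w + horLift cov z v : E × K)) :
    HasDerivAt (fun ε => G (γ ε)) (verDeriv (E := E) G z w + horDeriv cov G z v) 0 := by
  subst h0
  exact (hasDerivAt_comp_curve hG hγ).congr_deriv (mvfderiv_vertLift_add_horLift cov G _ w v h)

lemma hasDerivAt_pairing_lift (cov : CovariantDerivative 𝓘(ℝ, E) F V)
    {γ : ℝ → SumTotal F V} {z : SumTotal F V} (h0 : γ 0 = z)
    (h1 : MDifferentiableAt 𝓘(ℝ, ℝ) (𝓘(ℝ, E).prod 𝓘(ℝ, F)) (fun ε => toA (γ ε)) 0)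
    (h2 : MDifferentiableAt 𝓘(ℝ, ℝ) (𝓘(ℝ, E).prod 𝓘(ℝ, F →L[ℝ] ℝ)) (fun ε => toDual (γ ε)) 0)
    {w : V z.1} {r : DualFiber V z.1} {v : TangentSpace 𝓘(ℝ, E) z.1}
    (h3 : (mfderiv 𝓘(ℝ, ℝ) (𝓘(ℝ, E).prod 𝓘(ℝ, F)) (fun ε => toA (γ ε)) 0 (1 : ℝ) : E × F) =
      (vertLift (E := E) (toA z) w + horLift cov (toA z) v : E × F))
    (h4 : (mfderiv 𝓘(ℝ, ℝ) (𝓘(ℝ, E).prod 𝓘(ℝ, F →L[ℝ] ℝ)) (fun ε => toDual (γ ε)) 0 (1 : ℝ) :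
        E × (F →L[ℝ] ℝ)) =
      (vertLift (E := E) (toDual z) r + horLift (dualCov cov) (toDual z) v : E × (F →L[ℝ] ℝ))) :
    HasDerivAt (fun ε => (γ ε).2.2 (γ ε).2.1) (r z.2.1 + z.2.2 w) 0 := by
  subst h0
  have h5 : MDifferentiableAt 𝓘(ℝ, ℝ) 𝓘(ℝ, ℝ) (fun ε => (γ ε).2.2 (γ ε).2.1) 0 :=
    ((mdifferentiableAt_totalSpace 𝓘(ℝ, E) _).1
      (MDifferentiableAt.clm_bundle_apply (F₂ := ℝ) (E₂ := fun _ : Q => ℝ)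
        (b := fun ε => (γ ε).1) (ϕ := fun ε => (γ ε).2.2) (v := fun ε => (γ ε).2.1) h2 h1)).2
  refine (MDifferentiableAt.hasDerivAt_mvfderiv h5).congr_deriv ?_
  exact mvfderiv_pairing cov (b := fun ε => (γ ε).1) (α := fun ε => (γ ε).2.1)
    (β := fun ε => (γ ε).2.2) h1 h2 h3 h4

variable [SecondCountableTopology Q] {t₀ t₁ : ℝ} {q : ℝ → Q} {L : LieAlgebroid E F V}
  {a : ∀ t, V (q t)}

/-- The value at `t` is the derivative at `ε = 0` of `G(u + ε w)`, which is jointly `C¹` in `ε` and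
`t`. -/
lemma continuousOn_verDeriv (ht : t₀ < t₁) {u w : ∀ t, W (q t)}
    (hu : ContMDiffOn 𝓘(ℝ, ℝ) (𝓘(ℝ, E).prod 𝓘(ℝ, K)) 1
      (fun t => (⟨q t, u t⟩ : TotalSpace K W)) (Icc t₀ t₁))
    (hw : ContMDiffOn 𝓘(ℝ, ℝ) (𝓘(ℝ, E).prod 𝓘(ℝ, K)) 1
      (fun t => (⟨q t, w t⟩ : TotalSpace K W)) (Icc t₀ t₁))
    {G : TotalSpace K W → ℝ} (hG : ContMDiff (𝓘(ℝ, E).prod 𝓘(ℝ, K)) 𝓘(ℝ, ℝ) ∞ G) :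
    ContinuousOn (fun t => verDeriv (E := E) G ⟨q t, u t⟩ (w t)) (Icc t₀ t₁) := by
  have h1 : ContMDiffOn 𝓘(ℝ, ℝ × ℝ) 𝓘(ℝ, ℝ) 1
      (fun z : ℝ × ℝ => G ⟨q z.2, u z.2 + z.1 • w z.2⟩) (Ioo (-1) 1 ×ˢ Icc t₀ t₁) :=
    (hG.of_le (by simp)).comp_contMDiffOn (contMDiffOn_add_smul_path ht hu hw)
  obtain ⟨Φ', hc, hd, -⟩ := hasDerivAt_integral_of_contDiffOn (Φ := fun ε t =>
    G ⟨q t, u t + ε • w t⟩) ht one_pos (contMDiffOn_iff_contDiffOn.1 h1)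
  refine hc.congr fun t htJ => ((hd t htJ).unique ?_).symm
  have hm := (hasMFDerivAt_vertical (E := E) (⟨q t, u t⟩ : TotalSpace K W) (w t)).mdifferentiableAt
  have h0 : (⟨q t, u t⟩ : TotalSpace K W) = ⟨q t, u t + (0 : ℝ) • w t⟩ := by simp
  have h := hasDerivAt_comp_curve (G := G) (hG.mdifferentiable (by simp) _) hm
  refine h.congr_deriv ?_
  exact (congrArg (fun z : TotalSpace K W => (mvfderiv (𝓘(ℝ, E).prod 𝓘(ℝ, K)) G z : E × K →L[ℝ] ℝ)
    (vertLift (E := E) (⟨q t, u t⟩ : TotalSpace K W) (w t) : E × K)) h0).symm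

/-- The horizontal lift is defined point by point, so its continuity is obtained indirectly. With `u
= ∑ cᵢ sᵢ(q)`, the map `Y(c, x) = ∑ cᵢ sᵢ(x)` sends `(0, ρ(e))` to the horizontal lift plus the
vertical lift of `∑ cᵢ ∇_{ρ(e)} sᵢ`; the differential of `G ∘ Y` and the vertical term are both
continuous. The hypothesis `hcov` asks only that `∇_{ρ(e)}` preserve smooth sections, which covers
`∇` and `∇*` alike. -/
lemma continuousOn_horDeriv (cov : CovariantDerivative 𝓘(ℝ, E) K W) (ht : t₀ < t₁)
    (e : Cₛ^∞⟮𝓘(ℝ, E); F, V⟯)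
    (hcov : ∀ s : Cₛ^∞⟮𝓘(ℝ, E); K, W⟯, ∃ s' : Cₛ^∞⟮𝓘(ℝ, E); K, W⟯, ∀ x,
      s' x = cov s x (L.anchor x (e x)))
    {u : ∀ t, W (q t)}
    (hu : ContMDiffOn 𝓘(ℝ, ℝ) (𝓘(ℝ, E).prod 𝓘(ℝ, K)) 1
      (fun t => (⟨q t, u t⟩ : TotalSpace K W)) (Icc t₀ t₁))
    {G : TotalSpace K W → ℝ} (hG : ContMDiff (𝓘(ℝ, E).prod 𝓘(ℝ, K)) 𝓘(ℝ, ℝ) ∞ G) :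
    ContinuousOn (fun t => horDeriv cov G ⟨q t, u t⟩ (L.anchor (q t) (e (q t)))) (Icc t₀ t₁) := by
  have hq : ContMDiffOn 𝓘(ℝ, ℝ) 𝓘(ℝ, E) 1 q (Icc t₀ t₁) :=
    (contMDiff_proj W (IB := 𝓘(ℝ, E)) (n := 1) (F := K)).comp_contMDiffOn hu
  obtain ⟨N, s, c, hc, hus⟩ := exists_path_eq_sum ht hu
  choose s' hs' using fun i => hcov (s i)
  let Y : (Fin N → ℝ) × Q → TotalSpace K W := fun m => ⟨m.2, ∑ i, m.1 i • s i m.2⟩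
  have hY : ContMDiff (𝓘(ℝ, Fin N → ℝ).prod 𝓘(ℝ, E)) (𝓘(ℝ, E).prod 𝓘(ℝ, K)) ∞ Y := fun m =>
    contMDiffWithinAt_univ.1 (contMDiffWithinAt_sum_smul_section (n := ∞) le_rfl
      contMDiffWithinAt_snd Finset.univ (c := fun i (m : (Fin N → ℝ) × Q) => m.1 i)
      (fun i _ => ((contDiff_apply ℝ ℝ i).contMDiff.contMDiffAt.comp m
        contMDiffAt_fst).contMDiffWithinAt) s)
  have hZ : ContinuousOn (fun t => (⟨(fun i => c i t, q t), ((0 : Fin N → ℝ),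
      (L.anchor (q t) (e (q t)) : E))⟩ :
      TangentBundle (𝓘(ℝ, Fin N → ℝ).prod 𝓘(ℝ, E)) ((Fin N → ℝ) × Q))) (Icc t₀ t₁) := by
    have h1 : ContMDiff 𝓘(ℝ, E) (𝓘(ℝ, E).prod 𝓘(ℝ, E)) ∞
        (fun x => (⟨x, L.anchor x (e x)⟩ : TangentBundle 𝓘(ℝ, E) Q)) :=
      L.contMDiff_anchor.clm_bundle_apply e.contMDiff
    have h2 : Continuous fun t => (⟨fun i => c i t, (0 : Fin N → ℝ)⟩ :
        TangentBundle 𝓘(ℝ, Fin N → ℝ) (Fin N → ℝ)) :=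
      (Bundle.contMDiff_zeroSection (n := 0) (IB := 𝓘(ℝ, Fin N → ℝ)) (B := Fin N → ℝ)
        (F := Fin N → ℝ) ℝ (TangentSpace 𝓘(ℝ, Fin N → ℝ) :
        (Fin N → ℝ) → Type _)).continuous.comp (continuous_pi fun i => (hc i).continuous)
    exact ((contMDiff_equivTangentBundleProd_symm (n := 0) (I := 𝓘(ℝ, Fin N → ℝ)) (M := Fin N → ℝ)
      (I' := 𝓘(ℝ, E)) (M' := Q)).continuous).comp_continuousOn
      (h2.continuousOn.prodMk (h1.continuous.comp_continuousOn hq.continuousOn))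
  have h1 := (continuous_mvfderiv (hG.comp hY)).comp_continuousOn hZ
  have h2 := continuousOn_verDeriv ht hu (w := fun t => ∑ i, c i t • s' i (q t))
    (fun t htJ => contMDiffWithinAt_sum_smul_section (by simp) (hq t htJ) Finset.univ
      (fun i _ => (hc i).contMDiff.contMDiffAt.contMDiffWithinAt) s') hG
  refine (h1.sub h2).congr fun t htJ => ?_
  set m : (Fin N → ℝ) × Q := (fun i => c i t, q t) with hm
  set v : E := L.anchor (q t) (e (q t)) with hv
  have hsnd : (mfderiv (𝓘(ℝ, Fin N → ℝ).prod 𝓘(ℝ, E)) 𝓘(ℝ, E)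
      (fun m : (Fin N → ℝ) × Q => m.2) m ((0 : Fin N → ℝ), v) : E) = v := by
    rw [mfderiv_snd]
    rfl
  have hcoef : ∀ i, HasMFDerivAt (𝓘(ℝ, Fin N → ℝ).prod 𝓘(ℝ, E)) 𝓘(ℝ, ℝ)
      (fun m : (Fin N → ℝ) × Q => m.1 i) m
      ((ContinuousLinearMap.proj (R := ℝ) (φ := fun _ : Fin N => ℝ) i).comp
        (ContinuousLinearMap.fst ℝ (Fin N → ℝ) E)) := fun i =>
    (ContinuousLinearMap.hasMFDerivAt (ContinuousLinearMap.proj (R := ℝ)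
      (φ := fun _ : Fin N => ℝ) i)).comp m (hasMFDerivAt_fst m)
  have h3 := mfderiv_sum_smul_section (IM := 𝓘(ℝ, Fin N → ℝ).prod 𝓘(ℝ, E)) cov Finset.univ
    (b := fun m : (Fin N → ℝ) × Q => m.2) (m := m) mdifferentiableAt_snd
    (c := fun i m => m.1 i) (fun i _ => (hcoef i).mdifferentiableAt) s
    (hY.mdifferentiable (by simp) _) ((0 : Fin N → ℝ), v)
  have h4 : (mvfderiv (𝓘(ℝ, Fin N → ℝ).prod 𝓘(ℝ, E)) (G ∘ Y) m ((0 : Fin N → ℝ), v) : ℝ) =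
      verDeriv (E := E) G (Y m) (∑ i, c i t • s' i (q t)) + horDeriv cov G (Y m) v := by
    refine (mvfderiv_comp_apply (f := Y) m (hG.mdifferentiable (by simp) _)
      (hY.mdifferentiable (by simp) _) _).trans ?_
    refine mvfderiv_vertLift_add_horLift cov G (Y m) _ _ (h3.trans ?_)
    refine congrArg₂ (fun a b : E × K => a + b) ?_ (congrArg (fun v : TangentSpace 𝓘(ℝ, E) (q t) =>
      (horLift cov (Y m) v : E × K)) hsnd)
    refine congrArg (fun w : W (q t) => (vertLift (E := E) (Y m) w : E × K))
      (Finset.sum_congr rfl fun i _ => ?_)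
    refine (congrArg₂ (fun (x : ℝ) (y : TangentSpace 𝓘(ℝ, E) (q t)) =>
      x • s i (q t) + c i t • cov (s i) (q t) y)
      (mvfderiv_apply_of_hasMFDerivAt (hcoef i) ((0 : Fin N → ℝ), v)) hsnd).trans ?_
    rw [hs' i]
    change (0 : ℝ) • s i (q t) + _ = _
    rw [zero_smul, zero_add]
  have h5 : horDeriv cov G ⟨q t, u t⟩ v = horDeriv cov G (Y m) v :=
    congrArg (fun w => horDeriv cov G (⟨q t, w⟩ : TotalSpace K W) v) (hus t htJ)
  have h6 : verDeriv (E := E) G ⟨q t, u t⟩ (∑ i, c i t • s' i (q t)) =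
      verDeriv (E := E) G (Y m) (∑ i, c i t • s' i (q t)) :=
    congrArg (fun w => verDeriv (E := E) G (⟨q t, w⟩ : TotalSpace K W) (∑ i, c i t • s' i (q t)))
      (hus t htJ)
  refine h5.trans (eq_sub_of_add_eq' ?_)
  exact (congrArg (· + horDeriv cov G (Y m) v) h6).trans h4.symm

end FirstVariation

/-! ### Variational principles and equations of motion -/

section EulerLagrange

variable {E : Type*} [NormedAddCommGroup E] [NormedSpace ℝ E]
  {Q : Type*} [TopologicalSpace Q] [ChartedSpace E Q]
  {F : Type*} [NormedAddCommGroup F] [NormedSpace ℝ F]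
  {V : Q → Type*} [TopologicalSpace (TotalSpace F V)]
  [∀ x, AddCommGroup (V x)] [∀ x, Module ℝ (V x)] [∀ x, TopologicalSpace (V x)]
  [FiberBundle F V] [VectorBundle ℝ F V]
  [∀ x, IsTopologicalAddGroup (V x)] [∀ x, ContinuousSMul ℝ (V x)]
  [IsManifold 𝓘(ℝ, E) ∞ Q] [ContMDiffVectorBundle ∞ F V 𝓘(ℝ, E)]
  [FiniteDimensional ℝ E] [FiniteDimensional ℝ F] [T2Space Q] [SecondCountableTopology Q]
  {L : LieAlgebroid E F V} {t₀ t₁ : ℝ} {q : ℝ → Q} {a : ∀ t, V (q t)} {p : ∀ t, DualFiber V (q t)}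

/-- The extensions in `along` are chosen afresh at no cost in continuity: expanding `u` and `a` in
finitely many sections gives an explicit formula with continuous coefficients. -/
lemma AConnection.continuousOn_along_apply {K : Type*} [NormedAddCommGroup K] [NormedSpace ℝ K]
    {W : Q → Type*} [TopologicalSpace (TotalSpace K W)]
    [∀ x, AddCommGroup (W x)] [∀ x, Module ℝ (W x)] [∀ x, TopologicalSpace (W x)]
    [FiberBundle K W] [VectorBundle ℝ K W]
    [∀ x, IsTopologicalAddGroup (W x)] [∀ x, ContinuousSMul ℝ (W x)]
    [ContMDiffVectorBundle ∞ K W 𝓘(ℝ, E)] [FiniteDimensional ℝ K]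
    (D : AConnection L K W) (ht : t₀ < t₁)
    (ha : L.IsAPath (Icc t₀ t₁) (fun t => (⟨q t, a t⟩ : TotalSpace F V))) {u : ∀ t, W (q t)}
    (hu : ContMDiffOn 𝓘(ℝ, ℝ) (𝓘(ℝ, E).prod 𝓘(ℝ, K)) 1 (fun t => (⟨q t, u t⟩ : TotalSpace K W))
      (Icc t₀ t₁)) (σ : Cₛ^∞⟮𝓘(ℝ, E); K →L[ℝ] ℝ, DualFiber W⟯) :
    ContinuousOn (fun t => σ (q t) (D.along (Icc t₀ t₁) q a u t)) (Icc t₀ t₁) := by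
  obtain ⟨N, s, c, hc, hus⟩ := exists_path_eq_sum ht hu
  obtain ⟨N', X, y, hy, haX⟩ := exists_path_eq_sum ht ha.1.1
  have hq : ContinuousOn q (Icc t₀ t₁) := ha.1.2.continuousOn
  have hg : ∀ τ : Cₛ^∞⟮𝓘(ℝ, E); K, W⟯, ContinuousOn (fun t => pairing σ τ (q t)) (Icc t₀ t₁) :=
    fun τ => (pairing σ τ).contMDiff.continuous.comp_continuousOn hq
  have h : ContinuousOn (fun t => ∑ i, (deriv (c i) t * pairing σ (s i) (q t) +
      c i t * ∑ k, y k t * pairing σ (D.toFun (X k) (s i)) (q t))) (Icc t₀ t₁) :=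
    continuousOn_finsetSum _ fun i _ =>
      ((((hc i).continuous_deriv (by simp)).continuousOn.mul (hg _)).add
        ((hc i).continuous.continuousOn.mul (continuousOn_finsetSum _ fun k _ =>
          (hy k).continuous.continuousOn.mul (hg _))))
  refine h.congr fun t htJ => ?_
  obtain ⟨Z, hZ⟩ := exists_section_apply_eq (E := E) (F := F) (q t) (a t)
  have h1 := along_sum_smul D ht ha hu htJ hZ s
    (fun i => ((hc i).differentiable (by simp) t).hasDerivAt.hasDerivWithinAt) hus
  have h2 := fun i => D.toFun_apply_sum (hZ.trans (haX t htJ)) (s i)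
  simp only [h1, h2, map_sum, map_add, map_smul, smul_eq_mul, pairing_apply]

lemma integral_eq_zero_of_hasDerivWithinAt (ht : t₀ < t₁) {P P' : ℝ → ℝ}
    (hP : ∀ t ∈ Icc t₀ t₁, HasDerivWithinAt P (P' t) (Icc t₀ t₁) t)
    (hc : ContinuousOn P' (Icc t₀ t₁)) (h0 : P t₀ = 0) (h1 : P t₁ = 0) :
    ∫ t in t₀..t₁, P' t = 0 := by
  rw [intervalIntegral.integral_eq_sub_of_hasDerivAt_of_le ht.le
    (fun t h => (hP t h).continuousWithinAt)
    (fun t h => (hP t (Ioo_subset_Icc_self h)).hasDerivAt (Icc_mem_nhds h.1 h.2))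
    (hc.intervalIntegrable_of_Icc ht.le), h0, h1, sub_zero]

lemma eqOn_zero_of_forall_Ioo (ht : t₀ < t₁) {g : ℝ → ℝ} (hg : ContinuousOn g (Icc t₀ t₁))
    (h : ∀ t ∈ Ioo t₀ t₁, g t = 0) {t : ℝ} (htJ : t ∈ Icc t₀ t₁) : g t = 0 :=
  EqOn.of_subset_closure (g := fun _ => 0) (fun t ht => h t ht) hg continuousOn_const
    Ioo_subset_Icc_self (closure_Ioo ht.ne).ge htJ

/-- Integration by parts along an `A`-path. -/
lemma AConnection.integral_pairing_eq_zero (D : AConnection L F V) (ht : t₀ < t₁)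
    (ha : L.IsAPath (Icc t₀ t₁) (fun t => (⟨q t, a t⟩ : TotalSpace F V)))
    (hp : ContMDiffOn 𝓘(ℝ, ℝ) (𝓘(ℝ, E).prod 𝓘(ℝ, F →L[ℝ] ℝ)) 1
      (fun t => (⟨q t, p t⟩ : TotalSpace (F →L[ℝ] ℝ) (DualFiber V))) (Icc t₀ t₁))
    {b : ∀ t, V (q t)}
    (hb : ContMDiffOn 𝓘(ℝ, ℝ) (𝓘(ℝ, E).prod 𝓘(ℝ, F)) 1
      (fun t => (⟨q t, b t⟩ : TotalSpace F V)) (Icc t₀ t₁)) (hb0 : b t₀ = 0) (hb1 : b t₁ = 0)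
    {Φ : ℝ → ℝ} (hΦ : ContinuousOn Φ (Icc t₀ t₁))
    (h : ∀ t ∈ Icc t₀ t₁, Φ t = p t (D.along (Icc t₀ t₁) q a b t) +
      D.dual.along (Icc t₀ t₁) q a p t (b t)) :
    ∫ t in t₀..t₁, Φ t = 0 :=
  integral_eq_zero_of_hasDerivWithinAt ht (P := fun t => p t (b t))
    (fun t htJ => (hasDerivWithinAt_pairing_path D ht ha hb hp htJ).congr_deriv
      ((add_comm _ _).trans (h t htJ).symm)) hΦ
    (by simp [hb0]) (by simp [hb1])

/-- The fundamental lemma of the calculus of variations for admissible variations. -/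
lemma AConnection.dual_along_eq_of_forall_variation (D : AConnection L F V) (ht : t₀ < t₁)
    (ha : L.IsAPath (Icc t₀ t₁) (fun t => (⟨q t, a t⟩ : TotalSpace F V)))
    (hp : ContMDiffOn 𝓘(ℝ, ℝ) (𝓘(ℝ, E).prod 𝓘(ℝ, F →L[ℝ] ℝ)) 1
      (fun t => (⟨q t, p t⟩ : TotalSpace (F →L[ℝ] ℝ) (DualFiber V))) (Icc t₀ t₁))
    {l : ∀ t, DualFiber V (q t)}
    (hl : ∀ e : Cₛ^∞⟮𝓘(ℝ, E); F, V⟯, ContinuousOn (fun t => l t (e (q t))) (Icc t₀ t₁))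
    (h : ∀ (e : Cₛ^∞⟮𝓘(ℝ, E); F, V⟯), ∀ τ ∈ Ioo t₀ t₁, ∃ η > 0, ∀ f : ℝ → ℝ, ContDiff ℝ ∞ f →
      tsupport f ⊆ Ioo t₀ t₁ ∩ Metric.ball τ η →
      ∃ Φ : ℝ → ℝ, ContinuousOn Φ (Icc t₀ t₁) ∧ ∫ t in t₀..t₁, Φ t = 0 ∧
        ∀ t ∈ Icc t₀ t₁, Φ t =
          p t (D.along (Icc t₀ t₁) q a (fun t => f t • e (q t)) t) + f t * l t (e (q t)))
    {t : ℝ} (htJ : t ∈ Icc t₀ t₁) : D.dual.along (Icc t₀ t₁) q a p t = l t := by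
  refine AConnection.dual_ext (E := E) (K := F) (q t) fun e => sub_eq_zero.1 ?_
  have hg : ContinuousOn (fun t => D.dual.along (Icc t₀ t₁) q a p t (e (q t)) - l t (e (q t)))
      (Icc t₀ t₁) :=
    ((D.dual.continuousOn_along_apply ht ha hp (evalSection e)).sub (hl e)).congr fun t _ => by
      rw [Pi.sub_apply, evalSection_apply]
  -- Variations vanish at the endpoints, so the equation is proved in the open interval and extended
  -- by continuity.
  refine eqOn_zero_of_forall_Ioo ht hg (fun τ hτ => ?_) htJ
  obtain ⟨η, hη, H⟩ := h e τ hτ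
  refine eq_zero_of_forall_integral_smul_eq_zero
    (g := fun t => D.dual.along (Icc t₀ t₁) q a p t (e (q t)) - l t (e (q t))) hη hg hτ fun f hf hfs => ?_
  obtain ⟨Φ, hΦ, hΦ0, hΦe⟩ := H f hf hfs
  have hb := contMDiffOn_smul_section_path (by simp) (ha.1.2.of_le (by norm_num))
    (hf.of_le (by simp) : ContDiff ℝ 1 f) e
  have hend : ∀ t ∉ Ioo t₀ t₁, f t • e (q t) = 0 := fun t ht => by
    rw [image_eq_zero_of_notMem_tsupport fun h => ht (hfs h).1, zero_smul]
  have hfg : ContinuousOn (fun t => f t * (D.dual.along (Icc t₀ t₁) q a p t (e (q t)) -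
      l t (e (q t)))) (Icc t₀ t₁) := hf.continuous.continuousOn.mul hg
  -- Adding `f (D*_a p - l)(e)` to `Φ` gives `d/dt ⟨p, f e⟩`, whose integral is zero. Since `∫ Φ =
  -- 0`, the added term integrates to zero for every `f`.
  have h1 := D.integral_pairing_eq_zero ht ha hp hb (hend t₀ (by simp)) (hend t₁ (by simp))
    (hΦ.add hfg) fun t htJ => by
      rw [Pi.add_apply, hΦe t htJ, map_smul, smul_eq_mul]
      ring
  simp only [Pi.add_apply] at h1
  rw [intervalIntegral.integral_add (hΦ.intervalIntegrable_of_Icc ht.le)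
    (hfg.intervalIntegrable_of_Icc ht.le), hΦ0, zero_add] at h1
  exact h1

variable (L) (cov : CovariantDerivative 𝓘(ℝ, E) F V)
  [CovariantDerivative.ContMDiffCovariantDerivative cov ∞]

/-- The first variation of `∫ ℓ(a) dt`. -/
lemma LieAlgebroid.exists_firstVariation (ht : t₀ < t₁) {ℓ : TotalSpace F V → ℝ}
    (hℓ : ContMDiff (𝓘(ℝ, E).prod 𝓘(ℝ, F)) 𝓘(ℝ, ℝ) ∞ ℓ) {b : ∀ t, V (q t)} {δ : ℝ} (hδ : 0 < δ)
    {Γ : ℝ → ℝ → TotalSpace F V} (hΓ : L.IsAHomotopy (Icc t₀ t₁) (fun t => ⟨q t, a t⟩) δ Γ)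
    (hΓ' : ∀ t ∈ Icc t₀ t₁,
      (mfderiv 𝓘(ℝ, ℝ) (𝓘(ℝ, E).prod 𝓘(ℝ, F)) (fun ε => Γ ε t) 0 (1 : ℝ) : E × F) =
        admissibleTangent L cov t₀ t₁ q a b t) :
    ∃ Φ : ℝ → ℝ, ContinuousOn Φ (Icc t₀ t₁) ∧
      (∀ t ∈ Icc t₀ t₁, Φ t = verDeriv (E := E) ℓ ⟨q t, a t⟩
          ((AConnection.bar L cov).along (Icc t₀ t₁) q a b t) +
        horDeriv cov ℓ ⟨q t, a t⟩ (L.anchor (q t) (b t))) ∧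
      HasDerivAt (fun ε => ∫ t in t₀..t₁, ℓ (Γ ε t)) (∫ t in t₀..t₁, Φ t) 0 := by
  obtain ⟨Φ, hc, hd, hi⟩ := hasDerivAt_integral_of_contDiffOn (Φ := fun ε t => ℓ (Γ ε t)) ht hδ
    (contMDiffOn_iff_contDiffOn.1 ((hℓ.of_le (by simp)).comp_contMDiffOn hΓ.1))
  exact ⟨Φ, hc, fun t htJ => (hd t htJ).unique
    (hasDerivAt_comp_lift cov (γ := fun ε => Γ ε t) (hΓ.2.2 t htJ) (hℓ.mdifferentiable (by simp) _)
      (mdifferentiableAt_slice hΓ.1 hδ htJ) (hΓ' t htJ)), hi⟩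

/-- The first variation of `∫ (⟨p, a⟩ + s H(p)) dt`. -/
lemma LieAlgebroid.exists_firstVariation_sum (ht : t₀ < t₁) (s : ℝ)
    {H : TotalSpace (F →L[ℝ] ℝ) (DualFiber V) → ℝ}
    (hH : ContMDiff (𝓘(ℝ, E).prod 𝓘(ℝ, F →L[ℝ] ℝ)) 𝓘(ℝ, ℝ) ∞ H) {b : ∀ t, V (q t)}
    {r : ∀ t, DualFiber V (q t)} {δ : ℝ} (hδ : 0 < δ)
    {Γ : ℝ → ℝ → SumTotal F V} (hΓ : L.IsSumHomotopy (Icc t₀ t₁) (sumPath q a p) δ Γ)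
    (hΓ' : ∀ t ∈ Icc t₀ t₁,
      (mfderiv 𝓘(ℝ, ℝ) (𝓘(ℝ, E).prod 𝓘(ℝ, F)) (fun ε => toA (Γ ε t)) 0 (1 : ℝ) : E × F) =
        admissibleTangent L cov t₀ t₁ q a b t)
    (hΓ'' : ∀ t ∈ Icc t₀ t₁,
      (mfderiv 𝓘(ℝ, ℝ) (𝓘(ℝ, E).prod 𝓘(ℝ, F →L[ℝ] ℝ)) (fun ε => toDual (Γ ε t)) 0 (1 : ℝ) :
          E × (F →L[ℝ] ℝ)) =
        admissibleTangentDual L cov q p b r t) :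
    ∃ Φ : ℝ → ℝ, ContinuousOn Φ (Icc t₀ t₁) ∧
      (∀ t ∈ Icc t₀ t₁, Φ t = (r t (a t) + p t ((AConnection.bar L cov).along (Icc t₀ t₁) q a b t)) +
        s * (verDeriv (E := E) H ⟨q t, p t⟩ (r t) +
          horDeriv (dualCov cov) H ⟨q t, p t⟩ (L.anchor (q t) (b t)))) ∧
      HasDerivAt (fun ε => ∫ t in t₀..t₁, ((Γ ε t).2.2 (Γ ε t).2.1 + s * H (toDual (Γ ε t))))
        (∫ t in t₀..t₁, Φ t) 0 := by
  obtain ⟨hA, hD⟩ := contMDiffOn_sumTotal_iff.1 hΓ.1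
  have h1 : ContMDiffOn 𝓘(ℝ, ℝ × ℝ) 𝓘(ℝ, ℝ) 1
      (fun z : ℝ × ℝ => (Γ z.1 z.2).2.2 (Γ z.1 z.2).2.1) (Ioo (-δ) δ ×ˢ Icc t₀ t₁) := fun z hz =>
    ((contMDiffWithinAt_totalSpace).1 (ContMDiffWithinAt.clm_bundle_apply (F₂ := ℝ)
      (E₂ := fun _ : Q => ℝ) (b := fun z : ℝ × ℝ => (Γ z.1 z.2).1)
      (ϕ := fun z => (Γ z.1 z.2).2.2) (v := fun z => (Γ z.1 z.2).2.1) (hD z hz) (hA z hz))).2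
  have h2 : ContDiffOn ℝ 1 (fun z : ℝ × ℝ => (Γ z.1 z.2).2.2 (Γ z.1 z.2).2.1 +
      s * H (toDual (Γ z.1 z.2))) (Ioo (-δ) δ ×ˢ Icc t₀ t₁) :=
    (contMDiffOn_iff_contDiffOn.1 h1).add (contDiffOn_const.mul
      (contMDiffOn_iff_contDiffOn.1 ((hH.of_le (by simp)).comp_contMDiffOn hD)))
  obtain ⟨Φ, hc, hd, hi⟩ := hasDerivAt_integral_of_contDiffOn
    (Φ := fun ε t => (Γ ε t).2.2 (Γ ε t).2.1 + s * H (toDual (Γ ε t))) ht hδ h2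
  refine ⟨Φ, hc, fun t htJ => (hd t htJ).unique ?_, hi⟩
  have h3 : MDifferentiableAt 𝓘(ℝ, ℝ) (𝓘(ℝ, E).prod 𝓘(ℝ, F)) (fun ε => toA (Γ ε t)) 0 :=
    mdifferentiableAt_slice (Γ := fun ε t => toA (Γ ε t)) hA hδ htJ
  have h4 : MDifferentiableAt 𝓘(ℝ, ℝ) (𝓘(ℝ, E).prod 𝓘(ℝ, F →L[ℝ] ℝ))
      (fun ε => toDual (Γ ε t)) 0 :=
    mdifferentiableAt_slice (Γ := fun ε t => toDual (Γ ε t)) hD hδ htJ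
  exact (hasDerivAt_pairing_lift cov (γ := fun ε => Γ ε t) (z := sumPath q a p t)
      (hΓ.2.2 t htJ) h3 h4 (hΓ' t htJ) (hΓ'' t htJ)).add
    ((hasDerivAt_comp_lift (dualCov cov) (γ := fun ε => toDual (Γ ε t))
      (congrArg toDual (hΓ.2.2 t htJ)) (hH.mdifferentiable (by simp) _) h4 (hΓ'' t htJ)).const_mul s)

/-- The Euler–Lagrange–Poincaré equations are the critical point equations of `∫ ℓ(a) dt`. -/
theorem LieAlgebroid.lagrangePrinciple_iff (ht : t₀ < t₁)
    (hap : L.IsSumPath (Icc t₀ t₁) (sumPath q a p)) {ℓ : TotalSpace F V → ℝ}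
    (hℓ : ContMDiff (𝓘(ℝ, E).prod 𝓘(ℝ, F)) 𝓘(ℝ, ℝ) ∞ ℓ) (hleg : IsLegendrePath E t₀ t₁ q a p ℓ) :
    LagrangePrinciple L cov t₀ t₁ q a ℓ ↔
      EulerLagrangePoincareEquations L cov t₀ t₁ q a p ℓ := by
  have ha : L.IsAPath (Icc t₀ t₁) (fun t => (⟨q t, a t⟩ : TotalSpace F V)) := hap.2
  have hp : ContMDiffOn 𝓘(ℝ, ℝ) (𝓘(ℝ, E).prod 𝓘(ℝ, F →L[ℝ] ℝ)) 1
      (fun t => (⟨q t, p t⟩ : TotalSpace (F →L[ℝ] ℝ) (DualFiber V))) (Icc t₀ t₁) :=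
    (L.isSumPath_iff.1 hap).2
  constructor
  · intro h
    refine fun t htJ => (AConnection.bar L cov).dual_along_eq_of_forall_variation ht ha hp
      (l := fun t => (horDeriv cov ℓ ⟨q t, a t⟩).comp (L.anchor (q t))) (fun e => ?_)
      (fun e τ hτ => ?_) htJ
    · exact continuousOn_horDeriv cov ht e
        (fun s => ⟨anchorCov L cov s e, fun x => rfl⟩) ha.1.1 hℓ
    · obtain ⟨η, hη, -, hB⟩ := L.exists_local_homotopy cov ht ha e hτ
      refine ⟨η, hη, fun f hf hfs => ?_⟩
      obtain ⟨δ, hδ, Γ, hΓ, hΓ'⟩ := hB f hf (hfs.trans inter_subset_right)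
      obtain ⟨Φ, hc, hΦ, hi⟩ := L.exists_firstVariation cov ht hℓ hδ hΓ hΓ'
      have hend : ∀ t ∉ Ioo t₀ t₁, f t • e (q t) = 0 := fun t ht => by
        rw [image_eq_zero_of_notMem_tsupport fun h => ht (hfs h).1, zero_smul]
      refine ⟨Φ, hc, hi.unique (h _ ⟨contMDiffOn_smul_section_path (by simp)
        (ha.1.2.of_le (by norm_num)) (hf.of_le (by simp)) e, ha.1.2⟩ (hend t₀ (by simp))
        (hend t₁ (by simp)) δ hδ Γ hΓ hΓ'), fun t htJ => ?_⟩
      rw [hΦ t htJ, hleg t htJ, map_smul, map_smul]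
      rfl
  -- With `p = dℓ^ver(a)` and the equations, the first variation is the integral of `d/dt ⟨p, b⟩`.
  · intro h b hb hb0 hb1 δ hδ Γ hΓ hΓ'
    obtain ⟨Φ, hc, hΦ, hi⟩ := L.exists_firstVariation cov ht hℓ hδ hΓ hΓ'
    rwa [(AConnection.bar L cov).integral_pairing_eq_zero ht ha hp hb.1 hb0 hb1 hc fun t htJ => by
      rw [hΦ t htJ, h t htJ, hleg t htJ]; rfl] at hi

/-- The generalized Lie–Poisson equations are the critical point equations of
`∫ (⟨p, a⟩ + s H(p)) dt`. -/
theorem LieAlgebroid.hamiltonPrinciple_iff (ht : t₀ < t₁)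
    (hap : L.IsSumPath (Icc t₀ t₁) (sumPath q a p)) (s : ℝ)
    {H : TotalSpace (F →L[ℝ] ℝ) (DualFiber V) → ℝ}
    (hH : ContMDiff (𝓘(ℝ, E).prod 𝓘(ℝ, F →L[ℝ] ℝ)) 𝓘(ℝ, ℝ) ∞ H) :
    HamiltonPrinciple L cov t₀ t₁ q a p s H ↔ LiePoissonEquations L cov t₀ t₁ q a p s H := by
  have ha : L.IsAPath (Icc t₀ t₁) (fun t => (⟨q t, a t⟩ : TotalSpace F V)) := hap.2
  have hp : ContMDiffOn 𝓘(ℝ, ℝ) (𝓘(ℝ, E).prod 𝓘(ℝ, F →L[ℝ] ℝ)) 1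
      (fun t => (⟨q t, p t⟩ : TotalSpace (F →L[ℝ] ℝ) (DualFiber V))) (Icc t₀ t₁) :=
    (L.isSumPath_iff.1 hap).2
  have hver : ∀ t, a t = -s • verDerivDual (E := E) H ⟨q t, p t⟩ → ∀ r : DualFiber V (q t),
      r (a t) = -s * verDeriv (E := E) H ⟨q t, p t⟩ r := fun t h r => by
    rw [h, map_smul, smul_eq_mul]
    exact congrArg (-s * ·) (apply_predual (F := F) (q t) _ r)
  constructor
  · intro h
    -- Variations with `b = 0` and `r = f σ` are realized without moving the base path, and isolate
    -- `⟨r, a⟩ + s ⟨r, dH^ver(p)⟩`.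
    have hvert : ∀ t ∈ Icc t₀ t₁, a t = -s • verDerivDual (E := E) H ⟨q t, p t⟩ := by
      intro t htJ
      refine eq_of_forall_dual_section (E := E) (K := F) (q t) fun σ => ?_
      have hσ : ContMDiffOn 𝓘(ℝ, ℝ) (𝓘(ℝ, E).prod 𝓘(ℝ, F →L[ℝ] ℝ)) 1
          (fun t => (⟨q t, σ (q t)⟩ : TotalSpace (F →L[ℝ] ℝ) (DualFiber V))) (Icc t₀ t₁) :=
        (σ.contMDiff.of_le (by simp)).comp_contMDiffOn (ha.1.2.of_le (by norm_num))
      have hg : ContinuousOn (fun t => σ (q t) (a t) + s * verDeriv (E := E) H ⟨q t, p t⟩ (σ (q t)))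
          (Icc t₀ t₁) :=
        ((contMDiff_fiberLinear σ).continuous.comp_continuousOn ha.1.1.continuousOn).add
          (continuousOn_const.mul (continuousOn_verDeriv ht hp hσ hH))
      have h0 : σ (q t) (a t) + s * verDeriv (E := E) H ⟨q t, p t⟩ (σ (q t)) = 0 := by
        refine eqOn_zero_of_forall_Ioo ht hg (fun τ hτ => ?_) htJ
        refine eq_zero_of_forall_integral_smul_eq_zero (g := fun t => σ (q t) (a t) +
          s * verDeriv (E := E) H ⟨q t, p t⟩ (σ (q t))) one_pos hg hτ fun f hf hfs => ?_
        have hr : ContMDiffOn 𝓘(ℝ, ℝ) (𝓘(ℝ, E).prod 𝓘(ℝ, F →L[ℝ] ℝ)) 1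
            (fun t => (⟨q t, f t • σ (q t)⟩ : TotalSpace (F →L[ℝ] ℝ) (DualFiber V)))
            (Icc t₀ t₁) :=
          contMDiffOn_smul_section_path (by simp) (ha.1.2.of_le (by norm_num))
            (hf.of_le (by simp)) σ
        obtain ⟨Γ, hΓ, hΓ', hΓ''⟩ := L.exists_vertical_homotopy cov ht hap hr
        obtain ⟨Φ, hc, hΦ, hi⟩ := L.exists_firstVariation_sum cov ht s hH one_pos hΓ hΓ' hΓ''
        have hz : ContMDiffOn 𝓘(ℝ, ℝ) (𝓘(ℝ, E).prod 𝓘(ℝ, F)) 1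
            (fun t => (⟨q t, 0⟩ : TotalSpace F V)) (Icc t₀ t₁) := by
          simpa using contMDiffOn_smul_section_path (by simp) (ha.1.2.of_le (by norm_num))
            (f := fun _ => 0) contDiff_const (0 : Cₛ^∞⟮𝓘(ℝ, E); F, V⟯)
        have h1 := hi.unique (h _ _ (isBundlePath_sumTotal_iff.2 ⟨⟨hz, ha.1.2⟩, hr⟩) rfl rfl 1
          one_pos Γ hΓ hΓ' hΓ'')
        rw [← h1]
        refine intervalIntegral.integral_congr fun t htJ => ?_
        rw [uIcc_of_le ht.le] at htJ
        simp only [hΦ t htJ, AConnection.along_zero _ ht ha htJ, map_zero, map_smul, smul_apply,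
          smul_eq_mul]
        ring
      rw [map_smul, smul_eq_mul, eq_neg_of_add_eq_zero_left h0, neg_mul]
      exact congrArg (fun x => -(s * x)) (apply_predual (F := F) (q t) _ _).symm
    -- By `hvert` the terms with `r` in the first variation cancel, so it does not matter which `r`
    -- the lifted homotopy has.
    refine fun t htJ => ⟨(AConnection.bar L cov).dual_along_eq_of_forall_variation ht ha hp
      (l := fun t => s • (horDeriv (dualCov cov) H ⟨q t, p t⟩).comp (L.anchor (q t))) (fun e => ?_)
      (fun e τ hτ => ?_) htJ, hvert t htJ⟩
    · exact continuousOn_const.mul (continuousOn_horDeriv (dualCov cov) ht e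
        (fun σ => ⟨(AConnection.ofCov L cov).dual.toFun e σ,
          AConnection.ofCov_dual_apply L cov e σ⟩) hp hH)
    · obtain ⟨η, hη, -, hB⟩ := L.exists_local_homotopy cov ht ha e hτ
      refine ⟨η, hη, fun f hf hfs => ?_⟩
      obtain ⟨δ, hδ, Γ, hΓ, hΓ'⟩ := hB f hf (hfs.trans inter_subset_right)
      obtain ⟨r, hr, Γs, hΓs, hΓA, hΓs'⟩ :=
        L.exists_lift_homotopy cov ht hap (hf.of_le (by simp)) e hδ hΓ hΓ'
      obtain rfl : (fun ε t => toA (Γs ε t)) = Γ := funext₂ hΓA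
      obtain ⟨Φ, hc, hΦ, hi⟩ := L.exists_firstVariation_sum cov ht s hH hδ hΓs hΓ' hΓs'
      have hend : ∀ t ∉ Ioo t₀ t₁, f t • e (q t) = 0 := fun t ht => by
        rw [image_eq_zero_of_notMem_tsupport fun h => ht (hfs h).1, zero_smul]
      refine ⟨Φ, hc, hi.unique (h _ r hr (hend t₀ (by simp)) (hend t₁ (by simp)) δ hδ Γs hΓs hΓ'
        hΓs'), fun t htJ => ?_⟩
      rw [hΦ t htJ, hver t (hvert t htJ), map_smul, map_smul, smul_eq_mul, smul_apply, smul_eq_mul,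
        ContinuousLinearMap.comp_apply]
      ring
  · intro h b r hb hb0 hb1 δ hδ Γ hΓ hΓ' hΓ''
    obtain ⟨Φ, hc, hΦ, hi⟩ := L.exists_firstVariation_sum cov ht s hH hδ hΓ hΓ' hΓ''
    have hbc : ContMDiffOn 𝓘(ℝ, ℝ) (𝓘(ℝ, E).prod 𝓘(ℝ, F)) 1
        (fun t => (⟨q t, b t⟩ : TotalSpace F V)) (Icc t₀ t₁) := (isBundlePath_sumTotal_iff.1 hb).1.1
    rwa [(AConnection.bar L cov).integral_pairing_eq_zero ht ha hp hbc hb0 hb1 hc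
      fun t htJ => by
        rw [hΦ t htJ, hver t (h t htJ).2, (h t htJ).1, smul_apply, smul_eq_mul,
          ContinuousLinearMap.comp_apply]
        ring] at hi

end EulerLagrange

/-! ### The Legendre transformation -/

section Hyperregular

variable {E : Type*} [NormedAddCommGroup E] [NormedSpace ℝ E]
  {Q : Type*} [TopologicalSpace Q] [ChartedSpace E Q]
  {F : Type*} [NormedAddCommGroup F] [NormedSpace ℝ F]
  {V : Q → Type*} [TopologicalSpace (TotalSpace F V)]
  [∀ x, AddCommGroup (V x)] [∀ x, Module ℝ (V x)] [∀ x, TopologicalSpace (V x)]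
  [FiberBundle F V] [VectorBundle ℝ F V]
  [IsManifold 𝓘(ℝ, E) ∞ Q] [ContMDiffVectorBundle ∞ F V 𝓘(ℝ, E)]

lemma contMDiff_fiberwise_smul (c : ℝ) :
    ContMDiff (𝓘(ℝ, E).prod 𝓘(ℝ, F)) (𝓘(ℝ, E).prod 𝓘(ℝ, F)) ∞
      (fun z : TotalSpace F V => (⟨z.1, c • z.2⟩ : TotalSpace F V)) := by
  intro z
  have hid := (contMDiffAt_totalSpace (f := fun z : TotalSpace F V => z) (x₀ := z)
    (IM := 𝓘(ℝ, E).prod 𝓘(ℝ, F)) (IB := 𝓘(ℝ, E)) (n := ∞)).1 contMDiffAt_id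
  refine contMDiffAt_totalSpace.2 ⟨hid.1, ?_⟩
  have hc : ContMDiffAt (𝓘(ℝ, E).prod 𝓘(ℝ, F)) 𝓘(ℝ, ℝ) ∞ (fun _ : TotalSpace F V => c) z :=
    contMDiffAt_const
  refine (hc.smul hid.2).congr_of_eventuallyEq ?_
  have h : ∀ᶠ w : TotalSpace F V in 𝓝 z, w.1 ∈ (trivializationAt F V z.1).baseSet :=
    (FiberBundle.continuous_proj F V).continuousAt.eventually_mem
      ((trivializationAt F V z.1).open_baseSet.mem_nhds
        (FiberBundle.mem_baseSet_trivializationAt F V z.1))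
  filter_upwards [h] with w hw
  have h1 := trivialization_sum_smul z.1 hw (Finset.univ : Finset Unit) (fun _ => c) fun _ => w.2
  simpa using h1

variable [∀ x, IsTopologicalAddGroup (V x)] [∀ x, ContinuousSMul ℝ (V x)]
  [FiniteDimensional ℝ E] [FiniteDimensional ℝ F] [T2Space Q]
  {EM : Type*} [NormedAddCommGroup EM] [NormedSpace ℝ EM]
  {HM : Type*} [TopologicalSpace HM] {IM : ModelWithCorners ℝ EM HM}
  {M : Type*} [TopologicalSpace M] [ChartedSpace HM M]

lemma contMDiff_pairing {n : WithTop ℕ∞} {b : M → Q} {α : ∀ m, V (b m)} {β : ∀ m, DualFiber V (b m)}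
    (hα : ContMDiff IM (𝓘(ℝ, E).prod 𝓘(ℝ, F)) n (fun m => (⟨b m, α m⟩ : TotalSpace F V)))
    (hβ : ContMDiff IM (𝓘(ℝ, E).prod 𝓘(ℝ, F →L[ℝ] ℝ)) n
      (fun m => (⟨b m, β m⟩ : TotalSpace (F →L[ℝ] ℝ) (DualFiber V)))) :
    ContMDiff IM 𝓘(ℝ, ℝ) n (fun m => β m (α m)) := fun m =>
  ((contMDiffAt_totalSpace).1 (ContMDiffAt.clm_bundle_apply (F₂ := ℝ)
      (E₂ := fun _ : Q => ℝ) (b := b) (ϕ := β) (v := α) (hβ m) (hα m))).2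

section Lift
variable {K : Type*} [NormedAddCommGroup K] [NormedSpace ℝ K]
  {W : Q → Type*} [TopologicalSpace (TotalSpace K W)]
  [∀ x, AddCommGroup (W x)] [∀ x, Module ℝ (W x)] [∀ x, TopologicalSpace (W x)]
  [FiberBundle K W] [VectorBundle ℝ K W]
  [∀ x, IsTopologicalAddGroup (W x)] [∀ x, ContinuousSMul ℝ (W x)]
  [ContMDiffVectorBundle ∞ K W 𝓘(ℝ, E)] [FiniteDimensional ℝ K]
  {K' : Type*} [NormedAddCommGroup K'] [NormedSpace ℝ K']
  {W' : Q → Type*} [TopologicalSpace (TotalSpace K' W')]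
  [∀ x, AddCommGroup (W' x)] [∀ x, Module ℝ (W' x)] [∀ x, TopologicalSpace (W' x)]
  [FiberBundle K' W'] [VectorBundle ℝ K' W']
  [∀ x, IsTopologicalAddGroup (W' x)] [∀ x, ContinuousSMul ℝ (W' x)]
  [ContMDiffVectorBundle ∞ K' W' 𝓘(ℝ, E)] [FiniteDimensional ℝ K']
  {b : M → Q} {m : M} {u : TangentSpace IM m} {v : TangentSpace 𝓘(ℝ, E) (b m)}

lemma mvfderiv_comp_lift (cov : CovariantDerivative 𝓘(ℝ, E) K W) {α : ∀ m, W (b m)}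
    {G : TotalSpace K W → ℝ} {w : W (b m)}
    (hα : MDifferentiableAt IM (𝓘(ℝ, E).prod 𝓘(ℝ, K)) (fun m => (⟨b m, α m⟩ : TotalSpace K W)) m)
    (hG : MDifferentiableAt (𝓘(ℝ, E).prod 𝓘(ℝ, K)) 𝓘(ℝ, ℝ) G ⟨b m, α m⟩)
    (h : (mfderiv IM (𝓘(ℝ, E).prod 𝓘(ℝ, K)) (fun m => (⟨b m, α m⟩ : TotalSpace K W)) m u : E × K) =
      (vertLift (E := E) (⟨b m, α m⟩ : TotalSpace K W) w +
        horLift cov (⟨b m, α m⟩ : TotalSpace K W) v : E × K)) :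
    mvfderiv IM (fun m => G ⟨b m, α m⟩) m u =
      verDeriv (E := E) G ⟨b m, α m⟩ w + horDeriv cov G ⟨b m, α m⟩ v :=
  have h1 := mvfderiv_comp_apply (g := G) (f := fun m => (⟨b m, α m⟩ : TotalSpace K W)) m hG hα u
  h1.trans (mvfderiv_vertLift_add_horLift cov G (⟨b m, α m⟩ : TotalSpace K W) w v h)

/-- Maps to two bundles over the same base map have velocities with the same horizontal part. -/
lemma exists_mfderiv_eq_of_same_base (cov : CovariantDerivative 𝓘(ℝ, E) K W)
    (cov' : CovariantDerivative 𝓘(ℝ, E) K' W') {α : ∀ m, W (b m)} {β : ∀ m, W' (b m)}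
    (hα : MDifferentiableAt IM (𝓘(ℝ, E).prod 𝓘(ℝ, K)) (fun m => (⟨b m, α m⟩ : TotalSpace K W)) m)
    (hβ : MDifferentiableAt IM (𝓘(ℝ, E).prod 𝓘(ℝ, K')) (fun m => (⟨b m, β m⟩ : TotalSpace K' W')) m)
    {w : W (b m)}
    (h : (mfderiv IM (𝓘(ℝ, E).prod 𝓘(ℝ, K)) (fun m => (⟨b m, α m⟩ : TotalSpace K W)) m u : E × K) =
      (vertLift (E := E) (⟨b m, α m⟩ : TotalSpace K W) w +
        horLift cov (⟨b m, α m⟩ : TotalSpace K W) v : E × K)) :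
    ∃ r : W' (b m), (mfderiv IM (𝓘(ℝ, E).prod 𝓘(ℝ, K'))
        (fun m => (⟨b m, β m⟩ : TotalSpace K' W')) m u : E × K') =
      (vertLift (E := E) (⟨b m, β m⟩ : TotalSpace K' W') r +
        horLift cov' (⟨b m, β m⟩ : TotalSpace K' W') v : E × K') := by
  have h1 : (mfderiv IM (𝓘(ℝ, E).prod 𝓘(ℝ, K'))
      (fun m => (⟨b m, β m⟩ : TotalSpace K' W')) m u : E × K').1 = v :=
    (mfderiv_map_fst (f := fun m => (⟨b m, β m⟩ : TotalSpace K' W')) hβ u).trans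
      ((mfderiv_map_fst (f := fun m => (⟨b m, α m⟩ : TotalSpace K W)) hα u).symm.trans
      ((congrArg Prod.fst h).trans (lift_fst cov (⟨b m, α m⟩ : TotalSpace K W) w v)))
  obtain ⟨r, hr⟩ := exists_eq_vertLift_add_horLift cov' (⟨b m, β m⟩ : TotalSpace K' W')
    (mfderiv IM (𝓘(ℝ, E).prod 𝓘(ℝ, K')) (fun m => (⟨b m, β m⟩ : TotalSpace K' W')) m u)
  rw [h1] at hr
  exact ⟨r, hr⟩

end Lift

/-- The differential of the relation `ℓ(α) = ⟨β, α⟩ + s H(β)`, split into vertical and horizontal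
parts. -/
lemma verDeriv_add_horDeriv_of_legendre (cov : CovariantDerivative 𝓘(ℝ, E) F V) {s : ℝ}
    {H : TotalSpace (F →L[ℝ] ℝ) (DualFiber V) → ℝ} {ℓ : TotalSpace F V → ℝ}
    {b : M → Q} {α : ∀ m, V (b m)} {β : ∀ m, DualFiber V (b m)} {m : M}
    (hα : MDifferentiableAt IM (𝓘(ℝ, E).prod 𝓘(ℝ, F)) (fun m => (⟨b m, α m⟩ : TotalSpace F V)) m)
    (hβ : MDifferentiableAt IM (𝓘(ℝ, E).prod 𝓘(ℝ, F →L[ℝ] ℝ))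
      (fun m => (⟨b m, β m⟩ : TotalSpace (F →L[ℝ] ℝ) (DualFiber V))) m)
    (hH : MDifferentiableAt (𝓘(ℝ, E).prod 𝓘(ℝ, F →L[ℝ] ℝ)) 𝓘(ℝ, ℝ) H ⟨b m, β m⟩)
    (hℓ : MDifferentiableAt (𝓘(ℝ, E).prod 𝓘(ℝ, F)) 𝓘(ℝ, ℝ) ℓ ⟨b m, α m⟩)
    (hrel : ∀ m, ℓ ⟨b m, α m⟩ = β m (α m) + s * H ⟨b m, β m⟩)
    {u : TangentSpace IM m} {v : TangentSpace 𝓘(ℝ, E) (b m)} {w : V (b m)} {r : DualFiber V (b m)}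
    (h1 : (mfderiv IM (𝓘(ℝ, E).prod 𝓘(ℝ, F)) (fun m => (⟨b m, α m⟩ : TotalSpace F V)) m u : E × F) =
      (vertLift (E := E) (⟨b m, α m⟩ : TotalSpace F V) w +
        horLift cov (⟨b m, α m⟩ : TotalSpace F V) v : E × F))
    (h2 : (mfderiv IM (𝓘(ℝ, E).prod 𝓘(ℝ, F →L[ℝ] ℝ))
        (fun m => (⟨b m, β m⟩ : TotalSpace (F →L[ℝ] ℝ) (DualFiber V))) m u : E × (F →L[ℝ] ℝ)) =
      (vertLift (E := E) (⟨b m, β m⟩ : TotalSpace (F →L[ℝ] ℝ) (DualFiber V)) r +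
        horLift (dualCov cov) (⟨b m, β m⟩ : TotalSpace (F →L[ℝ] ℝ) (DualFiber V)) v :
        E × (F →L[ℝ] ℝ))) :
    verDeriv (E := E) ℓ ⟨b m, α m⟩ w + horDeriv cov ℓ ⟨b m, α m⟩ v =
      (r (α m) + β m w) + s * (verDeriv (E := E) H ⟨b m, β m⟩ r +
        horDeriv (dualCov cov) H ⟨b m, β m⟩ v) := by
  -- The parameter manifold `M` is `A*` when starting from `H` and `A` when starting from `ℓ`; one
  -- computation covers both cases.
  have h3 := mvfderiv_comp_lift cov hα hℓ h1
  have h4 := mvfderiv_comp_lift (dualCov cov) hβ hH h2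
  have h5 := mvfderiv_pairing cov hα hβ h1 h2
  have h6 : MDifferentiableAt IM 𝓘(ℝ, ℝ) (fun m => β m (α m)) m :=
    ((mdifferentiableAt_totalSpace 𝓘(ℝ, E) _).1
      (MDifferentiableAt.clm_bundle_apply (F₂ := ℝ) (E₂ := fun _ : Q => ℝ)
        (b := b) (ϕ := β) (v := α) hβ hα)).2
  have h7 : HasMFDerivAt IM 𝓘(ℝ, ℝ) (fun m => β m (α m) + s * H ⟨b m, β m⟩) m
      (mvfderiv IM (fun m => β m (α m)) m + s • mvfderiv IM (fun m => H ⟨b m, β m⟩) m) :=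
    h6.hasMFDerivAt.add ((hH.comp m hβ).hasMFDerivAt.const_smul s)
  rw [← h3, ← h4, ← h5]
  have h8 : (fun m => ℓ ⟨b m, α m⟩) = fun m => β m (α m) + s * H ⟨b m, β m⟩ := funext hrel
  rw [h8]
  exact mvfderiv_apply_of_hasMFDerivAt h7 u

lemma exists_mfderiv_eq {EN : Type*} [NormedAddCommGroup EN] [NormedSpace ℝ EN]
    {HN : Type*} [TopologicalSpace HN] {IN : ModelWithCorners ℝ EN HN}
    {N : Type*} [TopologicalSpace N] [ChartedSpace HN N] (Φ : Diffeomorph IM IN M N ∞) (m : M)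
    (y : TangentSpace IN (Φ m)) : ∃ u : TangentSpace IM m, mfderiv IM IN Φ m u = y :=
  (Φ.mfderivToContinuousLinearEquiv (by simp) m).surjective y

variable (cov : CovariantDerivative 𝓘(ℝ, E) F V) {s : ℝ}
    {H : TotalSpace (F →L[ℝ] ℝ) (DualFiber V) → ℝ} {ℓ : TotalSpace F V → ℝ}

/-- `H` and `ℓ` are related by the Legendre transformation: they are smooth, the fibre derivatives
are mutually inverse, and the horizontal differentials agree up to the sign. -/
def IsLegendrePair (s : ℝ) (H : TotalSpace (F →L[ℝ] ℝ) (DualFiber V) → ℝ)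
    (ℓ : TotalSpace F V → ℝ) : Prop :=
  ContMDiff (𝓘(ℝ, E).prod 𝓘(ℝ, F →L[ℝ] ℝ)) 𝓘(ℝ, ℝ) ∞ H ∧
  ContMDiff (𝓘(ℝ, E).prod 𝓘(ℝ, F)) 𝓘(ℝ, ℝ) ∞ ℓ ∧
  ∀ (x : Q) (a : V x) (p : DualFiber V x),
    (a = -s • verDerivDual (E := E) H ⟨x, p⟩ ↔ p = verDeriv (E := E) ℓ ⟨x, a⟩) ∧
    (p = verDeriv (E := E) ℓ ⟨x, a⟩ →
      horDeriv cov ℓ ⟨x, a⟩ = s • horDeriv (dualCov cov) H ⟨x, p⟩)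

lemma apply_smul_verDerivDual (z : TotalSpace (F →L[ℝ] ℝ) (DualFiber V)) (r : DualFiber V z.1) :
    r (-s • verDerivDual (E := E) H z) = -s * verDeriv (E := E) H z r := by
  rw [map_smul, smul_eq_mul]
  exact congrArg (-s * ·) (apply_predual (F := F) z.1 _ r)

/-- The map `α = -s dH^ver` is a diffeomorphism over the identity, since `s * s = 1` makes
multiplication by `-s` an involution. Hence `ℓ` is smooth, and `ℓ(α(p)) = ⟨p, α(p)⟩ + s H(p)` can be
differentiated in every direction of `A`. -/
lemma isLegendrePair_of_hamiltonian (hs : s * s = 1)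
    (hH : ContMDiff (𝓘(ℝ, E).prod 𝓘(ℝ, F →L[ℝ] ℝ)) 𝓘(ℝ, ℝ) ∞ H)
    (hreg : IsHyperregularHamiltonian E H) (hrel : IsLagrangianOf E s H ℓ) :
    IsLegendrePair cov s H ℓ := by
  obtain ⟨Φ, hΦ⟩ := hreg
  have hs' : -s * -s = 1 := by rw [neg_mul_neg, hs]
  let D : Diffeomorph (𝓘(ℝ, E).prod 𝓘(ℝ, F)) (𝓘(ℝ, E).prod 𝓘(ℝ, F))
      (TotalSpace F V) (TotalSpace F V) ∞ :=
    { toFun := fun z => ⟨z.1, -s • z.2⟩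
      invFun := fun z => ⟨z.1, -s • z.2⟩
      left_inv := fun z => by simp only [smul_smul, hs', one_smul]
      right_inv := fun z => by simp only [smul_smul, hs', one_smul]
      contMDiff_toFun := contMDiff_fiberwise_smul (-s)
      contMDiff_invFun := contMDiff_fiberwise_smul (-s) }
  let Ψ := Φ.trans D
  let α : ∀ z : TotalSpace (F →L[ℝ] ℝ) (DualFiber V), V z.1 := fun z =>
    -s • verDerivDual (E := E) H z
  have hΨ : ⇑Ψ = fun z => (⟨z.1, α z⟩ : TotalSpace F V) := funext fun z => congrArg D (hΦ z)
  have hα : ContMDiff (𝓘(ℝ, E).prod 𝓘(ℝ, F →L[ℝ] ℝ)) (𝓘(ℝ, E).prod 𝓘(ℝ, F)) ∞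
      (fun z => (⟨z.1, α z⟩ : TotalSpace F V)) := hΨ ▸ Ψ.contMDiff
  have hβ : ContMDiff (𝓘(ℝ, E).prod 𝓘(ℝ, F →L[ℝ] ℝ)) (𝓘(ℝ, E).prod 𝓘(ℝ, F →L[ℝ] ℝ)) ∞
      (fun z : TotalSpace (F →L[ℝ] ℝ) (DualFiber V) =>
        (⟨z.1, z.2⟩ : TotalSpace (F →L[ℝ] ℝ) (DualFiber V))) := contMDiff_id
  have hℓΨ : ∀ z : TotalSpace (F →L[ℝ] ℝ) (DualFiber V),
      ℓ ⟨z.1, α z⟩ = z.2 (α z) + s * H ⟨z.1, z.2⟩ := fun z => hrel z.1 z.2 _ rfl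
  have hℓ : ContMDiff (𝓘(ℝ, E).prod 𝓘(ℝ, F)) 𝓘(ℝ, ℝ) ∞ ℓ := by
    have h1 : ContMDiff (𝓘(ℝ, E).prod 𝓘(ℝ, F →L[ℝ] ℝ)) 𝓘(ℝ, ℝ) ∞ (ℓ ∘ Ψ) := by
      rw [hΨ, show (ℓ ∘ fun z => (⟨z.1, α z⟩ : TotalSpace F V)) = _ from funext hℓΨ]
      exact (contMDiff_pairing hα hβ).add (contMDiff_const.mul hH)
    have h2 : ℓ = (ℓ ∘ Ψ) ∘ Ψ.symm := funext fun z => by simp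
    rw [h2]
    exact h1.comp Ψ.symm.contMDiff
  have key : ∀ z : TotalSpace (F →L[ℝ] ℝ) (DualFiber V),
      z.2 = verDeriv (E := E) ℓ ⟨z.1, α z⟩ ∧
      horDeriv cov ℓ ⟨z.1, α z⟩ = s • horDeriv (dualCov cov) H z := by
    intro z
    -- Every pair `w`, `v` arises from some tangent vector of `A*`. Its vertical part `r` is not
    -- controlled, but contributes `⟨r, α⟩ + s ⟨r, dH^ver⟩ = 0`. Setting `v = 0` or `w = 0` then
    -- separates the two identities.
    have h : ∀ (w : V z.1) (v : TangentSpace 𝓘(ℝ, E) z.1),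
        verDeriv (E := E) ℓ ⟨z.1, α z⟩ w + horDeriv cov ℓ ⟨z.1, α z⟩ v =
          z.2 w + s * horDeriv (dualCov cov) H z v := by
      intro w v
      obtain ⟨u, hu⟩ := exists_mfderiv_eq Ψ z
        (vertLift (E := E) (⟨z.1, α z⟩ : TotalSpace F V) w +
          horLift cov (⟨z.1, α z⟩ : TotalSpace F V) v : E × F)
      rw [hΨ] at hu
      obtain ⟨r, hr⟩ := exists_mfderiv_eq_of_same_base (K := F) (W := V)
        (K' := F →L[ℝ] ℝ) (W' := DualFiber V) cov (dualCov cov)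
        (hα.mdifferentiable (by simp) z) (hβ.mdifferentiable (by simp) z) hu
      have h2 := verDeriv_add_horDeriv_of_legendre cov (hα.mdifferentiable (by simp) z)
        (hβ.mdifferentiable (by simp) z) (hH.mdifferentiable (by simp) _)
        (hℓ.mdifferentiable (by simp) _) hℓΨ hu hr
      have h3 := apply_smul_verDerivDual (E := E) (F := F) (V := V) (s := s) (H := H) z r
      refine h2.trans ?_
      simp only [α, h3]
      ring
    constructor
    · ext w
      simpa using (h w 0).symm
    · ext v
      simpa using h 0 v
  have hfwd : ∀ (x : Q) (a : V x) (p : DualFiber V x), a = -s • verDerivDual (E := E) H ⟨x, p⟩ →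
      p = verDeriv (E := E) ℓ ⟨x, a⟩ := fun x a p h => by
    subst h
    exact (key ⟨x, p⟩).1
  have hbwd : ∀ (x : Q) (a : V x) (p : DualFiber V x), p = verDeriv (E := E) ℓ ⟨x, a⟩ →
      a = -s • verDerivDual (E := E) H ⟨x, p⟩ := fun x a p h => by
    obtain ⟨⟨y, p'⟩, hz⟩ := Ψ.surjective ⟨x, a⟩
    replace hz := (congrFun hΨ ⟨y, p'⟩).symm.trans hz
    obtain rfl : y = x := congrArg TotalSpace.proj hz
    have ha : α ⟨y, p'⟩ = a := by simpa using hz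
    rw [h, ← hfwd y a p' ha.symm]
    exact ha.symm
  refine ⟨hH, hℓ, fun x a p => ⟨⟨hfwd x a p, hbwd x a p⟩, fun h => ?_⟩⟩
  rw [hbwd x a p h]
  exact (key ⟨x, p⟩).2

/-- Here directions in `A*` are prescribed, with arbitrary vertical part `r`. The uncontrolled
vertical part `w` in `A` contributes `dℓ^ver(w)` on both sides and cancels, which leaves `dℓ^hor(v)
= ⟨r, a⟩ + s (dH^ver(r) + dH^hor(v))`. -/
lemma isLegendrePair_of_lagrangian (hs : s * s = 1)
    (hℓ : ContMDiff (𝓘(ℝ, E).prod 𝓘(ℝ, F)) 𝓘(ℝ, ℝ) ∞ ℓ)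
    (hreg : IsHyperregularLagrangian E ℓ) (hrel : IsHamiltonianOf E s ℓ H) :
    IsLegendrePair cov s H ℓ := by
  obtain ⟨Φ, hΦ⟩ := hreg
  have hΦ' : ⇑Φ = fun z => (⟨z.1, verDeriv (E := E) ℓ z⟩ :
    TotalSpace (F →L[ℝ] ℝ) (DualFiber V)) := funext hΦ
  have hβ : ContMDiff (𝓘(ℝ, E).prod 𝓘(ℝ, F)) (𝓘(ℝ, E).prod 𝓘(ℝ, F →L[ℝ] ℝ)) ∞
      (fun z => (⟨z.1, verDeriv (E := E) ℓ z⟩ : TotalSpace (F →L[ℝ] ℝ) (DualFiber V))) :=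
    hΦ' ▸ Φ.contMDiff
  have hα : ContMDiff (𝓘(ℝ, E).prod 𝓘(ℝ, F)) (𝓘(ℝ, E).prod 𝓘(ℝ, F)) ∞
      (fun z : TotalSpace F V => (⟨z.1, z.2⟩ : TotalSpace F V)) := contMDiff_id
  have hHΦ : ∀ z : TotalSpace F V, H ⟨z.1, verDeriv (E := E) ℓ z⟩ =
      -s * (verDeriv (E := E) ℓ z z.2 - ℓ z) := fun z => hrel z.1 z.2 _ rfl
  have hℓΦ : ∀ z : TotalSpace F V, ℓ ⟨z.1, z.2⟩ =
      verDeriv (E := E) ℓ z z.2 + s * H ⟨z.1, verDeriv (E := E) ℓ z⟩ := fun z => by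
    rw [hHΦ z]
    linear_combination (verDeriv (E := E) ℓ z z.2 - ℓ z) * hs
  have hH : ContMDiff (𝓘(ℝ, E).prod 𝓘(ℝ, F →L[ℝ] ℝ)) 𝓘(ℝ, ℝ) ∞ H := by
    have h1 : ContMDiff (𝓘(ℝ, E).prod 𝓘(ℝ, F)) 𝓘(ℝ, ℝ) ∞ (H ∘ Φ) := by
      rw [hΦ', show (H ∘ fun z => (⟨z.1, verDeriv (E := E) ℓ z⟩ :
        TotalSpace (F →L[ℝ] ℝ) (DualFiber V))) = _ from funext hHΦ]
      exact contMDiff_const.mul ((contMDiff_pairing hα hβ).sub hℓ)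
    have h2 : H = (H ∘ Φ) ∘ Φ.symm := funext fun z => by simp
    rw [h2]
    exact h1.comp Φ.symm.contMDiff
  have key : ∀ z : TotalSpace F V,
      z.2 = -s • verDerivDual (E := E) H ⟨z.1, verDeriv (E := E) ℓ z⟩ ∧
      horDeriv cov ℓ z = s • horDeriv (dualCov cov) H ⟨z.1, verDeriv (E := E) ℓ z⟩ := by
    intro z
    set ζ : TotalSpace (F →L[ℝ] ℝ) (DualFiber V) := ⟨z.1, verDeriv (E := E) ℓ z⟩ with hζ
    have h : ∀ (r : DualFiber V z.1) (v : TangentSpace 𝓘(ℝ, E) z.1),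
        horDeriv cov ℓ z v = r z.2 + s * (verDeriv (E := E) H ζ r +
          horDeriv (dualCov cov) H ζ v) := by
      intro r v
      obtain ⟨u, hu⟩ := exists_mfderiv_eq Φ z
        (vertLift (E := E) ζ r + horLift (dualCov cov) ζ v : E × (F →L[ℝ] ℝ))
      rw [hΦ'] at hu
      obtain ⟨w, hw⟩ := exists_mfderiv_eq_of_same_base (K := F →L[ℝ] ℝ) (W := DualFiber V)
        (K' := F) (W' := V) (dualCov cov) cov
        (hβ.mdifferentiable (by simp) z) (hα.mdifferentiable (by simp) z) hu
      have h2 := verDeriv_add_horDeriv_of_legendre cov (hα.mdifferentiable (by simp) z)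
        (hβ.mdifferentiable (by simp) z) (hH.mdifferentiable (by simp) _)
        (hℓ.mdifferentiable (by simp) _) hℓΦ hw hu
      linarith
    have h0 : ∀ r : DualFiber V z.1, r z.2 + s * verDeriv (E := E) H ζ r = 0 := fun r => by
      simpa using (h r 0).symm
    constructor
    · refine eq_of_forall_dual_section (E := E) (K := F) z.1 fun σ => ?_
      refine Eq.trans ?_ (apply_smul_verDerivDual (E := E) (F := F) (V := V) (s := s) (H := H) ζ (σ z.1)).symm
      linarith [h0 (σ z.1)]
    · ext v
      simpa using h 0 v
  have hfwd : ∀ (x : Q) (a : V x) (p : DualFiber V x), p = verDeriv (E := E) ℓ ⟨x, a⟩ →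
      a = -s • verDerivDual (E := E) H ⟨x, p⟩ := fun x a p h => by
    subst h
    exact (key ⟨x, a⟩).1
  refine ⟨hH, hℓ, fun x a p => ⟨⟨fun h => ?_, hfwd x a p⟩, fun h => ?_⟩⟩
  -- Surjectivity gives `p = dℓ^ver(a')`; the implication already proved yields `a' = -s dH^ver(p) =
  -- a`.
  · obtain ⟨⟨y, a'⟩, hz⟩ := Φ.surjective ⟨x, p⟩
    replace hz := (hΦ ⟨y, a'⟩).symm.trans hz
    obtain rfl : y = x := congrArg TotalSpace.proj hz
    have hp : verDeriv (E := E) ℓ ⟨y, a'⟩ = p := by simpa using hz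
    rw [h, ← hfwd y a' p hp.symm, hp]
  · subst h
    exact (key ⟨x, a⟩).2

end Hyperregular

end LieAlgebroidMechanics

end

/-! ### The equivalence theorem -/

theorem mainTheorem3
    {E : Type*} [NormedAddCommGroup E] [NormedSpace ℝ E] [FiniteDimensional ℝ E]
    {Q : Type*} [TopologicalSpace Q] [ChartedSpace E Q] [IsManifold 𝓘(ℝ, E) ∞ Q]
    [T2Space Q] [SecondCountableTopology Q]
    {F : Type*} [NormedAddCommGroup F] [NormedSpace ℝ F] [FiniteDimensional ℝ F]
    {V : Q → Type*} [TopologicalSpace (TotalSpace F V)]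
    [∀ x, AddCommGroup (V x)] [∀ x, Module ℝ (V x)] [∀ x, TopologicalSpace (V x)]
    [∀ x, IsTopologicalAddGroup (V x)] [∀ x, ContinuousSMul ℝ (V x)]
    [FiberBundle F V] [VectorBundle ℝ F V] [ContMDiffVectorBundle ∞ F V 𝓘(ℝ, E)]
    (A : LieAlgebroid E F V)
    (cov : CovariantDerivative 𝓘(ℝ, E) F V)
    [CovariantDerivative.ContMDiffCovariantDerivative cov ∞]
    (s : ℝ) (hs : s = 1 ∨ s = -1)
    (t₀ t₁ : ℝ) (ht : t₀ < t₁)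
    (q : ℝ → Q) (a : ∀ t, V (q t)) (p : ∀ t, DualFiber V (q t))
    (hap : A.IsSumPath (Icc t₀ t₁) (sumPath q a p)) :
    (∀ H : TotalSpace (F →L[ℝ] ℝ) (DualFiber V) → ℝ,
      ContMDiff (𝓘(ℝ, E).prod 𝓘(ℝ, F →L[ℝ] ℝ)) 𝓘(ℝ, ℝ) ∞ H →
      (HamiltonPrinciple A cov t₀ t₁ q a p s H ↔
        LiePoissonEquations A cov t₀ t₁ q a p s H)) ∧
    (∀ ℓ : TotalSpace F V → ℝ, ContMDiff (𝓘(ℝ, E).prod 𝓘(ℝ, F)) 𝓘(ℝ, ℝ) ∞ ℓ →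
      ((LagrangePrinciple A cov t₀ t₁ q a ℓ ∧ IsLegendrePath E t₀ t₁ q a p ℓ) ↔
        (EulerLagrangePoincareEquations A cov t₀ t₁ q a p ℓ ∧
          IsLegendrePath E t₀ t₁ q a p ℓ))) ∧
    (∀ (H : TotalSpace (F →L[ℝ] ℝ) (DualFiber V) → ℝ) (ℓ : TotalSpace F V → ℝ),
      (ContMDiff (𝓘(ℝ, E).prod 𝓘(ℝ, F →L[ℝ] ℝ)) 𝓘(ℝ, ℝ) ∞ H ∧
          IsHyperregularHamiltonian E H ∧ IsLagrangianOf E s H ℓ) ∨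
        (ContMDiff (𝓘(ℝ, E).prod 𝓘(ℝ, F)) 𝓘(ℝ, ℝ) ∞ ℓ ∧
          IsHyperregularLagrangian E ℓ ∧ IsHamiltonianOf E s ℓ H) →
      List.TFAE
        [HamiltonPrinciple A cov t₀ t₁ q a p s H,
          LiePoissonEquations A cov t₀ t₁ q a p s H,
          LagrangePrinciple A cov t₀ t₁ q a ℓ ∧ IsLegendrePath E t₀ t₁ q a p ℓ,
          EulerLagrangePoincareEquations A cov t₀ t₁ q a p ℓ ∧
            IsLegendrePath E t₀ t₁ q a p ℓ]) := by
  have hs' : s * s = 1 := by rcases hs with rfl | rfl <;> norm_num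
  refine ⟨fun H hH => A.hamiltonPrinciple_iff cov ht hap s hH,
    fun ℓ hℓ => and_congr_left fun h => A.lagrangePrinciple_iff cov ht hap hℓ h,
    fun H ℓ h => ?_⟩
  have hpair : IsLegendrePair cov s H ℓ := by
    rcases h with ⟨hH, hreg, hrel⟩ | ⟨hℓ, hreg, hrel⟩
    · exact isLegendrePair_of_hamiltonian cov hs' hH hreg hrel
    · exact isLegendrePair_of_lagrangian cov hs' hℓ hreg hrel
  obtain ⟨hH, hℓ, hleg⟩ := hpair
  -- For a Legendre pair the two relations between `a` and `p` are equivalent, and under them the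
  -- right sides of the two evolution equations agree, so no variational argument is needed here.
  have h24 : LiePoissonEquations A cov t₀ t₁ q a p s H ↔
      EulerLagrangePoincareEquations A cov t₀ t₁ q a p ℓ ∧ IsLegendrePath E t₀ t₁ q a p ℓ := by
    constructor
    · intro h
      have hp : IsLegendrePath E t₀ t₁ q a p ℓ := fun t htJ => (hleg _ _ _).1.1 (h t htJ).2
      refine ⟨fun t htJ => ?_, hp⟩
      rw [(h t htJ).1, (hleg _ _ _).2 (hp t htJ), ContinuousLinearMap.smul_comp]
    · rintro ⟨h, hp⟩ t htJ
      refine ⟨?_, (hleg _ _ _).1.2 (hp t htJ)⟩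
      rw [h t htJ, (hleg _ _ _).2 (hp t htJ), ContinuousLinearMap.smul_comp]
  tfae_have 1 ↔ 2 := A.hamiltonPrinciple_iff cov ht hap s hH
  tfae_have 2 ↔ 4 := h24
  tfae_have 3 ↔ 4 := and_congr_left fun h => A.lagrangePrinciple_iff cov ht hap hℓ h
  tfae_finish
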